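/- **Setting.** A *majorant* is a positive, non-increasing, convex, differentiable function $\Lambda$ on $(0,1]$ with $\Lambda(0^+)=+\infty$ such that: $t\Lambda(t)$ (with value $0$ at $t=0$) is continuous, non-decreasing and concave on $[0,1]$; $t^{\alpha}\Lambda(t)$ is non-decreasing for some $\alpha\in(0,1)$; and $\Lambda(t^2)\le C\Lambda(t)$ for some constant $C$. For $c>0$ let $\mathcal A_\Lambda^{-c}$ be the Banach space of holomorphic functions $f$ on the unit disc $\mathbb D$ with $\|f\|_c=\sup_{z\in\mathbb D}|f(z)|e^{-c\Lambda(1-|z|)}<\infty$, and let $\mathcal A_\Lambda^{-\infty}=\bigcup_{c>0}\mathcal A_\Lambda^{-c}$ carry the locally convex inductive limit topology (the finest locally convex topology making all inclusions $\mathcal A_\Lambda^{-c}\hookrightarrow\mathcal A_\Lambda^{-\infty}$ continuous). A function $f\in\mathcal A_\Lambda^{-\infty}$ is *cyclic* if the closed linear span of $\{pf: p \text{ a polynomial}\}$ is all of $\mathcal A_\Lambda^{-\infty}$. Let $\mathcal B(\mathbb T)$ be the set of all arcs of the unit circle $\mathbb T$ (open, half-open or closed, including single points, $\emptyset$ and $\mathbb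 T$), and let $|\cdot|$ be normalized Lebesgue measure. A *premeasure* is a function $\mu:\mathcal B(\mathbb T)\to\mathbb R$ with $\mu(\mathbb T)=0$, with $\mu(I_1\cup I_2)=\mu(I_1)+\mu(I_2)$ whenever $I_1,I_2,I_1\cup I_2\in\mathcal B(\mathbb T)$ and $I_1\cap I_2=\emptyset$, and with $\mu(I_n)\to0$ whenever $I_{n+1}\subset I_n$ for all $n$ and $\bigcap_n I_n=\emptyset$. It is *$\Lambda$-bounded* if for some $C>0$ one has $\mu(I)\le C|I|\Lambda(|I|)$ for all arcs $I$ (the right side being $0$ if $|I|=0$). With $\hat\mu(\theta)=\mu(\{e^{it}:0\le t<\theta\})$, put $\int_{\mathbb T}g\,d\mu=\int_0^{2\pi}g(e^{i\theta})\,d\hat\mu(\theta)=-\int_0^{2\pi}\frac{d}{d\theta}\big[g(e^{i\theta})\big]\hat\mu(\theta)\,d\theta$ for $g\in C^1(\mathbb T)$. A closed set $F\subset\mathbb T$ is a *$\Lambda$-Carleson set* if $F\neq\emptyset$, $|F|=0$ and $\sum_n|I_n|\Lambda(|I_n|)<\infty$, where $\{I_n\}$ are the component arcs of $\mathbb T\setminus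 F$. The *$\Lambda$-singular part* of a $\Lambda$-bounded premeasure $\mu$ is given on $\Lambda$-Carleson sets by $\mu_s(F)=-\sum_n\mu(I_n)$. **Theorem.** Let $\Lambda$ be a majorant and let $f\in\mathcal A_\Lambda^{-\infty}$ be zero-free with $f(0)=1$. Then there is a $\Lambda$-bounded premeasure $\mu_f$ such that $$f(z)=\exp\int_{\mathbb T}\frac{e^{i\theta}+z}{e^{i\theta}-z}\,d\mu_f(\theta),\qquad z\in\mathbb D,$$ and if, for such a premeasure, $(\mu_f)_s(F)=0$ for every $\Lambda$-Carleson set $F$, then $f$ is cyclic in $\mathcal A_\Lambda^{-\infty}$. -/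

import Mathlib

open Set Filter Topology MeasureTheory Complex.UnitDisc

noncomputable section

namespace KorenblumType

/-! ### Majorants -/

/-- A majorant: a positive, non-increasing, convex, differentiable function `Λ` on `(0, 1]` with
`Λ(0+) = +∞`, such that `t Λ(t)` (with value `0` at `t = 0`, as `0 * Λ 0 = 0`) is continuous,
non-decreasing and concave on `[0, 1]`, `t ^ α Λ(t)` is non-decreasing for some `α ∈ (0, 1)`,
and `Λ(t²) ≤ C Λ(t)`. The values of `Λ` outside `(0, 1]` are irrelevant. -/
structure Majorant where
  toFun : ℝ → ℝ
  pos : ∀ t ∈ Ioc (0 : ℝ) 1, 0 < toFun t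
  antitoneOn : AntitoneOn toFun (Ioc 0 1)
  convexOn : ConvexOn ℝ (Ioc 0 1) toFun
  differentiableOn : DifferentiableOn ℝ toFun (Ioc 0 1)
  tendsto_atTop : Tendsto toFun (𝓝[>] 0) atTop
  continuousOn_mul : ContinuousOn (fun t => t * toFun t) (Icc 0 1)
  monotoneOn_mul : MonotoneOn (fun t => t * toFun t) (Icc 0 1)
  concaveOn_mul : ConcaveOn ℝ (Icc 0 1) (fun t => t * toFun t)
  tendsto_mul_zero : Tendsto (fun t => t * toFun t) (𝓝[>] 0) (𝓝 0)
  exists_rpow : ∃ α ∈ Ioo (0 : ℝ) 1, MonotoneOn (fun t => t ^ α * toFun t) (Ioc 0 1)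
  exists_sq : ∃ C : ℝ, ∀ t ∈ Ioc (0 : ℝ) 1, toFun (t ^ 2) ≤ C * toFun t

instance : CoeFun Majorant (fun _ => ℝ → ℝ) := ⟨Majorant.toFun⟩

/-! ### The spaces of analytic functions -/

/-- The space of holomorphic functions on the open unit disc. -/
def hol : Submodule ℂ (𝔻 → ℂ) where
  carrier := {f | ∃ F : ℂ → ℂ, DifferentiableOn ℂ F (Metric.ball 0 1) ∧ ∀ z : 𝔻, f z = F z}
  zero_mem' := ⟨fun _ => 0, differentiableOn_const 0, fun _ => rfl⟩
  add_mem' := by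
    rintro f g ⟨F, hF, hf⟩ ⟨G, hG, hg⟩
    exact ⟨fun z => F z + G z, hF.add hG, fun z => by simp [hf, hg]⟩
  smul_mem' := by
    rintro a f ⟨F, hF, hf⟩
    exact ⟨fun z => a * F z, hF.const_mul a, fun z => by simp [hf]⟩

lemma one_sub_norm_mem (z : 𝔻) : 1 - ‖(z : ℂ)‖ ∈ Ioc (0 : ℝ) 1 :=
  ⟨sub_pos.2 z.norm_lt_one, sub_le_self _ (norm_nonneg _)⟩

/-- The holomorphic functions `f` on the disc with `|f(z)| ≤ C exp (c Λ(1 - |z|))` for some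
constant `C`, i.e. with finite weighted supremum norm. -/
def growthSubmodule (Λ : Majorant) (c : ℝ) : Submodule ℂ (𝔻 → ℂ) where
  carrier := {f | f ∈ hol ∧ ∃ C : ℝ, ∀ z : 𝔻, ‖f z‖ ≤ C * Real.exp (c * Λ (1 - ‖(z : ℂ)‖))}
  zero_mem' := ⟨hol.zero_mem, 0, fun z => by simp⟩
  add_mem' := by
    rintro f g ⟨hf, C, hC⟩ ⟨hg, D, hD⟩
    refine ⟨hol.add_mem hf hg, C + D, fun z => (norm_add_le _ _).trans ?_⟩
    rw [add_mul]
    exact add_le_add (hC z) (hD z)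
  smul_mem' := by
    rintro a f ⟨hf, C, hC⟩
    refine ⟨hol.smul_mem a hf, ‖a‖ * C, fun z => ?_⟩
    rw [Pi.smul_apply, norm_smul, mul_assoc]
    exact mul_le_mul_of_nonneg_left (hC z) (norm_nonneg a)

/-- The Banach space `A_Λ^{-c}`. (A new type, so that it does not carry the topology of pointwise
convergence.) -/
def GrowthSpace (Λ : Majorant) (c : ℝ) : Type := ↥(growthSubmodule Λ c)

instance (Λ : Majorant) (c : ℝ) : AddCommGroup (GrowthSpace Λ c) :=
  inferInstanceAs (AddCommGroup ↥(growthSubmodule Λ c))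

instance (Λ : Majorant) (c : ℝ) : Module ℂ (GrowthSpace Λ c) :=
  inferInstanceAs (Module ℂ ↥(growthSubmodule Λ c))

/-- The underlying function on the disc. -/
def GrowthSpace.toFun {Λ : Majorant} {c : ℝ} (f : GrowthSpace Λ c) : 𝔻 → ℂ :=
  (show ↥(growthSubmodule Λ c) from f).1

instance (Λ : Majorant) (c : ℝ) : CoeFun (GrowthSpace Λ c) (fun _ => 𝔻 → ℂ) :=
  ⟨GrowthSpace.toFun⟩

lemma GrowthSpace.bddAbove {Λ : Majorant} {c : ℝ} (f : GrowthSpace Λ c) :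
    BddAbove (range fun z : 𝔻 => ‖f z‖ * Real.exp (-(c * Λ (1 - ‖(z : ℂ)‖)))) := by
  obtain ⟨C, hC⟩ := f.2.2
  refine ⟨C, ?_⟩
  rintro _ ⟨z, rfl⟩
  calc ‖f z‖ * Real.exp (-(c * Λ (1 - ‖(z : ℂ)‖)))
      ≤ C * Real.exp (c * Λ (1 - ‖(z : ℂ)‖)) * Real.exp (-(c * Λ (1 - ‖(z : ℂ)‖))) :=
        mul_le_mul_of_nonneg_right (hC z) (Real.exp_pos _).le
    _ = C := by rw [mul_assoc, ← Real.exp_add, add_neg_cancel, Real.exp_zero, mul_one]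

/-- The norm `‖f‖ = sup_z |f(z)| exp (-c Λ(1 - |z|))` of `A_Λ^{-c}`. -/
def GrowthSpace.addGroupNorm (Λ : Majorant) (c : ℝ) : AddGroupNorm (GrowthSpace Λ c) where
  toFun f := ⨆ z : 𝔻, ‖f z‖ * Real.exp (-(c * Λ (1 - ‖(z : ℂ)‖)))
  map_zero' := by
    have h : ∀ z : 𝔻, (0 : GrowthSpace Λ c) z = 0 := fun _ => rfl
    simp [h]
  add_le' f g := by
    refine ciSup_le fun z => ?_
    have h : (f + g : GrowthSpace Λ c) z = f z + g z := rfl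
    have hf := le_ciSup f.bddAbove z
    have hg := le_ciSup g.bddAbove z
    refine le_trans ?_ (add_le_add hf hg)
    rw [h, ← add_mul]
    exact mul_le_mul_of_nonneg_right (norm_add_le _ _) (Real.exp_pos _).le
  neg' f := by
    have h : ∀ z, (-f : GrowthSpace Λ c) z = -f z := fun _ => rfl
    simp [h]
  eq_zero_of_map_eq_zero' f hf := by
    refine Subtype.ext (funext fun z => ?_)
    have hz := le_ciSup f.bddAbove z
    rw [hf] at hz
    have : ‖f z‖ ≤ 0 := nonpos_of_mul_nonpos_left hz (Real.exp_pos _)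
    exact norm_le_zero_iff.1 this

instance (Λ : Majorant) (c : ℝ) : NormedAddCommGroup (GrowthSpace Λ c) :=
  (GrowthSpace.addGroupNorm Λ c).toNormedAddCommGroup

/-- The union over `c > 0` of the spaces `A_Λ^{-c}`, as a space of functions. -/
def korenblumSubmodule (Λ : Majorant) : Submodule ℂ (𝔻 → ℂ) where
  carrier := {f | ∃ c : ℝ, 0 < c ∧ f ∈ growthSubmodule Λ c}
  zero_mem' := ⟨1, one_pos, Submodule.zero_mem _⟩
  add_mem' := by
    have key : ∀ {c d : ℝ} {f : 𝔻 → ℂ}, c ≤ d → f ∈ growthSubmodule Λ c →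
        f ∈ growthSubmodule Λ d := by
      rintro c d f hcd ⟨hf, C, hC⟩
      refine ⟨hf, |C|, fun z => (hC z).trans ?_⟩
      have h := (Λ.pos _ (one_sub_norm_mem z)).le
      exact mul_le_mul (le_abs_self C)
        (Real.exp_le_exp.2 (mul_le_mul_of_nonneg_right hcd h)) (Real.exp_pos _).le (abs_nonneg C)
    rintro f g ⟨c, hc, hf⟩ ⟨d, hd, hg⟩
    exact ⟨max c d, lt_max_of_lt_left hc,
      Submodule.add_mem _ (key (le_max_left c d) hf) (key (le_max_right c d) hg)⟩
  smul_mem' := by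
    rintro a f ⟨c, hc, hf⟩
    exact ⟨c, hc, Submodule.smul_mem _ a hf⟩

/-- The Korenblum type space `A_Λ^{-∞} = ⋃_{c > 0} A_Λ^{-c}`. -/
def KorenblumSpace (Λ : Majorant) : Type := ↥(korenblumSubmodule Λ)

namespace KorenblumSpace

variable (Λ : Majorant)

instance : AddCommGroup (KorenblumSpace Λ) :=
  inferInstanceAs (AddCommGroup ↥(korenblumSubmodule Λ))

instance : Module ℂ (KorenblumSpace Λ) :=
  inferInstanceAs (Module ℂ ↥(korenblumSubmodule Λ))

/-- The underlying function on the disc. -/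
def toFun {Λ : Majorant} (f : KorenblumSpace Λ) : 𝔻 → ℂ :=
  (show ↥(korenblumSubmodule Λ) from f).1

instance : CoeFun (KorenblumSpace Λ) (fun _ => 𝔻 → ℂ) := ⟨toFun⟩

/-- The inclusion `A_Λ^{-c} ↪ A_Λ^{-∞}`. -/
def incl (c : ℝ) (hc : 0 < c) : GrowthSpace Λ c →ₗ[ℂ] KorenblumSpace Λ :=
  Submodule.inclusion (fun _ hf => ⟨c, hc, hf⟩ : growthSubmodule Λ c ≤ korenblumSubmodule Λ)

/-- The locally convex inductive limit topology: the finest locally convex vector space topology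
for which all the inclusions `A_Λ^{-c} ↪ A_Λ^{-∞}`, `c > 0`, are continuous. (In Mathlib's order
finer topologies are smaller; the instances and the lemma below say that the infimum belongs to
the family.) -/
instance : TopologicalSpace (KorenblumSpace Λ) :=
  sInf {t : TopologicalSpace (KorenblumSpace Λ) |
    @IsTopologicalAddGroup (KorenblumSpace Λ) t _ ∧
    @ContinuousSMul ℂ (KorenblumSpace Λ) _ _ t ∧
    @LocallyConvexSpace ℝ (KorenblumSpace Λ) _ _ _ _ t ∧
    ∀ (c : ℝ) (hc : 0 < c), @Continuous _ _ _ t (incl Λ c hc)}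

instance : IsTopologicalAddGroup (KorenblumSpace Λ) :=
  topologicalAddGroup_sInf fun _ ht => ht.1

instance : ContinuousSMul ℂ (KorenblumSpace Λ) :=
  continuousSMul_sInf fun _ ht => ht.2.1

instance : LocallyConvexSpace ℝ (KorenblumSpace Λ) :=
  .sInf fun _ ht => ht.2.2.1

lemma continuous_incl (c : ℝ) (hc : 0 < c) : Continuous (incl Λ c hc) :=
  continuous_sInf_rng.2 fun _ ht => ht.2.2.2 c hc

variable {Λ}

/-- The product `p f` of a polynomial `p` and a function `f ∈ A_Λ^{-∞}`. -/
def polyMul (p : Polynomial ℂ) (f : KorenblumSpace Λ) : KorenblumSpace Λ :=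
  ⟨fun z => p.eval (z : ℂ) * f z, by
    obtain ⟨c, hc, ⟨F, hF, hf⟩, C, hC⟩ := f.2
    refine ⟨c, hc, ⟨fun z => p.eval z * F z, p.differentiable.differentiableOn.mul hF,
      fun z => congrArg (p.eval (z : ℂ) * ·) (hf z)⟩, ?_⟩
    obtain ⟨K, hK⟩ := (isCompact_closedBall (0 : ℂ) 1).exists_bound_of_continuousOn
      p.continuous.continuousOn
    refine ⟨K * C, fun z => ?_⟩
    have hz : ‖p.eval (z : ℂ)‖ ≤ K := hK _ (mem_closedBall_zero_iff.2 z.norm_lt_one.le)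
    rw [norm_mul, mul_assoc]
    exact mul_le_mul hz (hC z) (norm_nonneg _) ((norm_nonneg _).trans hz)⟩

/-- The invariant subspace `[f]`: the closed linear span of all polynomial multiples of `f`. -/
def invariantSubspace (f : KorenblumSpace Λ) : Submodule ℂ (KorenblumSpace Λ) :=
  (Submodule.span ℂ (range fun p : Polynomial ℂ => polyMul p f)).topologicalClosure

/-- `f` is cyclic if `[f]` is the whole space `A_Λ^{-∞}`. -/
def IsCyclicVector (f : KorenblumSpace Λ) : Prop := invariantSubspace f = ⊤

end KorenblumSpace

/-! ### Arcs of the circle -/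

/-- The arcs of the unit circle: the images under `θ ↦ e^{iθ}` of the intervals of the real line
(open, half-open, closed, one-point or empty). The whole circle is among them. -/
def IsArc (I : Set Circle) : Prop := ∃ s : Set ℝ, s.OrdConnected ∧ I = Circle.exp '' s

/-- The set `B(𝕋)` of all arcs. -/
def Arc : Type := {I : Set Circle // IsArc I}

namespace Arc

instance : Coe Arc (Set Circle) := ⟨Subtype.val⟩

/-- The whole circle. -/
def whole : Arc := ⟨univ, univ, ordConnected_univ, by
  rw [image_univ, Circle.exp_surjective.range_eq]⟩

/-- The half-open arc `I_θ = {e^{it} : 0 ≤ t < θ}`. -/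
def initial (θ : ℝ) : Arc := ⟨Circle.exp '' Ico 0 θ, Ico 0 θ, ordConnected_Ico, rfl⟩

end Arc

/-- Normalized Lebesgue measure of a subset of the circle. -/
def circleMeasure (S : Set Circle) : ℝ :=
  volume.real {θ : ℝ | θ ∈ Ico 0 (2 * Real.pi) ∧ Circle.exp θ ∈ S} / (2 * Real.pi)

/-- Connected subsets of the circle are arcs. -/
lemma isArc_of_isPreconnected {S : Set Circle} (hS : IsPreconnected S) : IsArc S := by
  by_cases hu : S = univ
  · subst hu; exact Arc.whole.2
  obtain ⟨x, hx⟩ := (ne_univ_iff_exists_notMem S).1 hu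
  set w : Circle := Circle.exp Real.pi * x with hw
  have hwx : (w : ℂ) = -x := by simp [hw]
  let g : Circle → ℝ := fun y => Complex.arg ((y * w⁻¹ : Circle) : ℂ) + Complex.arg (w : ℂ)
  have hg : ∀ y, Circle.exp (g y) = y := fun y => by
    simp only [g, Circle.exp_add, Circle.exp_arg, inv_mul_cancel_right]
  have hc : ContinuousOn g S := by
    intro y hy
    refine ContinuousAt.continuousWithinAt ?_
    refine ContinuousAt.add ?_ continuousAt_const
    have h1 : ContinuousAt (fun y : Circle => ((y * w⁻¹ : Circle) : ℂ)) y := by fun_prop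
    refine ContinuousAt.comp (f := fun y : Circle => ((y * w⁻¹ : Circle) : ℂ))
      (g := Complex.arg) (Complex.continuousAt_arg ?_) h1
    rw [Complex.mem_slitPlane_iff_arg]
    refine ⟨fun h => hx ?_, Circle.coe_ne_zero _⟩
    have h2 : y * w⁻¹ = Circle.exp Real.pi := by
      rw [← Circle.exp_arg (y * w⁻¹), h]
    have h3 : y = x := by
      have h4 : y = Circle.exp Real.pi * w := by rw [← h2, inv_mul_cancel_right]
      rw [h4, hw, ← mul_assoc, ← Circle.exp_add, ← two_mul, Circle.exp_two_pi, one_mul]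
    exact h3 ▸ hy
  refine ⟨g '' S, (hS.image g hc).ordConnected, ?_⟩
  rw [image_image]
  simp [hg]

/-- The collection of the complementary arcs of `F`: the connected components of `𝕋 \ F`. -/
def complementaryArcs (F : Set Circle) : Set Arc :=
  {I | ∃ x ∈ Fᶜ, (I : Set Circle) = connectedComponentIn Fᶜ x}

/-- Every component of `𝕋 \ F` is listed in `complementaryArcs F`. -/
lemma exists_complementaryArc (F : Set Circle) {x : Circle} (hx : x ∈ Fᶜ) :
    ∃ I ∈ complementaryArcs F, (I : Set Circle) = connectedComponentIn Fᶜ x :=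
  ⟨⟨_, isArc_of_isPreconnected isPreconnected_connectedComponentIn⟩, ⟨x, hx, rfl⟩, rfl⟩

/-! ### Carleson sets -/

/-- The `Λ`-entropy `∑ |Iₙ| Λ(|Iₙ|)` of `F`, the sum running over the complementary arcs. -/
def entropy (Λ : Majorant) (F : Set Circle) : ENNReal :=
  ∑' I : complementaryArcs F,
    ENNReal.ofReal (circleMeasure (I : Arc) * Λ (circleMeasure (I : Arc)))

/-- `Λ`-Carleson sets: non-empty closed sets of Lebesgue measure zero and finite `Λ`-entropy. -/
structure IsCarlesonSet (Λ : Majorant) (F : Set Circle) : Prop where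
  isClosed : IsClosed F
  nonempty : F.Nonempty
  measure_zero : circleMeasure F = 0
  entropy_lt_top : entropy Λ F < ⊤

/-! ### Premeasures -/

/-- A (real) premeasure on the circle. -/
structure Premeasure where
  toFun : Arc → ℝ
  map_whole : toFun Arc.whole = 0
  map_union : ∀ I J K : Arc, Disjoint (I : Set Circle) J → (K : Set Circle) = ↑I ∪ ↑J →
    toFun K = toFun I + toFun J
  tendsto_zero : ∀ I : ℕ → Arc, (∀ n, (I (n + 1) : Set Circle) ⊆ I n) →
    ⋂ n, (I n : Set Circle) = ∅ → Tendsto (fun n => toFun (I n)) atTop (𝓝 0)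

instance : CoeFun Premeasure (fun _ => Arc → ℝ) := ⟨Premeasure.toFun⟩

namespace Premeasure

/-- `μ` is `Λ`-bounded: `μ(I) ≤ C |I| Λ(|I|)` for all arcs `I`; for arcs of length zero the right
side is `0`. -/
def IsBounded (Λ : Majorant) (μ : Premeasure) : Prop :=
  ∃ C : ℝ, 0 < C ∧ ∀ I : Arc, μ I ≤ C * (circleMeasure I * Λ (circleMeasure I))

/-- The distribution function `θ ↦ μ(I_θ)`. -/
def dist (μ : Premeasure) (θ : ℝ) : ℝ := μ (Arc.initial θ)

/-- The integral `∫ g dμ` of a `C¹` function `g` on the circle: the Stieltjes integral of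
`g(e^{iθ})` over `[0, 2π]` against the distribution function of `μ`. As the latter vanishes at both
end points and need not be of bounded variation, this is integration by parts. -/
def integral (μ : Premeasure) (g : Circle → ℂ) : ℂ :=
  -∫ θ in (0 : ℝ)..(2 * Real.pi), deriv (fun t : ℝ => g (Circle.exp t)) θ * (μ.dist θ : ℂ)

/-- The function `f_μ(z) = exp ∫ (e^{iθ} + z) / (e^{iθ} - z) dμ(θ)`. -/
def expHerglotz (μ : Premeasure) (z : 𝔻) : ℂ :=
  Complex.exp (μ.integral fun ξ => ((ξ : ℂ) + z) / ((ξ : ℂ) - z))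

/-- The `Λ`-singular part `μ_s(F) = -∑ μ(Iₙ)` of `μ` on a set `F`, the sum running over the
complementary arcs of `F`. (The series converges absolutely if `μ` is `Λ`-bounded and `F` is a
`Λ`-Carleson set.) -/
def singularPart (μ : Premeasure) (F : Set Circle) : ℝ :=
  -∑' I : complementaryArcs F, μ I

end Premeasure

end KorenblumType

end

/-! Everything is expressed through distribution functions `F` on the line whose increments obey a
one-sided bound `F b - F a ≤ M κ(b - a)`, where `κ` is `kap`, i.e. `|I| Λ(|I|)` in terms of angular
length. The Herglotz transform `herg` of such an `F` has real part at most a multiple of `M Λ(1 -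
|z|)` (`re_herg_le`), so its exponential lies in the space.

Cyclicity. It suffices to find `g n` in the space with `g n * f` bounded in a single `A_Λ^{-c}` and
tending to `1` locally uniformly (`isCyclicVector_of_tendsto_one`). Let `D` be the distribution
function of `μ`, and put `g n = exp (herg (F n - D))`, so that `g n * f = exp (herg (F n))`. What is
needed is that `F n` is uniformly small, that the increments of `F n` are at most `(C + 1) κ` with
`C` independent of `n`, and that those of `F n - D` are at most `N κ` for some `N`, which may depend
on `n`. All three demands follow from one upper bound `cost` on the increments of `F n`. Such a
function exists as soon as `cost` has nonnegative sum over every subdivision of `[0, 2π]`: take the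
infimum over chains (`exists_increments_le`).

Suppose that for some `ε` and every `N` there is a subdivision with negative total cost. Let `E` be
the limit set of these subdivisions along an ultrafilter. Since the increments of `D` sum to zero,
the sum of `cost - ΔD` is negative as well. Short intervals contribute at least `κ(length)` to it,
which forces `E` to have measure zero and finite entropy. The other intervals converge to gaps of
`E`; there `N κ` tends to infinity and plays no role, and the limit inequality says that the sum
over the gaps of `min ((C + 1) κ) ε - μ(gap)` is at most zero. Hence `∑ μ(gap) > 0`: the image of
`E` is a `Λ`-Carleson set with nonzero singular part (`exists_carleson_gaps`), a contradiction.

Representation. Write `f = exp G`. For `r < 1`, the real part of `G(r z)` is the Poisson integral of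
a continuous density, and the primitive of that density has a one-sided modulus with constant
independent of `r` (`exists_upperMod_primitive`): an almost extremal increment is compared with its
Poisson average at a much smaller scale, where the growth of `Re G` applies. A pointwise limit along
an ultrafilter gives `F` with `f = exp (herg F)` (`exists_eq_exp_herg`). Finally `F` has one-sided
limits everywhere, and these define a premeasure (`UpperMod.premeasure`) whose Herglotz integral is
`herg F`. -/

noncomputable section

namespace KorenblumType

/-! ### The modulus attached to a majorant -/

namespace Majorant

variable (Λ : Majorant)

/-- The modulus `|I| Λ(|I|)` as a function of the angular length of the arc. -/
def kap (t : ℝ) : ℝ := t / (2 * Real.pi) * Λ (t / (2 * Real.pi))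

lemma div_mem_Icc {t : ℝ} (h0 : 0 ≤ t) (h1 : t ≤ 2 * Real.pi) :
    t / (2 * Real.pi) ∈ Icc (0 : ℝ) 1 :=
  ⟨by positivity, (div_le_one Real.two_pi_pos).2 h1⟩

lemma div_mem_Ioc {t : ℝ} (h0 : 0 < t) (h1 : t ≤ 2 * Real.pi) :
    t / (2 * Real.pi) ∈ Ioc (0 : ℝ) 1 :=
  ⟨by positivity, (div_le_one Real.two_pi_pos).2 h1⟩

@[simp] lemma kap_zero : Λ.kap 0 = 0 := by simp [kap]

lemma kap_mono {s t : ℝ} (h0 : 0 ≤ s) (h : s ≤ t) (h1 : t ≤ 2 * Real.pi) :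
    Λ.kap s ≤ Λ.kap t :=
  Λ.monotoneOn_mul (div_mem_Icc h0 (h.trans h1)) (div_mem_Icc (h0.trans h) h1)
    (div_le_div_of_nonneg_right h Real.two_pi_pos.le)

lemma kap_nonneg {t : ℝ} (h0 : 0 ≤ t) (h1 : t ≤ 2 * Real.pi) : 0 ≤ Λ.kap t := by
  simpa using Λ.kap_mono le_rfl h0 h1

lemma kap_pos {t : ℝ} (h0 : 0 < t) (h1 : t ≤ 2 * Real.pi) : 0 < Λ.kap t :=
  mul_pos (div_mem_Ioc h0 h1).1 (Λ.pos _ (div_mem_Ioc h0 h1))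

/-- Since `Λ` is non-increasing, the quotient `kap t / t` is non-increasing; multiplied out, this
also covers `s = 0`. -/
lemma mul_kap_le {s t : ℝ} (h0 : 0 ≤ s) (h : s ≤ t) (h1 : t ≤ 2 * Real.pi) :
    s * Λ.kap t ≤ t * Λ.kap s := by
  rcases h0.eq_or_lt with rfl | h0
  · simp
  · have := Λ.antitoneOn (div_mem_Ioc h0 (h.trans h1)) (div_mem_Ioc (h0.trans_le h) h1)
      (div_le_div_of_nonneg_right h Real.two_pi_pos.le)
    have ht : 0 < t := h0.trans_le h
    have h2 : 0 ≤ s * t / (2 * Real.pi) := by positivity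
    calc s * Λ.kap t = s * t / (2 * Real.pi) * Λ (t / (2 * Real.pi)) := by unfold kap; ring
      _ ≤ s * t / (2 * Real.pi) * Λ (s / (2 * Real.pi)) := mul_le_mul_of_nonneg_left this h2
      _ = t * Λ.kap s := by unfold kap; ring

lemma kap_continuousOn : ContinuousOn Λ.kap (Icc 0 (2 * Real.pi)) :=
  Λ.continuousOn_mul.comp (f := fun t => t / (2 * Real.pi))
    (continuous_id.div_const _).continuousOn fun _ ht => div_mem_Icc ht.1 ht.2

lemma exists_kap_le {ε : ℝ} (hε : 0 < ε) :
    ∃ η > 0, η ≤ 2 * Real.pi ∧ ∀ t, 0 ≤ t → t ≤ η → Λ.kap t ≤ ε := by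
  have h0 : (0 : ℝ) ∈ Icc (0 : ℝ) (2 * Real.pi) := ⟨le_rfl, Real.two_pi_pos.le⟩
  have h := Λ.kap_continuousOn 0 h0
  rw [ContinuousWithinAt, kap_zero, Metric.tendsto_nhdsWithin_nhds] at h
  obtain ⟨δ, hδ, h⟩ := h ε hε
  refine ⟨min (δ / 2) (2 * Real.pi), lt_min (by positivity) Real.two_pi_pos, min_le_right _ _,
    fun t ht ht' => ?_⟩
  have := h (x := t) ⟨ht, ht'.trans (min_le_right _ _)⟩ (by
    rw [Real.dist_eq, sub_zero, abs_of_nonneg ht]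
    linarith [ht'.trans (min_le_left _ _)])
  rw [Real.dist_eq, sub_zero] at this
  exact (le_abs_self _).trans this.le

lemma mul_rpow_le {α : ℝ} (hα : MonotoneOn (fun t => t ^ α * Λ t) (Ioc 0 1)) {x s : ℝ}
    (hx : 0 < x) (hx1 : x ≤ 1) (hs : 0 < s) (hs1 : s ≤ 1) :
    x ^ α * Λ (x * s) ≤ Λ s := by
  have h := hα (a := x * s) (b := s) ⟨by positivity, mul_le_one₀ hx1 hs.le hs1⟩ ⟨hs, hs1⟩
    (mul_le_of_le_one_left hs.le hx1)
  simp only at h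
  rw [Real.mul_rpow hx.le hs.le] at h
  have h2 : 0 < s ^ α := Real.rpow_pos_of_pos hs _
  nlinarith

/-- The monotonicity of `t ^ α Λ(t)` gives a power gain `β = 1 - α` when an interval is shrunk by a
factor. This makes small displacements of the end points of an interval negligible relative to its
own `kap`. -/
lemma exists_kap_mul_le : ∃ β : ℝ, 0 < β ∧ ∀ η t : ℝ, 0 < η → η ≤ 1 → 0 ≤ t → t ≤ 2 * Real.pi →
    Λ.kap (η * t) ≤ η ^ β * Λ.kap t := by
  obtain ⟨α, hα, hm⟩ := Λ.exists_rpow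
  refine ⟨1 - α, sub_pos.2 hα.2, fun η t h0 h1 ht ht1 => ?_⟩
  rcases ht.eq_or_lt with rfl | ht
  · simp
  have h := Λ.mul_rpow_le hm h0 h1 (div_mem_Ioc ht ht1).1 (div_mem_Ioc ht ht1).2
  have h3 : η ^ (1 - α) * η ^ α = η := by
    rw [← Real.rpow_add h0]; simp
  have h4 : 0 ≤ η ^ (1 - α) * (t / (2 * Real.pi)) := by positivity
  calc Λ.kap (η * t) = η * (t / (2 * Real.pi)) * Λ (η * (t / (2 * Real.pi))) := by
        unfold kap; rw [mul_div_assoc]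
    _ = η ^ (1 - α) * (t / (2 * Real.pi)) * (η ^ α * Λ (η * (t / (2 * Real.pi)))) := by
        nth_rewrite 1 [← h3]; ring
    _ ≤ η ^ (1 - α) * (t / (2 * Real.pi)) * Λ (t / (2 * Real.pi)) :=
        mul_le_mul_of_nonneg_left h h4
    _ = _ := by unfold kap; ring

/-- The factor `η` costs `η ^ (-α)` by the monotonicity of `t ^ α Λ(t)`, and the square costs a
constant by hypothesis. -/
lemma exists_le_of_mul_sq {η : ℝ} (h0 : 0 < η) (h1 : η ≤ 1) :
    ∃ C : ℝ, 0 < C ∧ ∀ t, 0 < t → t ≤ 1 → Λ (η * t ^ 2) ≤ C * Λ t := by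
  obtain ⟨α, hα, hm⟩ := Λ.exists_rpow
  obtain ⟨C, hC⟩ := Λ.exists_sq
  have hp : 0 < η ^ α := Real.rpow_pos_of_pos h0 _
  refine ⟨(η ^ α)⁻¹ * max C 1, by positivity, fun t ht ht1 => ?_⟩
  have hs : t ^ 2 ≤ 1 := pow_le_one₀ ht.le ht1
  have h := Λ.mul_rpow_le hm h0 h1 (pow_pos ht 2) hs
  have h2 : Λ (t ^ 2) ≤ max C 1 * Λ t := (hC t ⟨ht, ht1⟩).trans
    (mul_le_mul_of_nonneg_right (le_max_left _ _) (Λ.pos t ⟨ht, ht1⟩).le)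
  rw [mul_assoc, le_inv_mul_iff₀ hp]
  exact h.trans h2

/-- `kap (2 t) ≤ Λ(δ) (δ + t / π)`. -/
lemma kap_two_mul_le {δ t : ℝ} (h0 : 0 < δ) (h1 : δ ≤ 1) (ht : 0 ≤ t) (ht1 : t ≤ Real.pi) :
    Λ.kap (2 * t) ≤ Λ δ * (δ + t / Real.pi) := by
  have hπ := Real.pi_pos
  have hL := Λ.pos δ ⟨h0, h1⟩
  have e : Λ.kap (2 * Real.pi * δ) = δ * Λ δ := by
    unfold kap; rw [mul_div_cancel_left₀ _ Real.two_pi_pos.ne']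
  have hδ : 2 * Real.pi * δ ≤ 2 * Real.pi := mul_le_of_le_one_right Real.two_pi_pos.le h1
  rcases le_total (2 * t) (2 * Real.pi * δ) with h | h
  · have := Λ.kap_mono (by positivity) h hδ
    rw [e] at this
    have : 0 ≤ Λ δ * (t / Real.pi) := by positivity
    linarith
  · have := Λ.mul_kap_le (by positivity) h (by linarith)
    rw [e] at this
    have h3 : Λ.kap (2 * t) ≤ Λ δ * (t / Real.pi) := by
      rw [← mul_le_mul_iff_right₀ (by positivity : 0 < 2 * Real.pi * δ)]
      refine this.trans (le_of_eq ?_)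
      field_simp
    have : 0 ≤ Λ δ * δ := by positivity
    linarith

end Majorant

/-! ### Functions with a one-sided modulus of continuity -/

/-- The increments of `F` on `[0, 2π]` are at most `M kap`. -/
def UpperModOn (Λ : Majorant) (M : ℝ) (F : ℝ → ℝ) : Prop :=
  ∀ a b, 0 ≤ a → a ≤ b → b ≤ 2 * Real.pi → F b - F a ≤ M * Λ.kap (b - a)

/-- The increments of `F` over intervals of length at most `2π` are at most `M kap`. -/
def UpperMod (Λ : Majorant) (M : ℝ) (F : ℝ → ℝ) : Prop :=
  ∀ a b, a ≤ b → b ≤ a + 2 * Real.pi → F b - F a ≤ M * Λ.kap (b - a)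

variable {Λ : Majorant} {M : ℝ} {F : ℝ → ℝ}

lemma UpperMod.upperModOn (h : UpperMod Λ M F) : UpperModOn Λ M F :=
  fun a b h0 hab hb => h a b hab (by linarith)

/-- Vanishing at both ends turns the one-sided bound into a two-sided one: the increment from `0`
bounds `F x` above, and the increment up to `2π` bounds it below. -/
lemma UpperModOn.abs_le (h : UpperModOn Λ M F) (hM : 0 ≤ M) (h0 : F 0 = 0)
    (h1 : F (2 * Real.pi) = 0) {x : ℝ} (hx0 : 0 ≤ x) (hx1 : x ≤ 2 * Real.pi) :
    |F x| ≤ M * Λ.kap (2 * Real.pi) := by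
  have h2 := h 0 x le_rfl hx0 hx1
  have h3 := h x _ hx0 hx1 le_rfl
  have h4 := mul_le_mul_of_nonneg_left
    (Λ.kap_mono (s := x - 0) (t := 2 * Real.pi) (by linarith) (by linarith) le_rfl) hM
  have h5 := mul_le_mul_of_nonneg_left
    (Λ.kap_mono (s := 2 * Real.pi - x) (t := 2 * Real.pi) (by linarith) (by linarith) le_rfl) hM
  rw [_root_.abs_le]; constructor <;> linarith

/-- As `kap` tends to `0` at `0`, `F` cannot rise abruptly to the right of a point, so every set `{F
< c}` contains a right neighbourhood of each of its points. -/
lemma UpperMod.measurable (h : UpperMod Λ M F) (hM : 0 ≤ M) : Measurable F := by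
  refine measurable_of_Iio fun c => MeasurableSet.of_mem_nhdsGT fun x hx => ?_
  have hx' : 0 < c - F x := sub_pos.2 hx
  obtain ⟨η, hη, hη2, hk⟩ := Λ.exists_kap_le (ε := (c - F x) / (M + 1)) (by positivity)
  filter_upwards [Ioo_mem_nhdsGT (show x < x + η by linarith)] with y hy
  have h1 := h x y hy.1.le (by linarith [hy.2])
  have h2 := hk (y - x) (by linarith [hy.1]) (by linarith [hy.2])
  have h3 : M * Λ.kap (y - x) < c - F x := by
    calc M * Λ.kap (y - x) ≤ M * ((c - F x) / (M + 1)) := mul_le_mul_of_nonneg_left h2 hM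
      _ = (c - F x) * (M / (M + 1)) := by ring
      _ < (c - F x) * 1 := mul_lt_mul_of_pos_left (by rw [div_lt_one] <;> linarith) hx'
      _ = c - F x := mul_one _
  show F y < c
  linarith

/-- The `2π`-periodic extension of the restriction of `F` to `[0, 2π)`. -/
def periodize (F : ℝ → ℝ) (x : ℝ) : ℝ := F (toIcoMod Real.two_pi_pos 0 x)

lemma periodize_periodic (F : ℝ → ℝ) : Function.Periodic (periodize F) (2 * Real.pi) := fun x => by
  simp [periodize]

lemma periodize_eq (F : ℝ → ℝ) {x : ℝ} (h0 : 0 ≤ x) (h1 : x < 2 * Real.pi) :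
    periodize F x = F x := by
  rw [periodize, (toIcoMod_eq_self Real.two_pi_pos).2 ⟨h0, by simpa using h1⟩]

/-- The factor `2` comes from intervals crossing a multiple of `2π`: they are cut there, and each
piece is bounded by `kap` of the whole length. -/
lemma UpperModOn.periodize (h : UpperModOn Λ M F) (hM : 0 ≤ M) (h0 : F 0 = F (2 * Real.pi)) :
    UpperMod Λ (2 * M) (periodize F) := by
  intro a b hab hb
  -- Translating by a multiple of `2π` puts the left end point in the basic period, so that at most
  -- one multiple of `2π` lies in the interior of the interval.
  wlog ha : 0 ≤ a ∧ a < 2 * Real.pi generalizing a b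
  · set n := toIcoDiv Real.two_pi_pos 0 a
    have e : ∀ x, KorenblumType.periodize F x =
        KorenblumType.periodize F (x - n • (2 * Real.pi)) :=
      fun x => ((periodize_periodic F).sub_zsmul_eq n).symm
    have hm := toIcoMod_mem_Ico Real.two_pi_pos 0 a
    rw [← self_sub_toIcoDiv_zsmul] at hm
    rw [e a, e b]
    have := this (a - n • (2 * Real.pi)) (b - n • (2 * Real.pi)) (by linarith) (by linarith)
      ⟨hm.1, by have := hm.2; rwa [zero_add] at this⟩
    simpa using this
  rw [periodize_eq F ha.1 ha.2]
  have hk := Λ.kap_nonneg (t := b - a) (by linarith) (by linarith)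
  have hMk := mul_nonneg hM hk
  rcases lt_or_ge b (2 * Real.pi) with hb2 | hb2
  · rw [periodize_eq F (ha.1.trans hab) hb2]
    have := h a b ha.1 hab hb2.le
    linarith
  · have e : KorenblumType.periodize F b = F (b - 2 * Real.pi) := by
      rw [← (periodize_periodic F).sub_eq b, periodize_eq F (by linarith) (by linarith)]
    have h1 := h a _ ha.1 ha.2.le le_rfl
    have h2 := h 0 (b - 2 * Real.pi) le_rfl (by linarith) (by linarith)
    have h3 := mul_le_mul_of_nonneg_left
      (Λ.kap_mono (s := 2 * Real.pi - a) (t := b - a) (by linarith) (by linarith) (by linarith)) hM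
    have h4 := mul_le_mul_of_nonneg_left
      (Λ.kap_mono (s := b - 2 * Real.pi - 0) (t := b - a) (by linarith) (by linarith)
        (by linarith)) hM
    rw [e]; linarith

/-! ### The Herglotz transform of a distribution function -/

/-- The derivative in `θ` of `(e^{iθ} + z) / (e^{iθ} - z)`. -/
def dker (z : ℂ) (θ : ℝ) : ℂ :=
  -2 * Complex.I * z * Complex.exp (θ * Complex.I) / (Complex.exp (θ * Complex.I) - z) ^ 2

lemma exp_sub_ne_zero {z : ℂ} (hz : ‖z‖ < 1) (θ : ℝ) :
    Complex.exp (θ * Complex.I) - z ≠ 0 := by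
  intro h
  rw [sub_eq_zero] at h
  rw [← h, Complex.norm_exp_ofReal_mul_I] at hz
  exact lt_irrefl _ hz

lemma le_norm_exp_sub (z : ℂ) (θ : ℝ) : 1 - ‖z‖ ≤ ‖Complex.exp (θ * Complex.I) - z‖ := by
  have := norm_sub_norm_le (Complex.exp (θ * Complex.I)) z
  rwa [Complex.norm_exp_ofReal_mul_I] at this

lemma hasDerivAt_ker {z : ℂ} (hz : ‖z‖ < 1) (θ : ℝ) :
    HasDerivAt (fun t : ℝ => (Complex.exp (t * Complex.I) + z) / (Complex.exp (t * Complex.I) - z))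
      (dker z θ) θ := by
  have h1 : HasDerivAt (fun t : ℝ => Complex.exp (t * Complex.I))
      (Complex.exp (θ * Complex.I) * Complex.I) θ := by
    have := ((Complex.ofRealCLM.hasDerivAt (x := θ)).mul_const Complex.I).cexp
    simpa using this
  have := (h1.add_const z).div (h1.sub_const z) (exp_sub_ne_zero hz θ)
  refine this.congr_deriv ?_
  unfold dker
  congr 1; ring

lemma continuous_dker {z : ℂ} (hz : ‖z‖ < 1) : Continuous (dker z) := by
  unfold dker
  refine Continuous.div (by fun_prop) (by fun_prop) fun θ => pow_ne_zero 2 (exp_sub_ne_zero hz θ)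

lemma norm_dker_le {z : ℂ} {ρ : ℝ} (hz : ‖z‖ ≤ ρ) (hρ : ρ < 1) (θ : ℝ) :
    ‖dker z θ‖ ≤ 2 / (1 - ρ) ^ 2 := by
  have h1 : 0 < 1 - ρ := by linarith
  have h2 := le_norm_exp_sub z θ
  unfold dker
  rw [norm_div, norm_pow, norm_mul, Complex.norm_exp_ofReal_mul_I]
  have h3 : ‖-2 * Complex.I * z‖ = 2 * ‖z‖ := by simp
  rw [h3, mul_one]
  gcongr <;> linarith [norm_nonneg z]

/-- The Herglotz transform of the distribution function `F`. -/
def herg (F : ℝ → ℝ) (z : ℂ) : ℂ :=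
  -∫ θ in (0 : ℝ)..(2 * Real.pi), dker z θ * (F θ : ℂ)

end KorenblumType

namespace KorenblumType

variable {Λ : Majorant} {M : ℝ} {F G : ℝ → ℝ}

lemma intervalIntegrable_dker_mul {z : ℂ} (hz : ‖z‖ < 1) {a b : ℝ}
    (hF : IntervalIntegrable F volume a b) :
    IntervalIntegrable (fun θ => dker z θ * (F θ : ℂ)) volume a b := by
  have : IntervalIntegrable (fun θ => (F θ : ℂ)) volume a b :=
    ⟨hF.1.ofReal, hF.2.ofReal⟩
  exact this.continuousOn_mul (continuous_dker hz).continuousOn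

lemma herg_congr (h : ∀ θ, 0 < θ → θ < 2 * Real.pi → F θ = G θ) (z : ℂ) : herg F z = herg G z := by
  unfold herg
  rw [intervalIntegral.integral_of_le Real.two_pi_pos.le, integral_Ioc_eq_integral_Ioo,
    intervalIntegral.integral_of_le Real.two_pi_pos.le, integral_Ioc_eq_integral_Ioo]
  congr 1
  refine setIntegral_congr_fun measurableSet_Ioo fun θ hθ => ?_
  simp only [h θ hθ.1 hθ.2]

lemma herg_sub (hF : IntervalIntegrable F volume 0 (2 * Real.pi))
    (hG : IntervalIntegrable G volume 0 (2 * Real.pi)) {z : ℂ} (hz : ‖z‖ < 1) :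
    herg (fun θ => F θ - G θ) z = herg F z - herg G z := by
  unfold herg
  rw [← neg_sub', ← intervalIntegral.integral_sub (intervalIntegrable_dker_mul hz hF)
    (intervalIntegrable_dker_mul hz hG)]
  congr 2; ext θ; push_cast; ring

/-- The kernel is bounded on each smaller disc, so uniform smallness of `F` gives locally uniform
smallness of its transform. This is what makes the products in the cyclicity argument tend to `1`.
-/
lemma norm_herg_le {ε ρ : ℝ} (hε : ∀ θ, 0 ≤ θ → θ ≤ 2 * Real.pi → |F θ| ≤ ε) {z : ℂ}
    (hz : ‖z‖ ≤ ρ) (hρ : ρ < 1) : ‖herg F z‖ ≤ 2 / (1 - ρ) ^ 2 * ε * (2 * Real.pi) := by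
  unfold herg
  rw [norm_neg]
  have := intervalIntegral.norm_integral_le_of_norm_le_const (a := (0 : ℝ)) (b := 2 * Real.pi)
    (f := fun θ => dker z θ * (F θ : ℂ)) (C := 2 / (1 - ρ) ^ 2 * ε) (fun θ hθ => ?_)
  · rwa [sub_zero, abs_of_pos Real.two_pi_pos] at this
  · rw [uIoc_of_le Real.two_pi_pos.le] at hθ
    rw [norm_mul, Complex.norm_real, Real.norm_eq_abs]
    exact mul_le_mul (norm_dker_le hz hρ θ) (hε θ hθ.1.le hθ.2) (abs_nonneg _) (by positivity)

lemma hasDerivAt_dker_left {z : ℂ} (hz : ‖z‖ < 1) (θ : ℝ) :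
    HasDerivAt (fun w => dker w θ)
      (-2 * Complex.I * Complex.exp (θ * Complex.I) * (Complex.exp (θ * Complex.I) + z) /
        (Complex.exp (θ * Complex.I) - z) ^ 3) z := by
  have hne := exp_sub_ne_zero hz θ
  have h1 : HasDerivAt (fun w : ℂ => -2 * Complex.I * w * Complex.exp (θ * Complex.I))
      (-2 * Complex.I * 1 * Complex.exp (θ * Complex.I)) z :=
    ((hasDerivAt_id z).const_mul _).mul_const _
  have h2 : HasDerivAt (fun w : ℂ => (Complex.exp (θ * Complex.I) - w) ^ 2)
      (((2 : ℕ) : ℂ) * (Complex.exp (θ * Complex.I) - z) ^ (2 - 1) * (-1)) z :=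
    ((hasDerivAt_id z).const_sub _).pow 2
  refine (h1.div h2 (pow_ne_zero 2 hne)).congr_deriv ?_
  generalize Complex.exp (θ * Complex.I) = w at *
  rw [div_eq_div_iff (pow_ne_zero 2 (pow_ne_zero 2 hne)) (pow_ne_zero 3 hne)]
  push_cast
  ring

lemma herg_differentiableOn (hF : IntervalIntegrable F volume 0 (2 * Real.pi)) :
    DifferentiableOn ℂ (herg F) (Metric.ball 0 1) := by
  intro z hz
  rw [mem_ball_zero_iff] at hz
  refine DifferentiableAt.differentiableWithinAt ?_
  obtain ⟨ρ, hρ, hρ1⟩ := exists_between hz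
  have hFc : IntervalIntegrable (fun θ => (F θ : ℂ)) volume 0 (2 * Real.pi) :=
    ⟨hF.1.ofReal, hF.2.ofReal⟩
  have hlt : ∀ w ∈ Metric.ball (0 : ℂ) ρ, ‖w‖ < ρ := fun w hw => mem_ball_zero_iff.1 hw
  have := intervalIntegral.hasDerivAt_integral_of_dominated_loc_of_deriv_le (𝕜 := ℂ)
    (μ := volume) (a := 0) (b := 2 * Real.pi) (x₀ := z) (s := Metric.ball 0 ρ)
    (F := fun w θ => dker w θ * (F θ : ℂ))
    (F' := fun w θ => (-2 * Complex.I * Complex.exp (θ * Complex.I) *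
      (Complex.exp (θ * Complex.I) + w) / (Complex.exp (θ * Complex.I) - w) ^ 3) * (F θ : ℂ))
    (bound := fun θ => 4 / (1 - ρ) ^ 3 * ‖(F θ : ℂ)‖)
    (Metric.isOpen_ball.mem_nhds (mem_ball_zero_iff.2 hρ)) ?_ ?_ ?_ ?_ ?_ ?_
  · exact this.2.differentiableAt.neg
  · filter_upwards [Metric.isOpen_ball.mem_nhds (mem_ball_zero_iff.2 hρ)] with w hw
    have := intervalIntegrable_dker_mul ((hlt w hw).trans hρ1) hF
    rw [uIoc_of_le Real.two_pi_pos.le]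
    exact this.1.1
  · exact intervalIntegrable_dker_mul hz hF
  · rw [uIoc_of_le Real.two_pi_pos.le]
    refine AEStronglyMeasurable.mul (Continuous.aestronglyMeasurable ?_) hFc.1.1
    refine Continuous.div (by fun_prop) (by fun_prop) fun θ => pow_ne_zero 3 (exp_sub_ne_zero hz θ)
  · refine Eventually.of_forall fun θ _ w hw => ?_
    have h1 : 0 < 1 - ρ := by linarith
    have h2 := le_norm_exp_sub w θ
    have h3 := hlt w hw
    rw [norm_mul]
    refine mul_le_mul_of_nonneg_right ?_ (norm_nonneg _)
    rw [norm_div, norm_pow, norm_mul, norm_mul, Complex.norm_exp_ofReal_mul_I]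
    have h4 : ‖-2 * Complex.I‖ = 2 := by simp
    have h5 : ‖Complex.exp (θ * Complex.I) + w‖ ≤ 2 := by
      refine (norm_add_le _ _).trans ?_
      rw [Complex.norm_exp_ofReal_mul_I]; linarith
    rw [h4]
    gcongr <;> linarith
  · exact hFc.norm.const_mul _
  · refine Eventually.of_forall fun θ _ w hw => ?_
    exact (hasDerivAt_dker_left ((hlt w hw).trans hρ1) θ).mul_const _

/-! ### The Poisson kernel and the growth of Herglotz transforms -/

/-- The Poisson kernel of the unit disc at radius `r`. -/
def pk (r t : ℝ) : ℝ := (1 - r ^ 2) / (1 - 2 * r * Real.cos t + r ^ 2)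

/-- The derivative of the Poisson kernel. -/
def dpk (r t : ℝ) : ℝ :=
  -((1 - r ^ 2) * (2 * r * Real.sin t)) / (1 - 2 * r * Real.cos t + r ^ 2) ^ 2

lemma pk_denom_ge {r : ℝ} (h0 : 0 ≤ r) (t : ℝ) :
    (1 - r) ^ 2 ≤ 1 - 2 * r * Real.cos t + r ^ 2 := by
  nlinarith [Real.cos_le_one t]

lemma pk_denom_pos {r : ℝ} (h0 : 0 ≤ r) (h1 : r < 1) (t : ℝ) :
    0 < 1 - 2 * r * Real.cos t + r ^ 2 :=
  (pow_pos (sub_pos.2 h1) 2).trans_le (pk_denom_ge h0 t)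

lemma pk_nonneg {r : ℝ} (h0 : 0 ≤ r) (h1 : r < 1) (t : ℝ) : 0 ≤ pk r t :=
  div_nonneg (by nlinarith) (pk_denom_pos h0 h1 t).le

lemma hasDerivAt_pk {r : ℝ} (h0 : 0 ≤ r) (h1 : r < 1) (t : ℝ) :
    HasDerivAt (pk r) (dpk r t) t := by
  have h : HasDerivAt (fun t => 1 - 2 * r * Real.cos t + r ^ 2) (2 * r * Real.sin t) t := by
    have := (((Real.hasDerivAt_cos t).const_mul (2 * r)).const_sub 1).add_const (r ^ 2)
    exact this.congr_deriv (by ring)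
  refine ((hasDerivAt_const t (1 - r ^ 2)).div h (pk_denom_pos h0 h1 t).ne').congr_deriv ?_
  unfold dpk
  congr 1; ring

lemma continuous_pk {r : ℝ} (h0 : 0 ≤ r) (h1 : r < 1) : Continuous (pk r) :=
  continuous_iff_continuousAt.2 fun t => (hasDerivAt_pk h0 h1 t).continuousAt

lemma continuous_dpk {r : ℝ} (h0 : 0 ≤ r) (h1 : r < 1) : Continuous (dpk r) := by
  unfold dpk
  exact Continuous.div (by fun_prop) (by fun_prop) fun t => pow_ne_zero 2 (pk_denom_pos h0 h1 t).ne'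

lemma dpk_neg (r t : ℝ) : dpk r (-t) = -dpk r t := by
  unfold dpk; rw [Real.sin_neg, Real.cos_neg, ← neg_div]; congr 1; ring

lemma dpk_nonpos {r t : ℝ} (h0 : 0 ≤ r) (h1 : r < 1) (ht : 0 ≤ t) (ht1 : t ≤ Real.pi) :
    dpk r t ≤ 0 := by
  refine div_nonpos_of_nonpos_of_nonneg ?_ (by positivity)
  have := Real.sin_nonneg_of_nonneg_of_le_pi ht ht1
  have h2 : 0 ≤ 1 - r ^ 2 := by nlinarith
  have : 0 ≤ (1 - r ^ 2) * (2 * r * Real.sin t) := by positivity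
  linarith

lemma pk_periodic (r : ℝ) : Function.Periodic (pk r) (2 * Real.pi) := fun t => by
  unfold pk; rw [Real.cos_add_two_pi]

lemma dpk_periodic (r : ℝ) : Function.Periodic (dpk r) (2 * Real.pi) := fun t => by
  unfold dpk; rw [Real.cos_add_two_pi, Real.sin_add_two_pi]

/-- Rotating by `arg z` reduces to a real nonnegative point, where the quotient is computed
directly. -/
lemma re_ker {z : ℂ} (hz : ‖z‖ < 1) (θ : ℝ) :
    ((Complex.exp (θ * Complex.I) + z) / (Complex.exp (θ * Complex.I) - z)).re =
      pk ‖z‖ (θ - z.arg) := by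
  have e : Complex.exp (θ * Complex.I) =
      Complex.exp (z.arg * Complex.I) * Complex.exp ((θ - z.arg : ℝ) * Complex.I) := by
    rw [← Complex.exp_add]; congr 1; push_cast; ring
  have ez : z = Complex.exp (z.arg * Complex.I) * (‖z‖ : ℂ) := by
    rw [mul_comm]; exact (Complex.norm_mul_exp_arg_mul_I z).symm
  have hd := pk_denom_pos (norm_nonneg z) hz (θ - z.arg)
  have e2 : (Complex.exp (θ * Complex.I) + z) / (Complex.exp (θ * Complex.I) - z) =
      (Complex.exp ((θ - z.arg : ℝ) * Complex.I) + (‖z‖ : ℂ)) /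
        (Complex.exp ((θ - z.arg : ℝ) * Complex.I) - (‖z‖ : ℂ)) := by
    symm
    rw [← mul_div_mul_left _ _ (Complex.exp_ne_zero (z.arg * Complex.I)), mul_add, mul_sub, ← e,
      ← ez]
  rw [e2, Complex.div_re]
  set t := θ - z.arg
  have hsq := Real.sin_sq_add_cos_sq t
  simp only [Complex.add_re, Complex.sub_re, Complex.add_im, Complex.sub_im, Complex.ofReal_re,
    Complex.ofReal_im, Complex.exp_ofReal_mul_I_re, Complex.exp_ofReal_mul_I_im, Complex.normSq_apply]
  have e3 : (Real.cos t - ‖z‖) * (Real.cos t - ‖z‖) + (Real.sin t - 0) * (Real.sin t - 0) =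
      1 - 2 * ‖z‖ * Real.cos t + ‖z‖ ^ 2 := by linear_combination hsq
  rw [e3, ← add_div]
  unfold pk
  congr 1
  linear_combination hsq

lemma re_dker {z : ℂ} (hz : ‖z‖ < 1) (θ : ℝ) : (dker z θ).re = dpk ‖z‖ (θ - z.arg) := by
  have h1 : HasDerivAt (fun t : ℝ =>
      ((Complex.exp (t * Complex.I) + z) / (Complex.exp (t * Complex.I) - z)).re)
      (dker z θ).re θ := by
    have := Complex.reCLM.hasFDerivAt.comp_hasDerivAt θ (hasDerivAt_ker hz θ)
    exact this
  have h2 : HasDerivAt (fun t : ℝ => pk ‖z‖ (t - z.arg)) (dpk ‖z‖ (θ - z.arg)) θ :=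
    (hasDerivAt_pk (norm_nonneg z) hz (θ - z.arg)).comp_sub_const θ z.arg
  simp_rw [re_ker hz] at h1
  exact h1.unique h2

/-- The Poisson formula for the constant function `1`, moved to an arbitrary period. -/
lemma integral_pk {r : ℝ} (h0 : 0 ≤ r) (h1 : r < 1) (c : ℝ) :
    ∫ t in c..(c + 2 * Real.pi), pk r t = 2 * Real.pi := by
  have hw : ‖(r : ℂ)‖ < 1 := by rwa [Complex.norm_real, Real.norm_of_nonneg h0]
  have h := DiffContOnCl.circleAverage_re_herglotzRieszKernel_smul (f := fun _ => (1 : ℂ)) (R := 1)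
    (c := 0) (w := (r : ℂ)) diffContOnCl_const (by rwa [mem_ball_zero_iff])
  have e : ∀ θ : ℝ, (((Complex.re ∘ herglotzRieszKernel 0 (r : ℂ)) • fun _ => (1 : ℂ))
      (circleMap 0 1 θ) : ℂ) = ((pk r θ : ℝ) : ℂ) := fun θ => by
    have := re_ker hw θ
    rw [Complex.norm_real, Real.norm_of_nonneg h0, Complex.arg_ofReal_of_nonneg h0, sub_zero] at this
    rw [← this]
    simp [herglotzRieszKernel_def, circleMap]
  rw [Real.circleAverage_def] at h
  simp_rw [e] at h
  rw [intervalIntegral.integral_ofReal] at h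
  have h3 : (2 * Real.pi)⁻¹ * ∫ t in (0 : ℝ)..(2 * Real.pi), pk r t = 1 := by
    rw [Complex.real_smul] at h
    exact_mod_cast h
  have h4 := (pk_periodic r).intervalIntegral_add_eq c 0
  rw [zero_add] at h4
  rw [h4]
  field_simp at h3
  linarith

lemma UpperModOn.intervalIntegrable (h : UpperModOn Λ M F) (hM : 0 ≤ M) (h0 : F 0 = 0)
    (h1 : F (2 * Real.pi) = 0) : IntervalIntegrable F volume 0 (2 * Real.pi) := by
  have hp := (h.periodize hM (h0.trans h1.symm)).measurable (by positivity)
  rw [intervalIntegrable_iff_integrableOn_Ioo_of_le Real.two_pi_pos.le]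
  have : IntegrableOn (KorenblumType.periodize F) (Ioo 0 (2 * Real.pi)) := by
    refine Measure.integrableOn_of_bounded (M := M * Λ.kap (2 * Real.pi))
      measure_Ioo_lt_top.ne hp.aestronglyMeasurable ?_
    refine (ae_restrict_iff' measurableSet_Ioo).2 (Eventually.of_forall fun x hx => ?_)
    rw [periodize_eq F hx.1.le hx.2]
    exact h.abs_le hM h0 h1 hx.1.le hx.2.le
  exact this.congr_fun (fun x hx => periodize_eq F hx.1.le hx.2) measurableSet_Ioo

lemma re_herg_eq {z : ℂ} (hz : ‖z‖ < 1) (hF : IntervalIntegrable F volume 0 (2 * Real.pi)) :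
    (herg F z).re = -∫ θ in (0 : ℝ)..(2 * Real.pi), dpk ‖z‖ (θ - z.arg) * F θ := by
  unfold herg
  rw [Complex.neg_re]
  congr 1
  have := Complex.reCLM.intervalIntegral_comp_comm (intervalIntegrable_dker_mul hz hF)
  simp only [Complex.reCLM_apply] at this
  rw [← this]
  congr 1; ext θ
  rw [Complex.re_mul_ofReal, re_dker hz]

/-- Growth of the Herglotz transform of a distribution function with a one-sided modulus. -/
lemma re_herg_le_of_upperMod (h : UpperMod Λ M F) (hM : 0 ≤ M)
    (hper : Function.Periodic F (2 * Real.pi))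
    (hF : ∀ a b, IntervalIntegrable F volume a b) {z : ℂ} (hz : ‖z‖ < 1) :
    (herg F z).re ≤ 3 * M * Λ (1 - ‖z‖) := by
  set r := ‖z‖ with hr
  have h0 : 0 ≤ r := norm_nonneg z
  set φ := z.arg
  have hπ := Real.pi_pos
  have hL := Λ.pos (1 - r) ⟨by linarith, by linarith⟩
  have hcont := continuous_dpk h0 hz
  have hI : ∀ a b, IntervalIntegrable (fun t => dpk r t * F (t + φ)) volume a b := fun a b => by
    have := (hF (a + φ) (b + φ)).comp_add_right φ
    simp only [add_sub_cancel_right] at this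
    exact this.continuousOn_mul hcont.continuousOn
  have e1 := re_herg_eq hz (hF 0 (2 * Real.pi))
  have e2 : ∫ θ in (0 : ℝ)..(2 * Real.pi), dpk r (θ - φ) * F θ =
      ∫ t in (-Real.pi)..Real.pi, dpk r t * F (t + φ) := by
    have hp : Function.Periodic (fun t => dpk r t * F (t + φ)) (2 * Real.pi) := fun t => by
      simp only
      rw [dpk_periodic r t, show t + 2 * Real.pi + φ = t + φ + 2 * Real.pi by ring, hper]
    have := intervalIntegral.integral_comp_sub_right (a := 0) (b := 2 * Real.pi)
      (fun t => dpk r t * F (t + φ)) φ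
    simp only [sub_add_cancel] at this
    rw [this]
    have h2 := hp.intervalIntegral_add_eq (0 - φ) (-Real.pi)
    rw [show 0 - φ + 2 * Real.pi = 2 * Real.pi - φ by ring,
      show -Real.pi + 2 * Real.pi = Real.pi by ring] at h2
    exact h2
  have hI2 : ∀ a b, IntervalIntegrable (fun t => dpk r t * F (-t + φ)) volume a b := fun a b => by
    have := (hI (-b) (-a)).comp_sub_left 0
    simp only [zero_sub, neg_neg, dpk_neg] at this
    have := this.neg
    refine (this.symm.congr fun t _ => ?_)
    simp
  -- The derivative of the kernel is odd, so pairing `t` with `-t` leaves only increments of `F`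
  -- over intervals of length `2t` centred at `φ`. On `[0, π]` the factor `-dpk` is nonnegative, so
  -- a one-sided bound on these increments suffices.
  have e3 : ∫ t in (-Real.pi)..Real.pi, dpk r t * F (t + φ) =
      ∫ t in (0 : ℝ)..Real.pi, dpk r t * (F (t + φ) - F (-t + φ)) := by
    rw [← intervalIntegral.integral_add_adjacent_intervals (hI (-Real.pi) 0) (hI 0 Real.pi)]
    have := intervalIntegral.integral_comp_neg (a := 0) (b := Real.pi)
      (fun t => dpk r t * F (t + φ))
    rw [neg_zero] at this
    rw [← this]
    rw [← intervalIntegral.integral_add _ (hI 0 Real.pi)]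
    · congr 1; ext t; rw [dpk_neg]; ring
    · refine (hI2 0 Real.pi).neg.congr fun t _ => ?_
      simp [dpk_neg]
  have hδ : 0 < 1 - r := by linarith
  have e4 : -∫ t in (0 : ℝ)..Real.pi, dpk r t * (F (t + φ) - F (-t + φ)) ≤
      ∫ t in (0 : ℝ)..Real.pi, -dpk r t * (M * Λ (1 - r) * (1 - r + t / Real.pi)) := by
    rw [← intervalIntegral.integral_neg]
    refine intervalIntegral.integral_mono_on hπ.le ?_ ?_ fun t ht => ?_
    · have := ((hI 0 Real.pi).sub (hI2 0 Real.pi)).neg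
      refine this.congr fun t _ => ?_
      simp only [Pi.neg_apply]; ring
    · exact Continuous.intervalIntegrable (by fun_prop) _ _
    · rw [← neg_mul]
      refine mul_le_mul_of_nonneg_left ?_ (neg_nonneg.2 (dpk_nonpos h0 hz ht.1 ht.2))
      have h5 := h (-t + φ) (t + φ) (by linarith [ht.1]) (by linarith [ht.2])
      rw [show t + φ - (-t + φ) = 2 * t by ring] at h5
      refine h5.trans ?_
      rw [mul_assoc]
      exact mul_le_mul_of_nonneg_left (Λ.kap_two_mul_le hδ (by linarith) ht.1 ht.2) hM
  -- Integration by parts gives a boundary term `(1 - r) * pk r 0 = 1 + r ≤ 2`, a discarded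
  -- nonpositive term at `π`, and `1/π` times the integral of the kernel over half a period, which
  -- is `1`; hence the `3`.
  have e5 : ∫ t in (0 : ℝ)..Real.pi, -dpk r t * (M * Λ (1 - r) * (1 - r + t / Real.pi)) ≤
      M * Λ (1 - r) * 3 := by
    have hd : ∀ t ∈ uIcc 0 Real.pi, HasDerivAt (fun t => 1 - r + t / Real.pi) (1 / Real.pi) t :=
      fun t _ => ((hasDerivAt_id t).div_const _).const_add _
    have hp := intervalIntegral.integral_mul_deriv_eq_deriv_mul hd
      (fun t _ => hasDerivAt_pk h0 hz t) (continuous_const.intervalIntegrable _ _)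
      (hcont.intervalIntegrable _ _)
    have hval : ∫ t in (0 : ℝ)..Real.pi, -dpk r t * (M * Λ (1 - r) * (1 - r + t / Real.pi)) =
        M * Λ (1 - r) * -∫ t in (0 : ℝ)..Real.pi, (1 - r + t / Real.pi) * dpk r t := by
      rw [← intervalIntegral.integral_neg, ← intervalIntegral.integral_const_mul]
      congr 1; ext t; ring
    rw [hval, hp, intervalIntegral.integral_const_mul]
    refine mul_le_mul_of_nonneg_left ?_ (by positivity)
    have hsub : ∫ t in (0 : ℝ)..Real.pi, pk r t ≤ Real.pi := by
      have hc := continuous_pk h0 hz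
      have h6 := intervalIntegral.integral_add_adjacent_intervals
        (hc.intervalIntegrable (μ := volume) (-Real.pi) 0) (hc.intervalIntegrable 0 Real.pi)
      have h7 := integral_pk h0 hz (-Real.pi)
      rw [show -Real.pi + 2 * Real.pi = Real.pi by ring] at h7
      have h9 : ∫ t in (-Real.pi)..0, pk r t = ∫ t in (0 : ℝ)..Real.pi, pk r t := by
        have := intervalIntegral.integral_comp_neg (a := 0) (b := Real.pi) (pk r)
        rw [neg_zero] at this
        rw [← this]
        congr 1; ext t; unfold pk; rw [Real.cos_neg]
      linarith
    have h10 : (1 - r) * pk r 0 ≤ 2 := by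
      unfold pk
      rw [Real.cos_zero, show 1 - 2 * r * 1 + r ^ 2 = (1 - r) * (1 - r) by ring,
        show 1 - r ^ 2 = (1 - r) * (1 + r) by ring, mul_div_mul_left _ _ hδ.ne',
        mul_div_cancel₀ _ hδ.ne']
      linarith
    have h11 := mul_nonneg (by positivity : 0 ≤ 1 - r + Real.pi / Real.pi)
      (pk_nonneg h0 hz Real.pi)
    have h12 : 1 / Real.pi * ∫ t in (0 : ℝ)..Real.pi, pk r t ≤ 1 := by
      rw [div_mul_eq_mul_div, one_mul, div_le_one hπ]; exact hsub
    simp only [zero_div, add_zero] at *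
    linarith
  rw [e1, e2, e3]
  linarith

/-- The periodic estimate is applied to the periodization, whose modulus constant is `2M`; this
turns `3` into `6`. -/
lemma re_herg_le (h : UpperModOn Λ M F) (hM : 0 ≤ M) (h0 : F 0 = 0)
    (h1 : F (2 * Real.pi) = 0) {z : ℂ} (hz : ‖z‖ < 1) :
    (herg F z).re ≤ 6 * M * Λ (1 - ‖z‖) := by
  have hp := h.periodize hM (h0.trans h1.symm)
  have hb : ∀ x, |periodize F x| ≤ M * Λ.kap (2 * Real.pi) := fun x => by
    have := toIcoMod_mem_Ico Real.two_pi_pos 0 x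
    rw [zero_add] at this
    exact h.abs_le hM h0 h1 this.1 this.2.le
  have hi : ∀ a b, IntervalIntegrable (periodize F) volume a b := fun a b => by
    rw [intervalIntegrable_iff]
    exact Measure.integrableOn_of_bounded (M := M * Λ.kap (2 * Real.pi))
      measure_Ioc_lt_top.ne (hp.measurable (by positivity)).aestronglyMeasurable (Eventually.of_forall fun x => hb x)
  have := re_herg_le_of_upperMod hp (by positivity) (periodize_periodic F) hi hz
  rw [herg_congr fun θ h2 h3 => periodize_eq F h2.le h3] at this
  linarith

end KorenblumType

namespace KorenblumType

variable {Λ : Majorant}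

/-! ### Convergence in the spaces of analytic functions -/

lemma GrowthSpace.norm_le {c ε : ℝ} (f : GrowthSpace Λ c)
    (h : ∀ z : 𝔻, ‖f z‖ ≤ ε * Real.exp (c * Λ (1 - ‖(z : ℂ)‖))) : ‖f‖ ≤ ε := by
  refine ciSup_le fun z => ?_
  rw [Real.exp_neg, ← div_eq_mul_inv, div_le_iff₀ (Real.exp_pos _)]
  exact h z

lemma Majorant.one_sub_norm_pos (Λ : Majorant) (z : 𝔻) : 0 < Λ (1 - ‖(z : ℂ)‖) :=
  Λ.pos _ (one_sub_norm_mem z)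

/-- A net that is bounded in some `A_Λ^{-c}` and converges locally uniformly converges in
`A_Λ^{-∞}`. -/
lemma KorenblumSpace.tendsto_of_locallyUniform {ι : Type*} {l : Filter ι}
    {u : ι → KorenblumSpace Λ} {v : KorenblumSpace Λ} {c K : ℝ} (hc : 0 < c)
    (hu : ∀ i (z : 𝔻), ‖u i z‖ ≤ K * Real.exp (c * Λ (1 - ‖(z : ℂ)‖)))
    (hv : ∀ z : 𝔻, ‖v z‖ ≤ K * Real.exp (c * Λ (1 - ‖(z : ℂ)‖)))
    (hloc : ∀ ρ < 1, ∀ ε > 0, ∀ᶠ i in l, ∀ z : 𝔻, ‖(z : ℂ)‖ ≤ ρ → ‖u i z - v z‖ ≤ ε) :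
    Tendsto u l (𝓝 v) := by
  have hK : 0 ≤ K := by
    have := (norm_nonneg _).trans (hv 0)
    exact nonneg_of_mul_nonneg_left this (Real.exp_pos _)
  have hmem : ∀ w : KorenblumSpace Λ,
      (∀ z : 𝔻, ‖w z‖ ≤ K * Real.exp (c * Λ (1 - ‖(z : ℂ)‖))) →
      w.toFun ∈ growthSubmodule Λ (c + 1) := by
    intro w hw
    obtain ⟨_, _, hh, _⟩ := w.2
    refine ⟨hh, K, fun z => (hw z).trans ?_⟩
    gcongr
    · exact (Λ.one_sub_norm_pos z).le
    · linarith
  -- Convergence takes place in `A_Λ^{-(c+1)}`: the extra unit in the exponent supplies a factor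
  -- `exp (-Λ)`, which is small near the circle because `Λ` tends to infinity. Away from the circle
  -- locally uniform convergence suffices.
  have hc1 : 0 < c + 1 := by linarith
  let U : ι → GrowthSpace Λ (c + 1) := fun i => ⟨(u i).toFun, hmem _ (hu i)⟩
  let V : GrowthSpace Λ (c + 1) := ⟨v.toFun, hmem _ hv⟩
  have hUV : Tendsto U l (𝓝 V) := by
    rw [tendsto_iff_norm_sub_tendsto_zero, Metric.tendsto_nhds]
    intro ε hε
    obtain ⟨T, hT⟩ : ∃ T : ℝ, 2 * K * Real.exp (-T) ≤ ε / 2 := by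
      have h1 : Tendsto (fun T : ℝ => 2 * K * Real.exp (-T)) atTop (𝓝 (2 * K * 0)) :=
        (Real.tendsto_exp_neg_atTop_nhds_zero).const_mul _
      rw [mul_zero] at h1
      exact (h1.eventually (Iic_mem_nhds (by positivity : (0 : ℝ) < ε / 2))).exists
    obtain ⟨δ, hδ, hδT⟩ := mem_nhdsGT_iff_exists_Ioo_subset.1
      (Λ.tendsto_atTop.eventually (eventually_ge_atTop T))
    filter_upwards [hloc (1 - δ) (by linarith [mem_Ioi.1 hδ]) (ε / 2) (by positivity)] with i hi
    rw [Real.dist_eq, sub_zero, abs_of_nonneg (norm_nonneg _)]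
    refine lt_of_le_of_lt (GrowthSpace.norm_le (ε := ε / 2) _ fun z => ?_) (by linarith)
    have hval : (U i - V : GrowthSpace Λ (c + 1)) z = u i z - v z := rfl
    rw [hval]
    have hL := Λ.one_sub_norm_pos z
    rcases le_or_gt ‖(z : ℂ)‖ (1 - δ) with hz | hz
    · refine (hi z hz).trans (le_mul_of_one_le_right (by positivity) ?_)
      exact Real.one_le_exp (by positivity)
    · have h2 : T ≤ Λ (1 - ‖(z : ℂ)‖) := hδT ⟨(one_sub_norm_mem z).1, by linarith⟩
      calc ‖u i z - v z‖ ≤ ‖u i z‖ + ‖v z‖ := norm_sub_le _ _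
        _ ≤ K * Real.exp (c * Λ (1 - ‖(z : ℂ)‖)) + K * Real.exp (c * Λ (1 - ‖(z : ℂ)‖)) :=
            add_le_add (hu i z) (hv z)
        _ = 2 * K * Real.exp (-Λ (1 - ‖(z : ℂ)‖)) *
            Real.exp ((c + 1) * Λ (1 - ‖(z : ℂ)‖)) := by
            rw [mul_assoc (2 * K), ← Real.exp_add]; ring_nf
        _ ≤ ε / 2 * Real.exp ((c + 1) * Λ (1 - ‖(z : ℂ)‖)) := by
            refine mul_le_mul_of_nonneg_right (le_trans ?_ hT) (Real.exp_pos _).le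
            gcongr
  exact ((KorenblumSpace.continuous_incl Λ (c + 1) hc1).tendsto V).comp hUV

/-! ### Polynomial approximation -/

lemma exists_polynomial_near {G : ℂ → ℂ} {R : ℝ} (hR : 1 < R)
    (hG : DifferentiableOn ℂ G (Metric.ball 0 R)) {ε : ℝ} (hε : 0 < ε) :
    ∃ p : Polynomial ℂ, ∀ z : ℂ, ‖z‖ ≤ 1 → ‖p.eval z - G z‖ ≤ ε := by
  obtain ⟨R', h1, h2⟩ := exists_between hR
  obtain ⟨R'', h3, h4⟩ := exists_between h1
  lift R' to NNReal using by linarith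
  lift R'' to NNReal using by linarith
  have hd : DifferentiableOn ℂ G (Metric.closedBall 0 R') :=
    hG.mono (Metric.closedBall_subset_ball h2)
  have hp := hd.hasFPowerSeriesOnBall (by exact_mod_cast (by linarith : (0 : ℝ) < R'))
  have hu := hp.tendstoUniformlyOn (r' := R'') (by exact_mod_cast h4)
  rw [Metric.tendstoUniformlyOn_iff] at hu
  obtain ⟨n, hn⟩ := (hu ε hε).exists
  set q := cauchyPowerSeries G 0 R' with hq
  refine ⟨∑ k ∈ Finset.range n, Polynomial.monomial k (q.coeff k), fun z hz => ?_⟩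
  have := hn z (mem_ball_zero_iff.2 (by linarith))
  rw [zero_add, dist_eq_norm, norm_sub_rev] at this
  refine le_trans (le_of_eq ?_) this.le
  congr 2
  rw [Polynomial.eval_finsetSum, FormalMultilinearSeries.partialSum]
  refine Finset.sum_congr rfl fun k _ => ?_
  rw [Polynomial.eval_monomial, FormalMultilinearSeries.apply_eq_pow_smul_coeff, smul_eq_mul,
    mul_comm]

/-- The dilations `g(r z)` satisfy the same growth bound as `g`, because `Λ(1 - r|z|) ≤ Λ(1 - |z|)`,
and they are holomorphic across the closed disc; their Taylor polynomials approximate them there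
within `1 / (n + 1)`. -/
lemma exists_polynomial_seq (g : KorenblumSpace Λ) :
    ∃ (p : ℕ → Polynomial ℂ) (c K : ℝ), 0 < c ∧
      (∀ n (z : 𝔻), ‖(p n).eval (z : ℂ)‖ ≤ K * Real.exp (c * Λ (1 - ‖(z : ℂ)‖))) ∧
      (∀ z : 𝔻, ‖g z‖ ≤ K * Real.exp (c * Λ (1 - ‖(z : ℂ)‖))) ∧
      ∀ ρ < 1, ∀ ε > 0, ∀ᶠ n in atTop, ∀ z : 𝔻, ‖(z : ℂ)‖ ≤ ρ →
        ‖(p n).eval (z : ℂ) - g z‖ ≤ ε := by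
  obtain ⟨c, hc, ⟨F, hF, hgF⟩, K, hK⟩ := g.2
  change ∀ z : 𝔻, g z = F z at hgF
  change ∀ z : 𝔻, ‖g z‖ ≤ _ at hK
  have hK0 : 0 ≤ K := nonneg_of_mul_nonneg_left ((norm_nonneg _).trans (hK 0)) (Real.exp_pos _)
  -- The shift by `2` keeps all the radii strictly between `0` and `1`.
  let r : ℕ → ℝ := fun n => 1 - 1 / ((n : ℝ) + 2)
  have hr0 : ∀ n, 0 < r n := fun n => by
    have : 1 / ((n : ℝ) + 2) < 1 := by rw [div_lt_one] <;> linarith [Nat.cast_nonneg (α := ℝ) n]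
    simp only [r]; linarith
  have hr1 : ∀ n, r n < 1 := fun n => by
    have : 0 < 1 / ((n : ℝ) + 2) := by positivity
    simp only [r]; linarith
  have hex : ∀ n, ∃ p : Polynomial ℂ, ∀ z : ℂ, ‖z‖ ≤ 1 →
      ‖p.eval z - F (r n * z)‖ ≤ 1 / ((n : ℝ) + 1) := fun n => by
    refine exists_polynomial_near (R := 1 / r n) (by rw [lt_div_iff₀ (hr0 n)]; linarith [hr1 n])
      (hF.comp (by fun_prop) fun z hz => ?_) (by positivity)
    rw [mem_ball_zero_iff] at hz ⊢
    rw [norm_mul, Complex.norm_real, Real.norm_of_nonneg (hr0 n).le]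
    rwa [lt_div_iff₀ (hr0 n), mul_comm] at hz
  choose p hp using hex
  refine ⟨p, c, K + 1, hc, fun n z => ?_, fun z => ?_, fun ρ hρ ε hε => ?_⟩
  · have hz := z.norm_lt_one
    have hn : ‖(r n : ℂ) * z‖ = r n * ‖(z : ℂ)‖ := by
      rw [norm_mul, Complex.norm_real, Real.norm_of_nonneg (hr0 n).le]
    have hle : r n * ‖(z : ℂ)‖ ≤ ‖(z : ℂ)‖ := mul_le_of_le_one_left (norm_nonneg _) (hr1 n).le
    have h1 := hK (Complex.UnitDisc.mk (r n * z) (by rw [hn]; linarith))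
    rw [hgF, Complex.UnitDisc.coe_mk, hn] at h1
    have h2 : Λ (1 - r n * ‖(z : ℂ)‖) ≤ Λ (1 - ‖(z : ℂ)‖) :=
      Λ.antitoneOn (one_sub_norm_mem z)
        ⟨by linarith, by linarith [mul_nonneg (hr0 n).le (norm_nonneg (z : ℂ))]⟩ (by linarith)
    have h3 : ‖F (r n * z)‖ ≤ K * Real.exp (c * Λ (1 - ‖(z : ℂ)‖)) :=
      h1.trans (by gcongr)
    have h4 : (1 : ℝ) / ((n : ℝ) + 1) ≤ 1 := by
      rw [div_le_one] <;> linarith [Nat.cast_nonneg (α := ℝ) n]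
    have h5 : (1 : ℝ) ≤ Real.exp (c * Λ (1 - ‖(z : ℂ)‖)) :=
      Real.one_le_exp (mul_nonneg hc.le (Λ.one_sub_norm_pos z).le)
    have h6 := norm_add_le ((p n).eval (z : ℂ) - F (r n * z)) (F (r n * z))
    rw [sub_add_cancel] at h6
    have := hp n z hz.le
    linarith
  · exact (hK z).trans (mul_le_mul_of_nonneg_right (by linarith) (Real.exp_pos _).le)
  · have huc : UniformContinuousOn F (Metric.closedBall 0 ρ) :=
      (isCompact_closedBall 0 ρ).uniformContinuousOn_of_continuous
        (hF.continuousOn.mono (Metric.closedBall_subset_ball hρ))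
    rw [Metric.uniformContinuousOn_iff] at huc
    obtain ⟨δ, hδ, huc⟩ := huc (ε / 2) (by positivity)
    have ht : Tendsto (fun n : ℕ => 1 / ((n : ℝ) + 1)) atTop (𝓝 0) :=
      tendsto_one_div_add_atTop_nhds_zero_nat
    filter_upwards [ht.eventually (Iio_mem_nhds hδ),
      ht.eventually (Iio_mem_nhds (half_pos hε))] with n h1 h2 z hz
    have hn : ‖(r n : ℂ) * z‖ = r n * ‖(z : ℂ)‖ := by
      rw [norm_mul, Complex.norm_real, Real.norm_of_nonneg (hr0 n).le]
    have hle : r n * ‖(z : ℂ)‖ ≤ ‖(z : ℂ)‖ := mul_le_of_le_one_left (norm_nonneg _) (hr1 n).le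
    have h3 := huc (r n * z) (mem_closedBall_zero_iff.2 (by rw [hn]; linarith)) z
      (mem_closedBall_zero_iff.2 hz) (by
        rw [dist_eq_norm]
        have e : (r n : ℂ) * z - z = ((-(1 / ((n : ℝ) + 2)) : ℝ) : ℂ) * z := by
          simp only [r]; push_cast; ring
        rw [e, norm_mul, Complex.norm_real, norm_neg, Real.norm_of_nonneg (by positivity)]
        have h4 : 1 / ((n : ℝ) + 2) ≤ 1 / ((n : ℝ) + 1) := by gcongr; linarith
        have h5 : 1 / ((n : ℝ) + 2) * ‖(z : ℂ)‖ ≤ 1 / ((n : ℝ) + 2) :=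
          mul_le_of_le_one_right (by positivity) z.norm_lt_one.le
        have h1' : 1 / ((n : ℝ) + 1) < δ := h1
        linarith)
    rw [dist_eq_norm] at h3
    rw [hgF]
    have h6 := norm_add_le ((p n).eval (z : ℂ) - F (r n * z)) (F (r n * z) - F z)
    rw [sub_add_sub_cancel] at h6
    have := hp n z z.norm_lt_one.le
    have h2' : 1 / ((n : ℝ) + 1) < ε / 2 := h2
    linarith

/-! ### Multiplication in the space and a criterion for cyclicity -/

namespace KorenblumSpace

lemma exists_bound (f : KorenblumSpace Λ) : ∃ c K : ℝ, 0 < c ∧ 0 ≤ K ∧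
    ∀ z : 𝔻, ‖f z‖ ≤ K * Real.exp (c * Λ (1 - ‖(z : ℂ)‖)) := by
  obtain ⟨c, hc, -, K, hK⟩ := f.2
  exact ⟨c, K, hc, nonneg_of_mul_nonneg_left ((norm_nonneg _).trans (hK 0)) (Real.exp_pos _), hK⟩

lemma exists_norm_le (f : KorenblumSpace Λ) {ρ : ℝ} (hρ : ρ < 1) : ∃ B : ℝ, 0 < B ∧
    ∀ z : 𝔻, ‖(z : ℂ)‖ ≤ ρ → ‖f z‖ ≤ B := by
  obtain ⟨c, K, hc, hK, h⟩ := f.exists_bound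
  rcases lt_or_ge ρ 0 with h0 | h0
  · exact ⟨1, one_pos, fun z hz => absurd (norm_nonneg (z : ℂ)) (by linarith)⟩
  refine ⟨(K + 1) * Real.exp (c * Λ (1 - ρ)), by positivity, fun z hz => (h z).trans ?_⟩
  have : Λ (1 - ‖(z : ℂ)‖) ≤ Λ (1 - ρ) :=
    Λ.antitoneOn ⟨by linarith, by linarith⟩ (one_sub_norm_mem z) (by linarith)
  gcongr
  linarith

/-- The product of two elements of `A_Λ^{-∞}`. -/
def mul (f g : KorenblumSpace Λ) : KorenblumSpace Λ :=
  ⟨fun z => f z * g z, by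
    obtain ⟨c, hc, ⟨F, hF, hf⟩, C, hC⟩ := f.2
    obtain ⟨d, hd, ⟨G, hG, hg⟩, D, hD⟩ := g.2
    refine ⟨c + d, by positivity, ⟨fun z => F z * G z, hF.mul hG, fun z => ?_⟩, C * D,
      fun z => ?_⟩
    · show f.1 z * g.1 z = _
      rw [hf, hg]
    · show ‖f.1 z * g.1 z‖ ≤ _
      rw [norm_mul, add_mul, Real.exp_add, mul_mul_mul_comm]
      exact mul_le_mul (hC z) (hD z) (norm_nonneg _) ((norm_nonneg _).trans (hC z))⟩

@[simp] lemma mul_apply (f g : KorenblumSpace Λ) (z : 𝔻) : mul f g z = f z * g z := rfl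

@[simp] lemma polyMul_apply (p : Polynomial ℂ) (f : KorenblumSpace Λ) (z : 𝔻) :
    polyMul p f z = p.eval (z : ℂ) * f z := rfl

lemma norm_mul_le_exp {a b : ℂ} {c d K D t : ℝ} (ha : ‖a‖ ≤ K * Real.exp (c * t))
    (hb : ‖b‖ ≤ D * Real.exp (d * t)) : ‖a * b‖ ≤ K * D * Real.exp ((c + d) * t) := by
  rw [norm_mul, add_mul, Real.exp_add, mul_mul_mul_comm]
  exact mul_le_mul ha hb (norm_nonneg _) ((norm_nonneg _).trans ha)

/-- Replace `g` by polynomials bounded in one `A_Λ^{-c}` and converging locally uniformly;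
multiplication by `f` keeps both properties, with a larger exponent. -/
lemma mul_mem_invariantSubspace (g f : KorenblumSpace Λ) : mul g f ∈ invariantSubspace f := by
  obtain ⟨p, c, K, hc, hp, hg, hloc⟩ := exists_polynomial_seq g
  obtain ⟨d, D, hd, hD, hf⟩ := f.exists_bound
  have ht : Tendsto (fun n => polyMul (p n) f) atTop (𝓝 (mul g f)) := by
    refine tendsto_of_locallyUniform (c := c + d) (K := K * D) (by positivity)
      (fun n z => norm_mul_le_exp (hp n z) (hf z)) (fun z => norm_mul_le_exp (hg z) (hf z))
      fun ρ hρ ε hε => ?_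
    obtain ⟨B, hB, hfB⟩ := f.exists_norm_le hρ
    filter_upwards [hloc ρ hρ (ε / B) (by positivity)] with n hn z hz
    rw [polyMul_apply, mul_apply, ← sub_mul, norm_mul]
    calc _ ≤ ε / B * B := mul_le_mul (hn z hz) (hfB z hz) (norm_nonneg _) (by positivity)
      _ = ε := div_mul_cancel₀ _ hB.ne'
  refine mem_closure_of_tendsto ht (Eventually.of_forall fun n => ?_)
  exact Submodule.subset_span ⟨p n, rfl⟩

/-- `f` is cyclic if there are `g n` in `A_Λ^{-∞}` such that `f g n` is bounded in some `A_Λ^{-c}`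
and tends to `1` locally uniformly. -/
lemma isCyclicVector_of_tendsto_one {f : KorenblumSpace Λ} (g : ℕ → KorenblumSpace Λ) {c K : ℝ}
    (hc : 0 < c) (hb : ∀ n (z : 𝔻), ‖g n z * f z‖ ≤ K * Real.exp (c * Λ (1 - ‖(z : ℂ)‖)))
    (hloc : ∀ ρ < 1, ∀ ε > 0, ∀ᶠ n in atTop, ∀ z : 𝔻, ‖(z : ℂ)‖ ≤ ρ → ‖g n z * f z - 1‖ ≤ ε) :
    f.IsCyclicVector := by
  refine (Submodule.eq_top_iff').2 fun w => ?_
  obtain ⟨d, D, hd, hD, hw⟩ := w.exists_bound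
  have hmem : ∀ n, mul (mul (g n) w) f ∈ invariantSubspace f := fun n =>
    mul_mem_invariantSubspace _ _
  have e : ∀ n (z : 𝔻), mul (mul (g n) w) f z = g n z * f z * w z := fun n z => by
    simp only [mul_apply]; ring
  -- No appeal to density of the polynomials is needed: every `w` is itself the limit of the
  -- elements `w g n f` of the closed invariant subspace.
  have ht : Tendsto (fun n => mul (mul (g n) w) f) atTop (𝓝 w) := by
    have hD' : ∀ z : 𝔻, ‖w z‖ ≤ (max K 1 * D) * Real.exp ((c + d) * Λ (1 - ‖(z : ℂ)‖)) := by
      intro z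
      have := norm_mul_le_exp (a := 1) (c := c) (K := max K 1) (t := Λ (1 - ‖(z : ℂ)‖)) (by
        rw [norm_one]
        exact one_le_mul_of_one_le_of_one_le (le_max_right _ _)
          (Real.one_le_exp (mul_nonneg hc.le (Λ.one_sub_norm_pos z).le))) (hw z)
      rwa [one_mul] at this
    refine tendsto_of_locallyUniform (c := c + d) (K := max K 1 * D) (by positivity)
      (fun n z => ?_) hD' fun ρ hρ ε hε => ?_
    · rw [e]
      refine norm_mul_le_exp ((hb n z).trans ?_) (hw z)
      exact mul_le_mul_of_nonneg_right (le_max_left _ _) (Real.exp_pos _).le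
    obtain ⟨B, hB, hwB⟩ := w.exists_norm_le hρ
    filter_upwards [hloc ρ hρ (ε / B) (by positivity)] with n hn z hz
    rw [e, ← sub_one_mul, norm_mul]
    calc _ ≤ ε / B * B := mul_le_mul (hn z hz) (hwB z hz) (norm_nonneg _) (by positivity)
      _ = ε := div_mul_cancel₀ _ hB.ne'
  exact (Submodule.isClosed_topologicalClosure _).mem_of_tendsto ht (Eventually.of_forall hmem)

end KorenblumSpace

end KorenblumType

namespace KorenblumType

/-! ### Additive functions below a given bound -/

/-- The value of the bound `b` along chains from `0` to `x`. -/
def chainSums (b : ℝ → ℝ → ℝ) (x : ℝ) : Set ℝ :=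
  {s | ∃ (n : ℕ) (c : ℕ → ℝ), Monotone c ∧ c 0 = 0 ∧ c n = x ∧
    s = ∑ i ∈ Finset.range n, b (c i) (c (i + 1))}

lemma add_mem_chainSums {b : ℝ → ℝ → ℝ} {x y s : ℝ} (hs : s ∈ chainSums b x) (hxy : x ≤ y) :
    s + b x y ∈ chainSums b y := by
  obtain ⟨n, c, hc, h0, hn, rfl⟩ := hs
  refine ⟨n + 1, fun i => if i ≤ n then c i else y, fun i j hij => ?_, by simp [h0], by simp, ?_⟩
  · simp only
    split_ifs with h1 h2 h2
    · exact hc hij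
    · exact (hc h1).trans (hn.trans_le hxy)
    · omega
    · exact le_rfl
  · rw [Finset.sum_range_succ]
    congr 1
    · refine Finset.sum_congr rfl fun i hi => ?_
      have := Finset.mem_range.1 hi
      beta_reduce
      rw [if_pos (by omega), if_pos (by omega)]
    · beta_reduce
      rw [if_pos le_rfl, if_neg (by omega), hn]

/-- If the sums of `b` over all subdivisions of `[0, T]` are nonnegative, there is a function
vanishing at the end points whose increments are at most `b`. -/
lemma exists_increments_le {b : ℝ → ℝ → ℝ} {T : ℝ} (hT : 0 < T) (hb : ∀ x, b x x = 0)
    (h : ∀ s ∈ chainSums b T, 0 ≤ s) :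
    ∃ F : ℝ → ℝ, F 0 = 0 ∧ F T = 0 ∧ ∀ x y, 0 ≤ x → x ≤ y → y ≤ T → F y - F x ≤ b x y := by
  have h00 : (0 : ℝ) ∈ chainSums b 0 := ⟨0, fun _ => 0, monotone_const, rfl, rfl, by simp⟩
  have hne : ∀ x, 0 ≤ x → (chainSums b x).Nonempty := fun x hx => ⟨_, add_mem_chainSums h00 hx⟩
  have hlb : ∀ x ≤ T, ∀ s ∈ chainSums b x, -b x T ≤ s := fun x hx s hs => by
    have := h _ (add_mem_chainSums hs hx); linarith
  have hbdd : ∀ x ≤ T, BddBelow (chainSums b x) := fun x hx => ⟨_, hlb x hx⟩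
  -- The infimum over chains from `0` satisfies the increment bound because a chain to `x` extends
  -- to `y` by one more step. At `T` this infimum is nonnegative and may be positive; it is replaced
  -- by `0`, which only lowers the increments ending at `T` and costs nothing else, since the chains
  -- to `x` have sums at least `-b x T`.
  refine ⟨fun x => if x = T then 0 else sInf (chainSums b x), ?_, if_pos rfl,
    fun x y hx hxy hy => ?_⟩
  · beta_reduce
    rw [if_neg hT.ne]
    refine le_antisymm (csInf_le (hbdd 0 hT.le) h00) (le_csInf ⟨0, h00⟩ ?_)
    rintro s ⟨n, c, hc, h0, hn, rfl⟩
    refine Finset.sum_nonneg fun i hi => ?_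
    have hi' := Finset.mem_range.1 hi
    have e : ∀ j ≤ n, c j = 0 := fun j hj =>
      le_antisymm (hn ▸ hc hj) (h0 ▸ hc (Nat.zero_le j))
    rw [e i hi'.le, e (i + 1) hi', hb]
  · rcases hxy.eq_or_lt with rfl | hlt
    · simp [hb]
    · beta_reduce
      rw [if_neg (hlt.trans_le hy).ne]
      split_ifs with hyT
      · subst hyT
        have := le_csInf (hne x hx) (hlb x hxy)
        linarith
      · have : sInf (chainSums b y) - b x y ≤ sInf (chainSums b x) :=
          le_csInf (hne x hx) fun s hs => by
            have := csInf_le (hbdd y hy) (add_mem_chainSums hs hxy)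
            linarith
        linarith

/-! ### Limits of subdivisions -/

/-- The complementary intervals of a subset of the line. -/
def gaps (E : Set ℝ) : Set (ℝ × ℝ) :=
  {p | p.1 < p.2 ∧ p.1 ∈ E ∧ p.2 ∈ E ∧ Disjoint (Ioo p.1 p.2) E}

lemma gaps_disjoint {E : Set ℝ} {p q : ℝ × ℝ} (hp : p ∈ gaps E) (hq : q ∈ gaps E) (h : p ≠ q) :
    Disjoint (Ioo p.1 p.2) (Ioo q.1 q.2) := by
  rw [Set.disjoint_left]
  intro x hx hy
  obtain ⟨h1, h2, h3, h4⟩ := hp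
  obtain ⟨k1, k2, k3, k4⟩ := hq
  rw [Set.disjoint_left] at h4 k4
  apply h
  have e1 : p.1 = q.1 := by
    by_contra hne
    rcases lt_or_gt_of_ne hne with hl | hl
    · exact h4 ⟨hl, hy.1.trans hx.2⟩ k2
    · exact k4 ⟨hl, hx.1.trans hy.2⟩ h2
  have e2 : p.2 = q.2 := by
    by_contra hne
    rcases lt_or_gt_of_ne hne with hl | hl
    · exact k4 ⟨hy.1.trans hx.2, hl⟩ h3
    · exact h4 ⟨hx.1.trans hy.2, hl⟩ k3
  exact Prod.ext e1 e2

/-- The gaps are disjoint subintervals of an interval of finite length. -/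
lemma finite_long_gaps {E : Set ℝ} {T s : ℝ} (hE : E ⊆ Icc 0 T) (hs : 0 < s) :
    {p : gaps E | s ≤ p.1.2 - p.1.1}.Finite := by
  have := Measure.finite_const_le_meas_of_disjoint_iUnion (volume : Measure ℝ)
    (ε := ENNReal.ofReal s) (ENNReal.ofReal_pos.2 hs)
    (As := fun p : gaps E => Ioo p.1.1 p.1.2) (fun p => measurableSet_Ioo)
    (fun p q hpq => gaps_disjoint p.2 q.2 fun h => hpq (Subtype.ext h)) ?_
  · refine this.subset fun p hp => ?_
    show ENNReal.ofReal s ≤ volume (Ioo p.1.1 p.1.2)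
    rw [Real.volume_Ioo]
    exact ENNReal.ofReal_le_ofReal hp
  · refine ne_top_of_le_ne_top (measure_Icc_lt_top (a := (0 : ℝ)) (b := T)).ne
      (measure_mono (iUnion_subset fun p => ?_))
    exact Ioo_subset_Icc_self.trans (Icc_subset_Icc (hE p.2.2.1).1 (hE p.2.2.2.1).2)

/-- A subdivision of `[0, T]`. -/
structure Subdivision (T : ℝ) where
  n : ℕ
  c : ℕ → ℝ
  mono : Monotone c
  zero : c 0 = 0
  last : c n = T

namespace Subdivision

variable {T : ℝ} (P : Subdivision T)

lemma mem_Icc {i : ℕ} (hi : i ≤ P.n) : P.c i ∈ Icc 0 T :=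
  ⟨P.zero.symm.trans_le (P.mono (Nat.zero_le i)), (P.mono hi).trans_eq P.last⟩

lemma exists_index {m : ℝ} (h0 : 0 ≤ m) (h1 : m < T) :
    ∃ i < P.n, P.c i ≤ m ∧ m < P.c (i + 1) := by
  have hex : ∃ j, m < P.c j := ⟨P.n, P.last.symm ▸ h1⟩
  classical
  have h2 := Nat.find_spec hex
  have hle : Nat.find hex ≤ P.n := Nat.find_min' hex (P.last.symm ▸ h1)
  obtain ⟨j, hj⟩ : ∃ j, Nat.find hex = j + 1 := by
    refine Nat.exists_eq_succ_of_ne_zero fun h => ?_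
    rw [h, P.zero] at h2
    linarith
  refine ⟨j, by omega, ?_, hj ▸ h2⟩
  exact not_lt.1 (Nat.find_min hex (by omega))

lemma index_unique {m : ℝ} {i j : ℕ} (hi : P.c i ≤ m ∧ m < P.c (i + 1))
    (hj : P.c j ≤ m ∧ m < P.c (j + 1)) : i = j := by
  by_contra h
  rcases Nat.lt_or_gt_of_ne h with h | h
  · have := P.mono (show i + 1 ≤ j by omega); linarith
  · have := P.mono (show j + 1 ≤ i by omega); linarith

/-- The index of the interval of the subdivision that contains `m`. -/
def index (m : ℝ) : ℕ := by
  classical exact if h : ∃ i < P.n, P.c i ≤ m ∧ m < P.c (i + 1) then h.choose else 0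

lemma index_spec {m : ℝ} (h0 : 0 ≤ m) (h1 : m < T) :
    P.index m < P.n ∧ P.c (P.index m) ≤ m ∧ m < P.c (P.index m + 1) := by
  have h := P.exists_index h0 h1
  unfold index
  rw [dif_pos h]
  exact h.choose_spec

/-- The limit set of a sequence of subdivisions along an ultrafilter. -/
def limitSet (𝒰 : Ultrafilter ℕ) (P : ℕ → Subdivision T) : Set ℝ :=
  {x | ∀ η > 0, ∀ᶠ N in (𝒰 : Filter ℕ), ∃ i ≤ (P N).n, |(P N).c i - x| < η}

variable {𝒰 : Ultrafilter ℕ} {P : ℕ → Subdivision T}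

lemma mem_limitSet {i : ℕ → ℕ} {x : ℝ} (hi : ∀ᶠ N in (𝒰 : Filter ℕ), i N ≤ (P N).n)
    (h : Tendsto (fun N => (P N).c (i N)) 𝒰 (𝓝 x)) : x ∈ limitSet 𝒰 P := fun η hη => by
  filter_upwards [hi, Metric.tendsto_nhds.1 h η hη] with N h1 h2
  exact ⟨i N, h1, h2⟩

lemma eventually_of_notMem_limitSet {x : ℝ} (h : x ∉ limitSet 𝒰 P) :
    ∃ η > 0, ∀ᶠ N in (𝒰 : Filter ℕ), ∀ i ≤ (P N).n, η ≤ |(P N).c i - x| := by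
  simp only [limitSet, mem_ofPred_eq, not_forall] at h
  obtain ⟨η, hη, h⟩ := h
  refine ⟨η, hη, ?_⟩
  rw [← Ultrafilter.eventually_not] at h
  filter_upwards [h] with N hN i hi
  exact not_lt.1 fun h' => hN ⟨i, hi, h'⟩

lemma isClosed_limitSet : IsClosed (limitSet 𝒰 P) := by
  rw [← isOpen_compl_iff, Metric.isOpen_iff]
  intro x hx
  obtain ⟨η, hη, h⟩ := eventually_of_notMem_limitSet hx
  refine ⟨η / 2, by positivity, fun y hy hy2 => ?_⟩
  obtain ⟨N, h1, i, hi, h2⟩ := (h.and (hy2 (η / 2) (by positivity))).exists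
  have h3 := h1 i hi
  rw [Metric.mem_ball, Real.dist_eq] at hy
  have := abs_add_le ((P N).c i - y) (y - x)
  rw [sub_add_sub_cancel] at this
  linarith

lemma limitSet_subset : limitSet 𝒰 P ⊆ Icc 0 T := by
  intro x hx
  constructor
  · refine le_of_forall_pos_le_add fun η hη => ?_
    obtain ⟨N, i, hi, h⟩ := (hx η hη).exists
    have := ((P N).mem_Icc hi).1
    have := (abs_lt.1 h).2
    linarith
  · refine le_of_forall_pos_le_add fun η hη => ?_
    obtain ⟨N, i, hi, h⟩ := (hx η hη).exists
    have := ((P N).mem_Icc hi).2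
    have := (abs_lt.1 h).1
    linarith

lemma zero_mem_limitSet : 0 ∈ limitSet 𝒰 P :=
  mem_limitSet (i := fun _ => 0) (by simp) (by simp [zero])

lemma last_mem_limitSet : T ∈ limitSet 𝒰 P :=
  mem_limitSet (i := fun N => (P N).n) (by simp) (by simp [last])

lemma exists_tendsto {i : ℕ → ℕ} (hi : ∀ᶠ N in (𝒰 : Filter ℕ), i N ≤ (P N).n) :
    ∃ x, Tendsto (fun N => (P N).c (i N)) 𝒰 (𝓝 x) := by
  obtain ⟨x, -, hx⟩ := isCompact_Icc.ultrafilter_le_nhds (𝒰.map fun N => (P N).c (i N))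
    (by
      rw [Filter.le_principal_iff]
      show ∀ᶠ N in (𝒰 : Filter ℕ), (P N).c (i N) ∈ Icc 0 T
      filter_upwards [hi] with N h
      exact (P N).mem_Icc h)
  exact ⟨x, hx⟩

/-- A limit point strictly between `a` and `b` would eventually place a subdivision point between
two consecutive ones. -/
lemma disjoint_limitSet {i : ℕ → ℕ} {a b : ℝ}
    (ha : Tendsto (fun N => (P N).c (i N)) 𝒰 (𝓝 a))
    (hb : Tendsto (fun N => (P N).c (i N + 1)) 𝒰 (𝓝 b)) : Disjoint (Ioo a b) (limitSet 𝒰 P) := by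
  rw [Set.disjoint_left]
  intro x hx hxE
  have h1 : a < x - min (x - a) (b - x) / 2 := by
    have := min_le_left (x - a) (b - x); linarith [hx.1]
  have h2 : x + min (x - a) (b - x) / 2 < b := by
    have := min_le_right (x - a) (b - x); linarith [hx.2]
  have h3 : 0 < min (x - a) (b - x) / 2 := by
    have : 0 < min (x - a) (b - x) := lt_min (by linarith [hx.1]) (by linarith [hx.2])
    positivity
  obtain ⟨N, h4, h5, j, hj, h6⟩ := ((ha.eventually (Iio_mem_nhds h1)).and
    ((hb.eventually (Ioi_mem_nhds h2)).and (hxE _ h3))).exists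
  rw [abs_lt] at h6
  have h4' : (P N).c (i N) < _ := h4
  have h5' : _ < (P N).c (i N + 1) := h5
  rcases Nat.lt_or_ge (i N) j with h | h
  · have := (P N).mono (show i N + 1 ≤ j by omega); linarith
  · have := (P N).mono h; linarith

/-- The intervals of the subdivisions around the midpoint of a complementary interval of the limit
set converge to that interval. -/
lemma tendsto_index {p : ℝ × ℝ} (hp : p ∈ gaps (limitSet 𝒰 P)) :
    Tendsto (fun N => (P N).c ((P N).index ((p.1 + p.2) / 2))) 𝒰 (𝓝 p.1) ∧
    Tendsto (fun N => (P N).c ((P N).index ((p.1 + p.2) / 2) + 1)) 𝒰 (𝓝 p.2) := by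
  obtain ⟨hlt, h1, h2, hd⟩ := hp
  have hm0 : 0 ≤ (p.1 + p.2) / 2 := by linarith [(limitSet_subset h1).1, (limitSet_subset h2).1]
  have hm1 : (p.1 + p.2) / 2 < T := by linarith [(limitSet_subset h1).2, (limitSet_subset h2).2]
  have hs := fun N => (P N).index_spec hm0 hm1
  have hi1 : ∀ᶠ N in (𝒰 : Filter ℕ), (P N).index ((p.1 + p.2) / 2) ≤ (P N).n :=
    Eventually.of_forall fun N => (hs N).1.le
  have hi2 : ∀ᶠ N in (𝒰 : Filter ℕ), (P N).index ((p.1 + p.2) / 2) + 1 ≤ (P N).n :=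
    Eventually.of_forall fun N => (hs N).1
  obtain ⟨a, ha⟩ := exists_tendsto hi1
  obtain ⟨b, hb⟩ := exists_tendsto hi2
  have haE := mem_limitSet hi1 ha
  have hbE := mem_limitSet hi2 hb
  have ham : a ≤ (p.1 + p.2) / 2 := le_of_tendsto' ha fun N => (hs N).2.1
  have hbm : (p.1 + p.2) / 2 ≤ b := ge_of_tendsto' hb fun N => (hs N).2.2.le
  have hd' := disjoint_limitSet ha hb
  rw [Set.disjoint_left] at hd hd'
  have e1 : a = p.1 := by
    by_contra hne
    rcases lt_or_gt_of_ne hne with h | h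
    · exact hd' ⟨h, by linarith⟩ h1
    · exact hd ⟨h, by linarith⟩ haE
  have e2 : b = p.2 := by
    by_contra hne
    rcases lt_or_gt_of_ne hne with h | h
    · exact hd ⟨by linarith, h⟩ hbE
    · exact hd' ⟨by linarith, h⟩ h2
  exact ⟨e1 ▸ ha, e2 ▸ hb⟩

/-- Eventually all the intervals of the subdivision of length more than `s` are among those
belonging to the complementary intervals in `S`. -/
lemma eventually_short {s : ℝ} (hs0 : 0 < s) {S : Finset (gaps (limitSet 𝒰 P))}
    (hS : ∀ p : gaps (limitSet 𝒰 P), s ≤ p.1.2 - p.1.1 → p ∈ S) :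
    ∀ᶠ N in (𝒰 : Filter ℕ), ∀ i < (P N).n,
      (∀ p ∈ S, (P N).index ((p.1.1 + p.1.2) / 2) ≠ i) → (P N).c (i + 1) - (P N).c i ≤ s := by
  by_contra hcon
  -- For an ultrafilter, failure of an eventual statement is itself eventual. The offending long
  -- intervals therefore converge to a gap of length at least `s`, which belongs to `S`; but
  -- eventually they contain its midpoint, so they are indexed by it after all.
  rw [← Ultrafilter.eventually_not] at hcon
  have hex : ∀ N, ∃ i, ¬ (∀ i < (P N).n, (∀ p ∈ S, (P N).index ((p.1.1 + p.1.2) / 2) ≠ i) →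
      (P N).c (i + 1) - (P N).c i ≤ s) →
      i < (P N).n ∧ (∀ p ∈ S, (P N).index ((p.1.1 + p.1.2) / 2) ≠ i) ∧
      s < (P N).c (i + 1) - (P N).c i := fun N => by
    by_cases h : ∀ i < (P N).n, (∀ p ∈ S, (P N).index ((p.1.1 + p.1.2) / 2) ≠ i) →
      (P N).c (i + 1) - (P N).c i ≤ s
    · exact ⟨0, fun h' => absurd h h'⟩
    · have h' := h
      push Not at h'
      obtain ⟨i, h1, h2, h3⟩ := h'
      exact ⟨i, fun _ => ⟨h1, h2, h3⟩⟩
  choose i hi using hex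
  have hev : ∀ᶠ N in (𝒰 : Filter ℕ), i N < (P N).n ∧
      (∀ p ∈ S, (P N).index ((p.1.1 + p.1.2) / 2) ≠ i N) ∧
      s < (P N).c (i N + 1) - (P N).c (i N) := by
    filter_upwards [hcon] with N hN using hi N hN
  obtain ⟨a, ha⟩ := exists_tendsto (hev.mono fun N h => h.1.le)
  obtain ⟨b, hb⟩ := exists_tendsto (i := fun N => i N + 1) (hev.mono fun N h => h.1)
  have hab : s ≤ b - a := ge_of_tendsto (hb.sub ha) (hev.mono fun N h => h.2.2.le)
  have hg : (a, b) ∈ gaps (limitSet 𝒰 P) :=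
    ⟨by simp only; linarith, mem_limitSet (hev.mono fun N h => h.1.le) ha,
      mem_limitSet (i := fun N => i N + 1) (hev.mono fun N h => h.1) hb, disjoint_limitSet ha hb⟩
  have hmem := hS ⟨(a, b), hg⟩ hab
  have h1 : a < (a + b) / 2 := by linarith
  have h2 : (a + b) / 2 < b := by linarith
  have hm0 : 0 ≤ (a + b) / 2 := by linarith [(limitSet_subset hg.2.1).1]
  have hm1 : (a + b) / 2 < T := by
    have : b ≤ T := (limitSet_subset hg.2.2.1).2
    linarith
  obtain ⟨N, h3, h4, h5⟩ := (hev.and ((ha.eventually (Iio_mem_nhds h1)).and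
    (hb.eventually (Ioi_mem_nhds h2)))).exists
  have h4' : (P N).c (i N) < (a + b) / 2 := h4
  have h5' : (a + b) / 2 < (P N).c (i N + 1) := h5
  exact h3.2.1 _ hmem ((P N).index_unique ((P N).index_spec hm0 hm1).2 ⟨h4'.le, h5'⟩)

/-- If two gaps were represented by the same subdivision interval for almost all `N`, its end points
would have both pairs of end points as limits. -/
lemma eventually_injOn (S : Finset (gaps (limitSet 𝒰 P))) :
    ∀ᶠ N in (𝒰 : Filter ℕ), InjOn (fun p : gaps (limitSet 𝒰 P) =>
      (P N).index ((p.1.1 + p.1.2) / 2)) S := by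
  have : ∀ p ∈ S, ∀ q ∈ S, ∀ᶠ N in (𝒰 : Filter ℕ),
      (P N).index ((p.1.1 + p.1.2) / 2) = (P N).index ((q.1.1 + q.1.2) / 2) → p = q := by
    intro p _ q _
    by_cases hpq : p = q
    · exact Eventually.of_forall fun _ _ => hpq
    · have : ¬ ∀ᶠ N in (𝒰 : Filter ℕ),
          (P N).index ((p.1.1 + p.1.2) / 2) = (P N).index ((q.1.1 + q.1.2) / 2) := by
        intro h
        apply hpq
        obtain ⟨hp1, hp2⟩ := tendsto_index p.2
        obtain ⟨hq1, hq2⟩ := tendsto_index q.2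
        have e1 := tendsto_nhds_unique hp1 (hq1.congr' (h.mono fun N hN => by beta_reduce; rw [hN]))
        have e2 := tendsto_nhds_unique hp2 (hq2.congr' (h.mono fun N hN => by beta_reduce; rw [hN]))
        exact Subtype.ext (Prod.ext e1 e2)
      rw [← Ultrafilter.eventually_not] at this
      filter_upwards [this] with N h1 h2 using absurd h2 h1
  have h2 := (Filter.eventually_all_finset S).2 fun p hp =>
    (Filter.eventually_all_finset S).2 fun q hq => this p hp q hq
  filter_upwards [h2] with N hN p hp q hq h using hN p hp q hq h

end Subdivision

end KorenblumType

/-! ### From subdivisions of negative cost to a Carleson set -/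

namespace KorenblumType

/-- The bound imposed on the increments of the approximating distribution functions. -/
def cost (Λ : Majorant) (D : ℝ → ℝ) (C ε N x y : ℝ) : ℝ :=
  min (min (C * Λ.kap (y - x)) ε) (D y - D x + N * Λ.kap (y - x))

/-- The defect of a complementary interval. -/
def defect (Λ : Majorant) (m : ℝ → ℝ → ℝ) (C ε : ℝ) (p : ℝ × ℝ) : ℝ :=
  min (C * Λ.kap (p.2 - p.1)) ε - m p.1 p.2

section limit

variable {Λ : Majorant} {D : ℝ → ℝ} {C₀ ε : ℝ} {m : ℝ → ℝ → ℝ} {𝒰 : Ultrafilter ℕ}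
  {P : ℕ → Subdivision (2 * Real.pi)}

/-- The constant `C₀ + 1` in the cost exceeds the modulus constant of `D` by one, and this spare
unit is the gain. It is what produces the finite entropy and the null measure of the limit set. -/
lemma kap_le_cost_sub (hD : UpperModOn Λ C₀ D) {x y N : ℝ} (hx : 0 ≤ x) (hxy : x ≤ y)
    (hy : y ≤ 2 * Real.pi) (hs : (C₀ + 1) * Λ.kap (y - x) ≤ ε) (hN : 1 ≤ N) :
    Λ.kap (y - x) ≤ cost Λ D (C₀ + 1) ε N x y - (D y - D x) := by
  have h1 := hD x y hx hxy hy
  have h2 := Λ.kap_nonneg (t := y - x) (by linarith) (by linarith)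
  rw [le_sub_iff_add_le, cost, le_min_iff, le_min_iff]
  refine ⟨⟨?_, ?_⟩, ?_⟩ <;> nlinarith

lemma gaps_bounds {p : ℝ × ℝ} (hp : p ∈ gaps (Subdivision.limitSet 𝒰 P)) :
    0 ≤ p.1 ∧ p.1 < p.2 ∧ p.2 ≤ 2 * Real.pi :=
  ⟨(Subdivision.limitSet_subset hp.2.1).1, hp.1, (Subdivision.limitSet_subset hp.2.2.1).2⟩

/-- The subdivision intervals converge to a gap of positive length, so their term `N * kap` tends to
infinity and eventually only `min (C * kap) ε` matters in the cost. The hypothesis `husc` is upper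
semicontinuity of the increment of `D`, with limit value `m`. -/
lemma eventually_defect_le (h𝒰 : (𝒰 : Filter ℕ) ≤ atTop)
    (husc : ∀ a b, 0 ≤ a → a < b → b ≤ 2 * Real.pi → ∀ η > 0, ∃ δ > 0, ∀ x y, 0 ≤ x → x ≤ y →
      y ≤ 2 * Real.pi → |x - a| < δ → |y - b| < δ → D y - D x ≤ m a b + η)
    {p : ℝ × ℝ} (hp : p ∈ gaps (Subdivision.limitSet 𝒰 P)) {η : ℝ} (hη : 0 < η) (C : ℝ) :
    ∀ᶠ N : ℕ in (𝒰 : Filter ℕ), defect Λ m C ε p - η ≤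
      cost Λ D C ε N ((P N).c ((P N).index ((p.1 + p.2) / 2)))
        ((P N).c ((P N).index ((p.1 + p.2) / 2) + 1)) -
      (D ((P N).c ((P N).index ((p.1 + p.2) / 2) + 1)) -
        D ((P N).c ((P N).index ((p.1 + p.2) / 2)))) := by
  obtain ⟨h0, hlt, hT⟩ := gaps_bounds hp
  obtain ⟨hl, hu⟩ := Subdivision.tendsto_index hp
  have hs := fun N => (P N).index_spec (m := (p.1 + p.2) / 2) (by linarith) (by linarith)
  set l := fun N => (P N).c ((P N).index ((p.1 + p.2) / 2)) with hl_def
  set u := fun N => (P N).c ((P N).index ((p.1 + p.2) / 2) + 1) with hu_def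
  have hl0 : ∀ N, 0 ≤ l N := fun N => ((P N).mem_Icc (hs N).1.le).1
  have huT : ∀ N, u N ≤ 2 * Real.pi := fun N => ((P N).mem_Icc (hs N).1).2
  have hlu : ∀ N, l N ≤ u N := fun N => (P N).mono (Nat.le_succ _)
  have hk : Tendsto (fun N => Λ.kap (u N - l N)) 𝒰 (𝓝 (Λ.kap (p.2 - p.1))) := by
    have hc := Λ.kap_continuousOn (p.2 - p.1) ⟨by linarith, by linarith⟩
    refine hc.tendsto.comp (tendsto_nhdsWithin_iff.2 ⟨hu.sub hl, Eventually.of_forall fun N => ?_⟩)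
    exact ⟨by linarith [hlu N], by linarith [hl0 N, huT N]⟩
  have hkpos : 0 < Λ.kap (p.2 - p.1) := Λ.kap_pos (by linarith) (by linarith)
  obtain ⟨δ, hδ, husc⟩ := husc p.1 p.2 h0 hlt hT (η / 2) (by positivity)
  have hNk : Tendsto (fun N : ℕ => (N : ℝ) * Λ.kap (u N - l N)) 𝒰 atTop :=
    (tendsto_natCast_atTop_atTop.mono_left h𝒰).atTop_mul_pos hkpos hk
  have hmin : Tendsto (fun N => min (C * Λ.kap (u N - l N)) ε) 𝒰
      (𝓝 (min (C * Λ.kap (p.2 - p.1)) ε)) := (hk.const_mul C).min tendsto_const_nhds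
  filter_upwards [Metric.tendsto_nhds.1 hl δ hδ, Metric.tendsto_nhds.1 hu δ hδ,
    hNk.eventually (eventually_ge_atTop (defect Λ m C ε p)),
    hmin.eventually (Ioi_mem_nhds (show min (C * Λ.kap (p.2 - p.1)) ε - η / 2 <
      min (C * Λ.kap (p.2 - p.1)) ε by linarith))] with N h1 h2 h3 h4
  have h5 := husc (l N) (u N) (hl0 N) (hlu N) (huT N) h1 h2
  have h4' : min (C * Λ.kap (p.2 - p.1)) ε - η / 2 < min (C * Λ.kap (u N - l N)) ε := h4
  show defect Λ m C ε p - η ≤ cost Λ D C ε N (l N) (u N) - (D (u N) - D (l N))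
  rw [le_sub_iff_add_le, cost, le_min_iff]
  constructor
  · refine le_trans ?_ h4'.le
    unfold defect
    linarith
  · linarith

/-- The limit of the inequalities `∑ cost < 0`. -/
lemma sum_defect_le (h𝒰 : (𝒰 : Filter ℕ) ≤ atTop) (hD : UpperModOn Λ C₀ D)
    (hD0 : D 0 = 0) (hD1 : D (2 * Real.pi) = 0)
    (husc : ∀ a b, 0 ≤ a → a < b → b ≤ 2 * Real.pi → ∀ η > 0, ∃ δ > 0, ∀ x y, 0 ≤ x → x ≤ y →
      y ≤ 2 * Real.pi → |x - a| < δ → |y - b| < δ → D y - D x ≤ m a b + η)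
    (hbad : ∀ N : ℕ, ∑ i ∈ Finset.range (P N).n,
      cost Λ D (C₀ + 1) ε N ((P N).c i) ((P N).c (i + 1)) < 0)
    {s θ : ℝ} (hs : 0 < s) (hsT : s ≤ 2 * Real.pi)
    (hsε : ∀ t, 0 ≤ t → t ≤ s → (C₀ + 1) * Λ.kap t ≤ ε) (hθ : θ ≤ Λ.kap s / s)
    {S : Finset (gaps (Subdivision.limitSet 𝒰 P))}
    (hS : ∀ p : gaps (Subdivision.limitSet 𝒰 P), s ≤ p.1.2 - p.1.1 → p ∈ S) :
    ∑ p ∈ S, defect Λ m (C₀ + 1) ε p + θ * (2 * Real.pi - ∑ p ∈ S, (p.1.2 - p.1.1)) ≤ 0 := by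
  classical
  refine le_of_forall_pos_le_add fun e he => ?_
  set η := e / ((S.card : ℝ) + 1) with hη_def
  have hη : 0 < η := by positivity
  have hSη : (S.card : ℝ) * η ≤ e := by
    rw [hη_def, mul_div_assoc', div_le_iff₀ (by positivity)]
    nlinarith
  have hev := (Filter.eventually_all_finset S).2 fun p _ =>
    eventually_defect_le (Λ := Λ) (ε := ε) h𝒰 husc p.2 hη (C₀ + 1)
  have hlim : Tendsto (fun N => ∑ p ∈ S, (defect Λ m (C₀ + 1) ε p - η) +
      θ * (2 * Real.pi - ∑ p ∈ S, ((P N).c ((P N).index ((p.1.1 + p.1.2) / 2) + 1) -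
        (P N).c ((P N).index ((p.1.1 + p.1.2) / 2))))) 𝒰
      (𝓝 (∑ p ∈ S, (defect Λ m (C₀ + 1) ε p - η) +
        θ * (2 * Real.pi - ∑ p ∈ S, (p.1.2 - p.1.1)))) := by
    refine tendsto_const_nhds.add ((tendsto_const_nhds.sub (tendsto_finsetSum _ fun p _ => ?_)).const_mul _)
    exact (Subdivision.tendsto_index p.2).2.sub (Subdivision.tendsto_index p.2).1
  have hle := le_of_tendsto hlim (b := 0) ?_
  · rw [Finset.sum_sub_distrib, Finset.sum_const, nsmul_eq_mul] at hle
    linarith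
  filter_upwards [hev, Subdivision.eventually_short hs hS, Subdivision.eventually_injOn S,
    h𝒰 (eventually_ge_atTop 1)] with N h1 h2 h3 h4
  set σ : gaps (Subdivision.limitSet 𝒰 P) → ℕ := fun p => (P N).index ((p.1.1 + p.1.2) / 2)
  set x := (P N).c with hx
  set f : ℕ → ℝ := fun i => cost Λ D (C₀ + 1) ε N (x i) (x (i + 1)) - (D (x (i + 1)) - D (x i))
    with hf
  have hσ : S.image σ ⊆ Finset.range (P N).n := by
    intro i hi
    obtain ⟨p, hp, rfl⟩ := Finset.mem_image.1 hi
    obtain ⟨h0, hlt, hT⟩ := gaps_bounds p.2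
    exact Finset.mem_range.2 ((P N).index_spec (by linarith) (by linarith)).1
  have hsplit : ∀ g : ℕ → ℝ, ∑ i ∈ Finset.range (P N).n, g i =
      ∑ p ∈ S, g (σ p) + ∑ i ∈ Finset.range (P N).n \ S.image σ, g i := fun g => by
    rw [← Finset.sum_sdiff hσ, Finset.sum_image h3, add_comm]
  -- Subtracting the increments of `D` from the costs does not change the total, because they
  -- telescope to `D (2π) - D 0 = 0`.
  have htot : ∑ i ∈ Finset.range (P N).n, f i < 0 := by
    rw [hf, Finset.sum_sub_distrib, Finset.sum_range_sub (fun i => D (x i)), hx, (P N).last,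
      (P N).zero, hD0, hD1, sub_zero, sub_zero]
    exact hbad N
  have hlen : ∑ i ∈ Finset.range (P N).n, (x (i + 1) - x i) = 2 * Real.pi := by
    rw [Finset.sum_range_sub, hx, (P N).last, (P N).zero, sub_zero]
  rw [hsplit] at htot hlen
  -- Each remaining interval has length at most `s`, so its contribution is at least `kap(length)`,
  -- hence at least `kap s / s` times the length, since `kap t / t` is non-increasing.
  have hshort : ∀ i ∈ Finset.range (P N).n \ S.image σ, θ * (x (i + 1) - x i) ≤ f i := by
    intro i hi
    rw [Finset.mem_sdiff, Finset.mem_range, Finset.mem_image] at hi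
    have hl := h2 i hi.1 fun p hp he => hi.2 ⟨p, hp, he⟩
    have hi0 := ((P N).mem_Icc hi.1.le).1
    have hi1 := ((P N).mem_Icc (i := i + 1) hi.1).2
    have hmono : x i ≤ x (i + 1) := (P N).mono (Nat.le_succ i)
    have hd : 0 ≤ x (i + 1) - x i := by linarith
    refine le_trans ?_ (kap_le_cost_sub hD hi0 hmono hi1 (hsε _ hd hl) (by exact_mod_cast h4))
    have h5 := Λ.mul_kap_le hd hl hsT
    calc θ * (x (i + 1) - x i) ≤ Λ.kap s / s * (x (i + 1) - x i) :=
          mul_le_mul_of_nonneg_right hθ hd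
      _ = (x (i + 1) - x i) * Λ.kap s / s := by ring
      _ ≤ s * Λ.kap (x (i + 1) - x i) / s := by gcongr
      _ = _ := by field_simp
  have h6 := Finset.sum_le_sum hshort
  rw [← Finset.mul_sum] at h6
  have h7 : ∑ p ∈ S, (defect Λ m (C₀ + 1) ε p - η) ≤ ∑ p ∈ S, f (σ p) :=
    Finset.sum_le_sum fun p hp => h1 p hp
  have h8 : 2 * Real.pi - ∑ p ∈ S, (x (σ p + 1) - x (σ p)) =
      ∑ i ∈ Finset.range (P N).n \ S.image σ, (x (i + 1) - x i) := by linarith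
  rw [h8]
  linarith

/-- Off the finite set the terms are nonnegative, and their partial sums are bounded by minus the
sum over `S₀`. -/
lemma summable_of_sum_le_of_nonneg_off {ι : Type*} {f : ι → ℝ} (S₀ : Finset ι)
    (h0 : ∀ i ∉ S₀, 0 ≤ f i) (h : ∀ S, S₀ ⊆ S → ∑ i ∈ S, f i ≤ 0) :
    Summable f ∧ ∑' i, f i ≤ 0 := by
  classical
  have hs : Summable f := by
    rw [← S₀.summable_compl_iff]
    refine summable_of_sum_le (c := -∑ i ∈ S₀, f i) (fun i => h0 i.1 i.2) fun u => ?_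
    have h1 := h (S₀ ∪ u.map ⟨Subtype.val, Subtype.val_injective⟩) Finset.subset_union_left
    rw [Finset.sum_union ?_, Finset.sum_map] at h1
    · simp only [Function.Embedding.coeFn_mk] at h1
      linarith
    · rw [Finset.disjoint_right]
      intro i hi
      obtain ⟨j, -, rfl⟩ := Finset.mem_map.1 hi
      exact j.2
  refine ⟨hs, le_of_tendsto hs.hasSum ?_⟩
  filter_upwards [eventually_ge_atTop S₀] with S hS using h S hS

/-- If for every `N` some subdivision has negative total cost, then there is a closed set of
measure zero and finite entropy whose complementary intervals have positive total mass. -/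
theorem exists_carleson_gaps (hC₀ : 0 ≤ C₀) (hε : 0 < ε) (hD : UpperModOn Λ C₀ D)
    (hD0 : D 0 = 0) (hD1 : D (2 * Real.pi) = 0)
    (hm : ∀ a b, 0 ≤ a → a < b → b ≤ 2 * Real.pi → m a b ≤ C₀ * Λ.kap (b - a))
    (husc : ∀ a b, 0 ≤ a → a < b → b ≤ 2 * Real.pi → ∀ η > 0, ∃ δ > 0, ∀ x y, 0 ≤ x → x ≤ y →
      y ≤ 2 * Real.pi → |x - a| < δ → |y - b| < δ → D y - D x ≤ m a b + η)
    (hbad : ∀ N : ℕ, ∃ P : Subdivision (2 * Real.pi), ∑ i ∈ Finset.range P.n,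
      cost Λ D (C₀ + 1) ε N (P.c i) (P.c (i + 1)) < 0) :
    ∃ E : Set ℝ, IsClosed E ∧ E ⊆ Icc 0 (2 * Real.pi) ∧ 0 ∈ E ∧ 2 * Real.pi ∈ E ∧
      volume E = 0 ∧ Summable (fun p : gaps E => Λ.kap (p.1.2 - p.1.1)) ∧
      0 < ∑' p : gaps E, m p.1.1 p.1.2 := by
  classical
  choose P hP using hbad
  let 𝒰 : Ultrafilter ℕ := hyperfilter ℕ
  have h𝒰 : (𝒰 : Filter ℕ) ≤ atTop := Nat.hyperfilter_le_atTop
  set E := Subdivision.limitSet 𝒰 P with hE_def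
  have hEsub : E ⊆ Icc 0 (2 * Real.pi) := Subdivision.limitSet_subset
  obtain ⟨η₀, hη₀, hη₀T, hk⟩ := Λ.exists_kap_le (ε := ε / (C₀ + 1)) (by positivity)
  have hkε : ∀ t, 0 ≤ t → t ≤ η₀ → (C₀ + 1) * Λ.kap t ≤ ε := fun t h0 h1 => by
    have := hk t h0 h1
    rwa [le_div_iff₀ (by positivity), mul_comm] at this
  have hfin : ∀ s, 0 < s → {p : gaps E | s ≤ p.1.2 - p.1.1}.Finite := fun s hs =>
    finite_long_gaps hEsub hs
  let τ : gaps E → ℝ := fun p => defect Λ m (C₀ + 1) ε p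
  let S₀ : Finset (gaps E) := (hfin η₀ hη₀).toFinset
  have hτk : ∀ p : gaps E, p ∉ S₀ → Λ.kap (p.1.2 - p.1.1) ≤ τ p := fun p hp => by
    obtain ⟨h0, hlt, hT⟩ := gaps_bounds p.2
    have hlen : p.1.2 - p.1.1 ≤ η₀ := by
      by_contra hcon
      exact hp ((hfin η₀ hη₀).mem_toFinset.2 (not_le.1 hcon).le)
    simp only [τ, defect]
    rw [min_eq_left (hkε _ (by linarith) hlen)]
    have := hm _ _ h0 hlt hT
    linarith
  have hknn : ∀ p : gaps E, 0 < Λ.kap (p.1.2 - p.1.1) := fun p => by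
    obtain ⟨h0, hlt, hT⟩ := gaps_bounds p.2
    exact Λ.kap_pos (by linarith) (by linarith)
  -- Two choices of `θ` are exploited: `θ = 0` bounds the sums of the defects, and hence the
  -- entropy; `θ = kap s / s`, which tends to infinity as `s → 0`, controls the length not covered
  -- by gaps.
  have hmain : ∀ s θ, 0 < s → s ≤ η₀ → θ ≤ Λ.kap s / s → ∀ S : Finset (gaps E),
      (∀ p : gaps E, s ≤ p.1.2 - p.1.1 → p ∈ S) →
      ∑ p ∈ S, τ p + θ * (2 * Real.pi - ∑ p ∈ S, (p.1.2 - p.1.1)) ≤ 0 :=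
    fun s θ hs hs1 hθ S hS => sum_defect_le h𝒰 hD hD0 hD1 husc hP hs (hs1.trans hη₀T)
      (fun t h0 h1 => hkε t h0 (h1.trans hs1)) hθ hS
  have hsumτ : ∀ S, S₀ ⊆ S → ∑ p ∈ S, τ p ≤ 0 := fun S hS => by
    have := hmain η₀ 0 hη₀ le_rfl (div_nonneg (Λ.kap_nonneg hη₀.le hη₀T) hη₀.le) S
      fun p hp => hS ((hfin η₀ hη₀).mem_toFinset.2 hp)
    simpa using this
  obtain ⟨hτs, hτ0⟩ := summable_of_sum_le_of_nonneg_off S₀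
    (fun p hp => (hknn p).le.trans (hτk p hp)) hsumτ
  have hks : Summable (fun p : gaps E => Λ.kap (p.1.2 - p.1.1)) := by
    rw [← S₀.summable_compl_iff]
    exact Summable.of_nonneg_of_le (fun p => (hknn _).le) (fun p => hτk p.1 p.2)
      (S₀.summable_compl_iff.2 hτs)
  have hmins : Summable (fun p : gaps E => min ((C₀ + 1) * Λ.kap (p.1.2 - p.1.1)) ε) :=
    Summable.of_nonneg_of_le (fun p => le_min (mul_nonneg (by positivity) (hknn p).le) hε.le)
      (fun p => min_le_left _ _) (hks.mul_left _)
  -- Without gaps the empty family would be admissible, and the main inequality would read `(kap η₀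
  -- / η₀) * 2π ≤ 0`.
  have hne : Nonempty (gaps E) := by
    by_contra hemp
    rw [not_nonempty_iff] at hemp
    have := hmain η₀ _ hη₀ le_rfl le_rfl ∅
      fun p => (hemp.false p).elim
    have h1 : 0 < Λ.kap η₀ / η₀ := div_pos (Λ.kap_pos hη₀ hη₀T) hη₀
    have h2 := mul_pos h1 Real.two_pi_pos
    simp at this
    linarith
  have hminpos : 0 < ∑' p : gaps E, min ((C₀ + 1) * Λ.kap (p.1.2 - p.1.1)) ε := by
    obtain ⟨p⟩ := hne
    exact hmins.tsum_pos (fun q => le_min (mul_nonneg (by positivity) (hknn q).le) hε.le) p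
      (lt_min (mul_pos (by positivity) (hknn p)) hε)
  have hmeq : (fun p : gaps E => m p.1.1 p.1.2) =
      fun p => min ((C₀ + 1) * Λ.kap (p.1.2 - p.1.1)) ε - τ p := by
    ext p; simp only [τ, defect]; ring
  refine ⟨E, Subdivision.isClosed_limitSet, hEsub, Subdivision.zero_mem_limitSet,
    Subdivision.last_mem_limitSet, ?_, hks, ?_⟩
  · set K := -∑ p ∈ S₀, τ p with hK
    -- The measure of `E` is at most the length left over by the gaps of length at least `s`. The
    -- defects of these gaps sum to at least `-K`, so the main inequality bounds that leftover by `K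
    -- * (s / kap s)`, and `s / kap s = 2π / Λ(s / 2π)` tends to `0`.
    have hbound : ∀ s, 0 < s → s ≤ η₀ → (volume E).toReal ≤ K * (s / Λ.kap s) := by
      intro s hs hs1
      set S := (hfin s hs).toFinset
      have hks : 0 < Λ.kap s := Λ.kap_pos hs (hs1.trans hη₀T)
      have h1 := hmain s _ hs hs1 le_rfl S
        fun p hp => (hfin s hs).mem_toFinset.2 hp
      have hS₀S : S₀ ⊆ S := by
        intro p hp
        exact (hfin s hs).mem_toFinset.2 (hs1.trans ((hfin η₀ hη₀).mem_toFinset.1 hp))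
      have h2 : ∑ p ∈ S₀, τ p ≤ ∑ p ∈ S, τ p :=
        Finset.sum_le_sum_of_subset_of_nonneg hS₀S fun p _ hp => (hknn p).le.trans (hτk p hp)
      have h3 : 2 * Real.pi - ∑ p ∈ S, (p.1.2 - p.1.1) ≤ K * (s / Λ.kap s) := by
        rw [mul_div_assoc', le_div_iff₀ hks]
        have h4 : Λ.kap s / s * (2 * Real.pi - ∑ p ∈ S, (p.1.2 - p.1.1)) ≤ K := by linarith
        rw [div_mul_eq_mul_div, div_le_iff₀ hs] at h4
        linarith
      refine le_trans ?_ h3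
      have hU : MeasurableSet (⋃ p ∈ S, Ioo p.1.1 p.1.2) :=
        S.measurableSet_biUnion fun p _ => measurableSet_Ioo
      have hdis : Disjoint E (⋃ p ∈ S, Ioo p.1.1 p.1.2) := by
        simp only [disjoint_iUnion_right]
        exact fun p _ => p.2.2.2.2.symm
      have hvolU : volume (⋃ p ∈ S, Ioo p.1.1 p.1.2) =
          ENNReal.ofReal (∑ p ∈ S, (p.1.2 - p.1.1)) := by
        rw [measure_biUnion_finset (fun p _ q _ hpq => gaps_disjoint p.2 q.2
          fun h => hpq (Subtype.ext h)) fun p _ => measurableSet_Ioo,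
          ENNReal.ofReal_sum_of_nonneg fun p _ => by linarith [p.2.1]]
        simp [Real.volume_Ioo]
      have hle : volume E + volume (⋃ p ∈ S, Ioo p.1.1 p.1.2) ≤ volume (Icc 0 (2 * Real.pi)) := by
        rw [← measure_union hdis hU]
        refine measure_mono (union_subset hEsub (iUnion₂_subset fun p _ => ?_))
        obtain ⟨h0, hlt, hT⟩ := gaps_bounds p.2
        exact Ioo_subset_Icc_self.trans (Icc_subset_Icc h0 hT)
      have hEfin : volume E ≠ ⊤ := ((measure_mono hEsub).trans_lt measure_Icc_lt_top).ne
      rw [hvolU, Real.volume_Icc, sub_zero] at hle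
      have h5 := ENNReal.toReal_mono ENNReal.ofReal_ne_top hle
      rw [ENNReal.toReal_add hEfin ENNReal.ofReal_ne_top,
        ENNReal.toReal_ofReal (Finset.sum_nonneg fun p _ => by linarith [p.2.1]),
        ENNReal.toReal_ofReal Real.two_pi_pos.le] at h5
      linarith
    have hlim : Tendsto (fun s => K * (s / Λ.kap s)) (𝓝[>] 0) (𝓝 (K * 0)) := by
      refine Tendsto.const_mul _ ?_
      have h1 : Tendsto (fun s : ℝ => s / (2 * Real.pi)) (𝓝[>] 0) (𝓝[>] 0) := by
        refine tendsto_nhdsWithin_iff.2 ⟨?_, ?_⟩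
        · have : Tendsto (fun s : ℝ => s / (2 * Real.pi)) (𝓝 0) (𝓝 (0 / (2 * Real.pi))) :=
            tendsto_id.div_const _
          rw [zero_div] at this
          exact this.mono_left nhdsWithin_le_nhds
        · filter_upwards [self_mem_nhdsWithin] with s hs
          exact div_pos hs Real.two_pi_pos
      have h2 := (Λ.tendsto_atTop.comp h1).inv_tendsto_atTop.const_mul (2 * Real.pi)
      rw [mul_zero] at h2
      refine h2.congr' ?_
      filter_upwards [self_mem_nhdsWithin] with s hs
      have hs' : (s : ℝ) ≠ 0 := ne_of_gt hs
      simp only [Pi.inv_apply, Function.comp, Majorant.kap]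
      field_simp
    rw [mul_zero] at hlim
    have h0 : (volume E).toReal ≤ 0 := by
      refine ge_of_tendsto hlim ?_
      filter_upwards [Ioc_mem_nhdsGT hη₀] with s hs using hbound s hs.1 hs.2
    have hEfin : volume E ≠ ⊤ := ((measure_mono hEsub).trans_lt measure_Icc_lt_top).ne
    have h1 := le_antisymm h0 ENNReal.toReal_nonneg
    rw [ENNReal.toReal_eq_zero_iff] at h1
    exact h1.resolve_right hEfin
  -- The masses are the truncated moduli minus the defects. The former have positive sum, the latter
  -- nonpositive sum.
  · rw [hmeq, hmins.tsum_sub hτs]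
    linarith

end limit

end KorenblumType

namespace KorenblumType

/-! ### Arcs and their lengths -/

/-- The arc that is the image of an interval. -/
def Arc.image (s : Set ℝ) (hs : s.OrdConnected) : Arc := ⟨Circle.exp '' s, s, hs, rfl⟩

@[simp] lemma Arc.coe_image (s : Set ℝ) (hs : s.OrdConnected) :
    (Arc.image s hs : Set Circle) = Circle.exp '' s := rfl

lemma Arc.ext {I J : Arc} (h : (I : Set Circle) = J) : I = J := Subtype.ext h

lemma injOn_exp : InjOn Circle.exp (Ico 0 (2 * Real.pi)) :=
  Circle.exp_injOn_Ico (by simp)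

lemma circleMeasure_image {s : Set ℝ} (hs : s ⊆ Ico 0 (2 * Real.pi)) :
    circleMeasure (Circle.exp '' s) = volume.real s / (2 * Real.pi) := by
  unfold circleMeasure
  congr 2
  ext θ
  simp only [mem_ofPred_eq]
  constructor
  · rintro ⟨h1, t, ht, h2⟩
    rwa [← injOn_exp (hs ht) h1 h2]
  · exact fun h => ⟨hs h, mem_image_of_mem _ h⟩

lemma exists_angle (x : Circle) : ∃ θ ∈ Ico 0 (2 * Real.pi), Circle.exp θ = x := by
  obtain ⟨t, rfl⟩ := Circle.exp_surjective x
  refine ⟨toIcoMod Real.two_pi_pos 0 t, ?_, ?_⟩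
  · simpa using toIcoMod_mem_Ico Real.two_pi_pos 0 t
  · rw [← self_sub_toIcoDiv_zsmul]
    exact Circle.periodic_exp.sub_zsmul_eq _

lemma Ioo_subset_period {a b : ℝ} (ha : 0 ≤ a) (hb : b ≤ 2 * Real.pi) :
    Ioo a b ⊆ Ico 0 (2 * Real.pi) := fun _ hx => ⟨ha.trans hx.1.le, hx.2.trans_le hb⟩

lemma Ico_subset_period {a b : ℝ} (ha : 0 ≤ a) (hb : b ≤ 2 * Real.pi) :
    Ico a b ⊆ Ico 0 (2 * Real.pi) := fun _ hx => ⟨ha.trans hx.1, hx.2.trans_le hb⟩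

lemma circleMeasure_Ioo {a b : ℝ} (ha : 0 ≤ a) (hab : a ≤ b) (hb : b ≤ 2 * Real.pi) :
    circleMeasure (Circle.exp '' Ioo a b) = (b - a) / (2 * Real.pi) := by
  rw [circleMeasure_image (Ioo_subset_period ha hb), Real.volume_real_Ioo_of_le hab]

lemma circleMeasure_Ico {a b : ℝ} (ha : 0 ≤ a) (hab : a ≤ b) (hb : b ≤ 2 * Real.pi) :
    circleMeasure (Circle.exp '' Ico a b) = (b - a) / (2 * Real.pi) := by
  rw [circleMeasure_image (Ico_subset_period ha hb), Real.volume_real_Ico_of_le hab]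

namespace Premeasure

variable {Λ : Majorant} (μ : Premeasure)

lemma map_union_image {s t : Set ℝ} (hs : s.OrdConnected) (ht : t.OrdConnected)
    (hst : (s ∪ t).OrdConnected) (hd : Disjoint s t) (hsub : s ∪ t ⊆ Ico 0 (2 * Real.pi)) :
    μ (Arc.image (s ∪ t) hst) = μ (Arc.image s hs) + μ (Arc.image t ht) := by
  refine μ.map_union _ _ _ ?_ (image_union _ _ _)
  exact hd.image injOn_exp (subset_union_left.trans hsub) (subset_union_right.trans hsub)


lemma empty_eq {I : Arc} (h : (I : Set Circle) = ∅) : μ I = 0 := by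
  have := μ.map_union I I I (by rw [h]; exact disjoint_bot_left) (by simp)
  linarith

lemma dist_zero : μ.dist 0 = 0 := μ.empty_eq (by simp [Arc.initial])

lemma dist_two_pi : μ.dist (2 * Real.pi) = 0 := by
  rw [← μ.map_whole]
  refine congrArg μ.toFun (Arc.ext (eq_univ_of_forall fun x => ?_))
  obtain ⟨θ, hθ, rfl⟩ := exists_angle x
  exact mem_image_of_mem _ hθ

lemma dist_sub {a b : ℝ} (ha : 0 ≤ a) (hab : a ≤ b) (hb : b ≤ 2 * Real.pi) :
    μ.dist b - μ.dist a = μ (Arc.image (Ico a b) ordConnected_Ico) := by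
  have hu : Ico 0 a ∪ Ico a b = Ico 0 b := Ico_union_Ico_eq_Ico ha hab
  have := μ.map_union (Arc.initial a) (Arc.image (Ico a b) ordConnected_Ico) (Arc.initial b)
    (Disjoint.image (Ico_disjoint_Ico_same) injOn_exp (Ico_subset_period le_rfl (hab.trans hb))
      (Ico_subset_period ha hb)) (by
        show Circle.exp '' Ico 0 b = Circle.exp '' Ico 0 a ∪ Circle.exp '' Ico a b
        rw [← image_union, hu])
  unfold dist
  linarith

lemma exists_upperModOn (h : μ.IsBounded Λ) :
    ∃ C, 0 < C ∧ UpperModOn Λ C μ.dist ∧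
      ∀ a b, 0 ≤ a → a < b → b ≤ 2 * Real.pi →
        μ (Arc.image (Ioo a b) ordConnected_Ioo) ≤ C * Λ.kap (b - a) := by
  obtain ⟨C, hC, h⟩ := h
  refine ⟨C, hC, fun a b ha hab hb => ?_, fun a b ha hab hb => ?_⟩
  · rw [μ.dist_sub ha hab hb]
    refine (h _).trans (le_of_eq ?_)
    rw [Arc.coe_image, circleMeasure_Ico ha hab hb]; rfl
  · refine (h _).trans (le_of_eq ?_)
    rw [Arc.coe_image, circleMeasure_Ioo ha hab.le hb]; rfl

lemma tendsto_image {s : ℕ → Set ℝ} (hs : ∀ n, (s n).OrdConnected)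
    (hsub : ∀ n, s n ⊆ Ico 0 (2 * Real.pi)) (hanti : ∀ n, s (n + 1) ⊆ s n)
    (hempty : ⋂ n, s n = ∅) : Tendsto (fun n => μ (Arc.image (s n) (hs n))) atTop (𝓝 0) := by
  refine μ.tendsto_zero _ (fun n => image_mono (hanti n)) ?_
  simp only [Arc.coe_image]
  rw [← InjOn.image_iInter_eq (injOn_exp.mono (iUnion_subset hsub)), hempty, image_empty]

/-- The increments of the distribution function over intervals close to `(a, b)` are essentially
at most the mass of `(a, b)`. -/
lemma dist_sub_le_of_near {C : ℝ} (hC : 0 < C) (h : UpperModOn Λ C μ.dist) {a b : ℝ} (ha : 0 ≤ a)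
    (hab : a < b) (hb : b ≤ 2 * Real.pi) {η : ℝ} (hη : 0 < η) :
    ∃ δ > 0, ∀ x y, 0 ≤ x → x ≤ y → y ≤ 2 * Real.pi → |x - a| < δ → |y - b| < δ →
      μ.dist y - μ.dist x ≤ μ (Arc.image (Ioo a b) ordConnected_Ioo) + η := by
  -- The denominators start at `3` so that `a + d k` stays to the left of `b - d k`.
  let d : ℕ → ℝ := fun k => (b - a) / ((k : ℝ) + 3)
  have hba : 0 < b - a := by linarith
  have hd0 : ∀ k, 0 < d k := fun k => by positivity
  have hd3 : ∀ k, d k ≤ (b - a) / 3 := fun k => by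
    have := Nat.cast_nonneg (α := ℝ) k
    simp only [d]; gcongr; linarith
  have hdanti : ∀ k, d (k + 1) ≤ d k := fun k => by
    simp only [d]; gcongr; linarith
  have hdlim : Tendsto d atTop (𝓝 0) := by
    have h1 : Tendsto (fun k : ℕ => (k : ℝ) + 3) atTop atTop :=
      tendsto_atTop_add_const_right _ _ tendsto_natCast_atTop_atTop
    exact h1.const_div_atTop _
  have hl := μ.tendsto_image (s := fun k => Ioo a (a + d k)) (fun k => ordConnected_Ioo)
    (fun k => Ioo_subset_period ha (by linarith [hd3 k]))
    (fun k => Ioo_subset_Ioo_right (by linarith [hdanti k])) (by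
      refine eq_empty_of_forall_notMem fun x hx => ?_
      rw [mem_iInter] at hx
      have h1 : 0 < x - a := by linarith [(hx 0).1]
      obtain ⟨k, hk⟩ := (hdlim.eventually (Iio_mem_nhds h1)).exists
      have hk' : d k < x - a := hk
      linarith [(hx k).2])
  have hr := μ.tendsto_image (s := fun k => Ico (b - d k) b) (fun k => ordConnected_Ico)
    (fun k => Ico_subset_period (by linarith [hd3 k]) hb)
    (fun k => Ico_subset_Ico_left (by linarith [hdanti k])) (by
      refine eq_empty_of_forall_notMem fun x hx => ?_
      rw [mem_iInter] at hx
      have h1 : 0 < b - x := by linarith [(hx 0).2]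
      obtain ⟨k, hk⟩ := (hdlim.eventually (Iio_mem_nhds h1)).exists
      have hk' : d k < b - x := hk
      linarith [(hx k).1])
  obtain ⟨η₁, hη₁, hη₁T, hk1⟩ := Λ.exists_kap_le (ε := η / (4 * C)) (by positivity)
  have hCk : ∀ t, 0 ≤ t → t ≤ η₁ → C * Λ.kap t ≤ η / 4 := fun t h0 h1 => by
    calc C * Λ.kap t ≤ C * (η / (4 * C)) := mul_le_mul_of_nonneg_left (hk1 t h0 h1) hC.le
      _ = η / 4 := by field_simp
  -- Four errors of size `η / 4` arise: two end increments of `D`, bounded above by the one-sided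
  -- modulus, and the masses of the two end pieces of `(a, b)`, bounded below by continuity of the
  -- premeasure on sets shrinking to the empty set. An upper bound on masses alone would not control
  -- the latter.
  obtain ⟨k, h1, h2, h3⟩ := ((hl.eventually (Ioi_mem_nhds (show -(η / 4) < 0 by linarith))).and
    ((hr.eventually (Ioi_mem_nhds (show -(η / 4) < 0 by linarith))).and
      (hdlim.eventually (Iio_mem_nhds (show 0 < η₁ / 2 by positivity))))).exists
  have h1' : -(η / 4) < μ (Arc.image (Ioo a (a + d k)) ordConnected_Ioo) := h1
  have h2' : -(η / 4) < μ (Arc.image (Ico (b - d k) b) ordConnected_Ico) := h2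
  have h3' : d k < η₁ / 2 := h3
  have hdk := hd0 k
  have hd3k := hd3 k
  refine ⟨d k, hdk, fun x y hx hxy hy hxa hyb => ?_⟩
  rw [abs_lt] at hxa hyb
  have h4 := h x (a + d k) hx (by linarith) (by linarith)
  have h5 := h (b - d k) y (by linarith) (by linarith) hy
  have h6 := hCk (a + d k - x) (by linarith) (by linarith)
  have h7 := hCk (y - (b - d k)) (by linarith) (by linarith)
  have h8 := μ.dist_sub (a := a + d k) (b := b - d k) (by linarith) (by linarith) (by linarith)
  have e1 : Ioo a (a + d k) ∪ Ico (a + d k) (b - d k) = Ioo a (b - d k) :=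
    Ioo_union_Ico_eq_Ioo (by linarith) (by linarith)
  have e2 : Ioo a (b - d k) ∪ Ico (b - d k) b = Ioo a b :=
    Ioo_union_Ico_eq_Ioo (by linarith) (by linarith)
  have h9 := μ.map_union_image (s := Ioo a (a + d k)) (t := Ico (a + d k) (b - d k))
    ordConnected_Ioo ordConnected_Ico (e1 ▸ ordConnected_Ioo)
    (Set.disjoint_left.2 fun t h1 h2 => by linarith [h1.2, h2.1])
    (by rw [e1]; exact Ioo_subset_period ha (by linarith))
  have h10 := μ.map_union_image (s := Ioo a (b - d k)) (t := Ico (b - d k) b)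
    ordConnected_Ioo ordConnected_Ico (e2 ▸ ordConnected_Ioo)
    (Set.disjoint_left.2 fun t h1 h2 => by linarith [h1.2, h2.1])
    (by rw [e2]; exact Ioo_subset_period ha hb)
  simp only [e1, e2] at h9 h10
  linarith

end Premeasure

/-! ### Complementary arcs of the image of a closed subset of the period -/

section complementary

variable {E : Set ℝ}

/-- The only collision on `[0, 2π]` is that of `0` and `2π`, and it is harmless because `0` belongs
to `E`. -/
lemma exp_mem_image_iff (hE : E ⊆ Icc 0 (2 * Real.pi)) (h0 : 0 ∈ E) {θ : ℝ}
    (hθ : θ ∈ Ico 0 (2 * Real.pi)) : Circle.exp θ ∈ Circle.exp '' E ↔ θ ∈ E := by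
  refine ⟨?_, fun h => mem_image_of_mem _ h⟩
  rintro ⟨t, ht, h⟩
  rcases (hE ht).2.eq_or_lt with h2 | h2
  · have : θ = 0 := injOn_exp hθ ⟨le_rfl, Real.two_pi_pos⟩ (by
      rw [← h, h2, Circle.exp_two_pi, Circle.exp_zero])
    rwa [this]
  · rwa [← injOn_exp ⟨(hE ht).1, h2⟩ hθ h]

/-- The image of the open gap is connected and open. The ends of the gap lie in `E`, so within the
complement the image of the open gap and the complement of the image of the closed gap form a
separation. -/
lemma connectedComponentIn_eq_of_gap (hE : E ⊆ Icc 0 (2 * Real.pi)) (h0 : 0 ∈ E)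
    {p : ℝ × ℝ} (hp : p ∈ gaps E) {θ : ℝ} (hθ : θ ∈ Ioo p.1 p.2) :
    connectedComponentIn (Circle.exp '' E)ᶜ (Circle.exp θ) = Circle.exp '' Ioo p.1 p.2 := by
  obtain ⟨hlt, h1, h2, hd⟩ := hp
  have hsub : Ioo p.1 p.2 ⊆ Ico 0 (2 * Real.pi) := Ioo_subset_period (hE h1).1 (hE h2).2
  have hcompl : Circle.exp '' Ioo p.1 p.2 ⊆ (Circle.exp '' E)ᶜ := by
    rintro _ ⟨t, ht, rfl⟩ h
    rw [exp_mem_image_iff hE h0 (hsub ht)] at h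
    exact (Set.disjoint_left.1 hd) ht h
  refine Subset.antisymm ?_ ?_
  · have hU : IsOpen (Circle.exp '' Ioo p.1 p.2) :=
      isLocalHomeomorph_circleExp.isOpenMap _ isOpen_Ioo
    have hV : IsOpen (Circle.exp '' Icc p.1 p.2)ᶜ :=
      (isCompact_Icc.image Circle.exp.continuous).isClosed.isOpen_compl
    refine (isPreconnected_connectedComponentIn).subset_left_of_subset_union hU hV ?_ ?_ ?_
    · exact disjoint_compl_right_iff_subset.2 (image_mono Ioo_subset_Icc_self)
    · intro x hx
      by_cases hxI : x ∈ Circle.exp '' Icc p.1 p.2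
      · left
        obtain ⟨t, ht, rfl⟩ := hxI
        have hxF := connectedComponentIn_subset _ _ hx
        refine ⟨t, ⟨lt_of_le_of_ne ht.1 fun h => hxF ⟨t, h ▸ h1, rfl⟩,
          lt_of_le_of_ne ht.2 fun h => hxF ⟨t, h ▸ h2, rfl⟩⟩, rfl⟩
      · right; exact hxI
    · exact ⟨_, mem_connectedComponentIn (hcompl (mem_image_of_mem _ hθ)), mem_image_of_mem _ hθ⟩
  · exact (isPreconnected_Ioo.image _ Circle.exp.continuous.continuousOn).subset_connectedComponentIn
      (mem_image_of_mem _ hθ) hcompl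

lemma exists_gap (hEc : IsClosed E) (hE : E ⊆ Icc 0 (2 * Real.pi)) (h0 : 0 ∈ E)
    (h1 : 2 * Real.pi ∈ E) {θ : ℝ} (hθ0 : 0 ≤ θ) (hθ1 : θ ≤ 2 * Real.pi) (hθ : θ ∉ E) :
    ∃ p ∈ gaps E, θ ∈ Ioo p.1 p.2 := by
  have hA : IsCompact (E ∩ Iic θ) := isCompact_Icc.of_isClosed_subset (hEc.inter isClosed_Iic)
    (inter_subset_left.trans hE)
  have hB : IsCompact (E ∩ Ici θ) := isCompact_Icc.of_isClosed_subset (hEc.inter isClosed_Ici)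
    (inter_subset_left.trans hE)
  have ha := hA.sSup_mem ⟨0, h0, hθ0⟩
  have hb := hB.sInf_mem ⟨_, h1, hθ1⟩
  have ha1 : sSup (E ∩ Iic θ) < θ := lt_of_le_of_ne ha.2 fun h => hθ (h ▸ ha.1)
  have hb1 : θ < sInf (E ∩ Ici θ) := lt_of_le_of_ne hb.2 fun h => hθ (h ▸ hb.1)
  refine ⟨(sSup (E ∩ Iic θ), sInf (E ∩ Ici θ)), ⟨ha1.trans hb1, ha.1, hb.1, ?_⟩, ha1, hb1⟩
  rw [Set.disjoint_left]
  intro x hx hxE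
  rcases le_total x θ with h | h
  · exact absurd (le_csSup hA.bddAbove ⟨hxE, h⟩) (not_le.2 hx.1)
  · exact absurd (csInf_le hB.bddBelow ⟨hxE, h⟩) (not_le.2 hx.2)

/-- The complementary arcs of the image of `E` correspond to the complementary intervals of `E`. -/
lemma exists_equiv_complementaryArcs (hEc : IsClosed E) (hE : E ⊆ Icc 0 (2 * Real.pi))
    (h0 : 0 ∈ E) (h1 : 2 * Real.pi ∈ E) :
    ∃ e : gaps E ≃ complementaryArcs (Circle.exp '' E),
      ∀ p, (e p : Arc) = Arc.image (Ioo p.1.1 p.1.2) ordConnected_Ioo := by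
  have hmid : ∀ p : gaps E, (p.1.1 + p.1.2) / 2 ∈ Ioo p.1.1 p.1.2 := fun p =>
    ⟨by linarith [p.2.1], by linarith [p.2.1]⟩
  have hsub : ∀ p : gaps E, Ioo p.1.1 p.1.2 ⊆ Ico 0 (2 * Real.pi) := fun p =>
    Ioo_subset_period (hE p.2.2.1).1 (hE p.2.2.2.1).2
  let φ : gaps E → complementaryArcs (Circle.exp '' E) := fun p =>
    ⟨Arc.image (Ioo p.1.1 p.1.2) ordConnected_Ioo, Circle.exp ((p.1.1 + p.1.2) / 2), by
      rw [mem_compl_iff, exp_mem_image_iff hE h0 (hsub p (hmid p))]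
      exact Set.disjoint_left.1 p.2.2.2.2 (hmid p),
      (connectedComponentIn_eq_of_gap hE h0 p.2 (hmid p)).symm⟩
  have hφ : Function.Bijective φ := by
    constructor
    · intro p q hpq
      have h2 : Circle.exp '' Ioo p.1.1 p.1.2 = Circle.exp '' Ioo q.1.1 q.1.2 :=
        congrArg (fun I : complementaryArcs (Circle.exp '' E) => ((I : Arc) : Set Circle)) hpq
      have h3 := (injOn_exp.image_eq_image_iff (hsub p) (hsub q)).1 h2
      by_contra hne
      have h4 := gaps_disjoint p.2 q.2 fun h => hne (Subtype.ext h)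
      exact Set.disjoint_left.1 h4 (hmid p) (h3 ▸ hmid p)
    · rintro ⟨I, x, hx, hI⟩
      obtain ⟨θ, hθ, rfl⟩ := exists_angle x
      rw [mem_compl_iff, exp_mem_image_iff hE h0 hθ] at hx
      obtain ⟨p, hp, hθp⟩ := exists_gap hEc hE h0 h1 hθ.1 hθ.2.le hx
      refine ⟨⟨p, hp⟩, Subtype.ext (Arc.ext ?_)⟩
      rw [hI, connectedComponentIn_eq_of_gap hE h0 hp hθp]
      rfl
  exact ⟨Equiv.ofBijective φ hφ, fun p => rfl⟩

lemma isCarlesonSet_image {Λ : Majorant} (hEc : IsClosed E) (hE : E ⊆ Icc 0 (2 * Real.pi))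
    (h0 : 0 ∈ E) (h1 : 2 * Real.pi ∈ E) (hv : volume E = 0)
    (hs : Summable fun p : gaps E => Λ.kap (p.1.2 - p.1.1)) :
    IsCarlesonSet Λ (Circle.exp '' E) where
  isClosed := ((isCompact_Icc.of_isClosed_subset hEc hE).image Circle.exp.continuous).isClosed
  nonempty := ⟨_, mem_image_of_mem _ h0⟩
  measure_zero := by
    unfold circleMeasure
    have : volume {θ : ℝ | θ ∈ Ico 0 (2 * Real.pi) ∧ Circle.exp θ ∈ Circle.exp '' E} = 0 :=
      measure_mono_null (fun θ hθ => (exp_mem_image_iff hE h0 hθ.1).1 hθ.2) hv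
    rw [Measure.real, this]; simp
  entropy_lt_top := by
    obtain ⟨e, he⟩ := exists_equiv_complementaryArcs hEc hE h0 h1
    unfold entropy
    rw [← e.tsum_eq]
    convert hs.tsum_ofReal_lt_top using 4 with p
    rw [he, Arc.coe_image, circleMeasure_Ioo (hE p.2.2.1).1 p.2.1.le (hE p.2.2.2.1).2]
    rfl

lemma singularPart_image (μ : Premeasure) (hEc : IsClosed E) (hE : E ⊆ Icc 0 (2 * Real.pi))
    (h0 : 0 ∈ E) (h1 : 2 * Real.pi ∈ E) :
    μ.singularPart (Circle.exp '' E) =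
      -∑' p : gaps E, μ (Arc.image (Ioo p.1.1 p.1.2) ordConnected_Ioo) := by
  obtain ⟨e, he⟩ := exists_equiv_complementaryArcs hEc hE h0 h1
  unfold Premeasure.singularPart
  rw [← e.tsum_eq]
  simp_rw [he]

end complementary

end KorenblumType

/-! ### Cyclicity from a vanishing singular part -/

namespace KorenblumType

variable {Λ : Majorant}

/-- If the singular part of `μ` vanishes, the distribution function of `μ` can be approximated by
uniformly small perturbations that keep a uniform one-sided modulus. -/
lemma Premeasure.exists_approximation {μ : Premeasure} {C : ℝ} (hC : 0 < C)
    (hD : UpperModOn Λ C μ.dist)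
    (hm : ∀ a b, 0 ≤ a → a < b → b ≤ 2 * Real.pi →
      μ (Arc.image (Ioo a b) ordConnected_Ioo) ≤ C * Λ.kap (b - a))
    (hs : ∀ F : Set Circle, IsCarlesonSet Λ F → μ.singularPart F = 0) {ε : ℝ} (hε : 0 < ε) :
    ∃ (N : ℝ) (F : ℝ → ℝ), 0 ≤ N ∧ F 0 = 0 ∧ F (2 * Real.pi) = 0 ∧
      (∀ θ, 0 ≤ θ → θ ≤ 2 * Real.pi → |F θ| ≤ ε) ∧ UpperModOn Λ (C + 1) F ∧
      UpperModOn Λ N fun θ => F θ - μ.dist θ := by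
  by_cases hbad : ∀ N : ℕ, ∃ P : Subdivision (2 * Real.pi), ∑ i ∈ Finset.range P.n,
      cost Λ μ.dist (C + 1) ε N (P.c i) (P.c (i + 1)) < 0
  -- If every `N` fails, the limit of the failures is a Carleson set whose complementary arcs have
  -- positive total mass, that is, negative singular part.
  · obtain ⟨E, hEc, hE, h0, h1, hv, hsum, hpos⟩ := exists_carleson_gaps hC.le hε hD μ.dist_zero
      μ.dist_two_pi hm
      (fun a b ha hab hb η hη => μ.dist_sub_le_of_near hC hD ha hab hb hη) hbad
    have h2 := hs _ (isCarlesonSet_image hEc hE h0 h1 hv hsum)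
    rw [singularPart_image μ hEc hE h0 h1] at h2
    linarith
  · push Not at hbad
    obtain ⟨N, hN⟩ := hbad
    obtain ⟨F, hF0, hF1, hF⟩ := exists_increments_le (b := cost Λ μ.dist (C + 1) ε N)
      Real.two_pi_pos (fun x => by simp [cost, hε.le]) (by
        rintro s ⟨n, c, hc, hc0, hcn, rfl⟩
        exact hN ⟨n, c, hc, hc0, hcn⟩)
    refine ⟨N, F, Nat.cast_nonneg N, hF0, hF1, fun θ h1 h2 => ?_, fun a b ha hab hb => ?_,
      fun a b ha hab hb => ?_⟩
    -- An increment bound `ε` from `0` and another one up to `2π`, where `F` vanishes, give `|F| ≤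
    -- ε`.
    · have h3 := (hF 0 θ le_rfl h1 h2).trans ((min_le_left _ _).trans (min_le_right _ _))
      have h4 := (hF θ _ h1 h2 le_rfl).trans ((min_le_left _ _).trans (min_le_right _ _))
      rw [abs_le]
      constructor <;> linarith
    · exact (hF a b ha hab hb).trans ((min_le_left _ _).trans (min_le_left _ _))
    · have := (hF a b ha hab hb).trans (min_le_right _ _)
      simp only
      linarith

lemma Premeasure.expHerglotz_eq (μ : Premeasure) (z : 𝔻) :
    μ.expHerglotz z = Complex.exp (herg μ.dist z) := by
  unfold expHerglotz integral herg
  congr 3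
  ext θ
  have := (hasDerivAt_ker z.norm_lt_one θ).deriv
  simp only [Circle.coe_exp]
  rw [this]

/-- The exponential of the Herglotz transform of a distribution function with a one-sided
modulus belongs to `A_Λ^{-∞}`. -/
def expHerg (F : ℝ → ℝ) {M : ℝ} (hM : 0 ≤ M) (h : UpperModOn Λ M F) (h0 : F 0 = 0)
    (h1 : F (2 * Real.pi) = 0) : KorenblumSpace Λ :=
  ⟨fun z => Complex.exp (herg F z), 6 * M + 1, by positivity,
    ⟨fun z => Complex.exp (herg F z),
      (herg_differentiableOn (h.intervalIntegrable hM h0 h1)).cexp, fun z => rfl⟩, 1, fun z => by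
    rw [Complex.norm_exp, one_mul, Real.exp_le_exp]
    have h2 := re_herg_le h hM h0 h1 z.norm_lt_one
    have h3 := Λ.one_sub_norm_pos z
    linarith⟩

@[simp] lemma expHerg_apply (F : ℝ → ℝ) {M : ℝ} (hM : 0 ≤ M) (h : UpperModOn Λ M F) (h0 : F 0 = 0)
    (h1 : F (2 * Real.pi) = 0) (z : 𝔻) : expHerg F hM h h0 h1 z = Complex.exp (herg F z) := rfl

/-- A function represented by a `Λ`-bounded premeasure with vanishing singular part is cyclic. -/
theorem isCyclicVector_of_singularPart_eq_zero {f : KorenblumSpace Λ} {μ : Premeasure}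
    (hμ : μ.IsBounded Λ) (hf : ∀ z, f z = μ.expHerglotz z)
    (hs : ∀ F : Set Circle, IsCarlesonSet Λ F → μ.singularPart F = 0) : f.IsCyclicVector := by
  obtain ⟨C, hC, hD, hm⟩ := μ.exists_upperModOn hμ
  have hex := fun n : ℕ => Premeasure.exists_approximation hC hD hm hs
    (ε := 1 / ((n : ℝ) + 1)) (by positivity)
  choose N F hN hF0 hF1 hFε hFC hFN using hex
  have hD' := hD.intervalIntegrable hC.le μ.dist_zero μ.dist_two_pi
  have hG0 : ∀ n, F n 0 - μ.dist 0 = 0 := fun n => by rw [hF0, μ.dist_zero, sub_zero]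
  have hG1 : ∀ n, F n (2 * Real.pi) - μ.dist (2 * Real.pi) = 0 := fun n => by
    rw [hF1, μ.dist_two_pi, sub_zero]
  have hprod : ∀ n (z : 𝔻), expHerg (fun θ => F n θ - μ.dist θ) (hN n) (hFN n) (hG0 n) (hG1 n) z *
      f z = Complex.exp (herg (F n) z) := fun n z => by
    rw [expHerg_apply, hf, μ.expHerglotz_eq, ← Complex.exp_add,
      herg_sub ((hFC n).intervalIntegrable (by positivity) (hF0 n) (hF1 n)) hD' z.norm_lt_one,
      sub_add_cancel]
  refine KorenblumSpace.isCyclicVector_of_tendsto_one (K := 1) (c := 6 * (C + 1))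
    (fun n => expHerg (fun θ => F n θ - μ.dist θ) (hN n) (hFN n) (hG0 n) (hG1 n)) (by positivity)
    (fun n z => ?_) fun ρ hρ ε hε => ?_
  · rw [hprod, Complex.norm_exp, one_mul, Real.exp_le_exp]
    exact re_herg_le (hFC n) (by positivity) (hF0 n) (hF1 n) z.norm_lt_one
  · have ht : Tendsto (fun n : ℕ => 2 / (1 - ρ) ^ 2 * (1 / ((n : ℝ) + 1)) * (2 * Real.pi)) atTop
        (𝓝 (2 / (1 - ρ) ^ 2 * 0 * (2 * Real.pi))) :=
      (tendsto_one_div_add_atTop_nhds_zero_nat.const_mul _).mul_const _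
    rw [mul_zero, zero_mul] at ht
    -- For `|w| ≤ 1` one has `|exp w - 1| ≤ 2 |w|`; hence the threshold `min 1 (ε / 2)`.
    filter_upwards [ht.eventually (Iio_mem_nhds (show 0 < min 1 (ε / 2) by positivity))] with n hn z hz
    rw [hprod]
    have h1 := (norm_herg_le (hFε n) hz hρ).trans (mem_Iio.1 hn).le
    have h2 := Complex.norm_exp_sub_one_le (h1.trans (min_le_left _ _))
    linarith [h1.trans (min_le_right _ _)]

end KorenblumType

/-! ### One-sided modulus of primitives from growth of Poisson means -/

namespace KorenblumType

variable {Λ : Majorant}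

/-- For `t ≤ 1` the cube is at least `(t ^ 2) ^ 2`, so two applications of the square estimate
suffice. The cube is the scale at which an interval of length `t` is smoothed below. -/
lemma Majorant.exists_le_of_mul_cube (Λ : Majorant) {q : ℝ} (h0 : 0 < q) (h1 : q ≤ 1) :
    ∃ C : ℝ, 0 < C ∧ ∀ t, 0 < t → t ≤ 1 → Λ (q * t ^ 3) ≤ C * Λ t := by
  obtain ⟨C₁, hC₁, h2⟩ := Λ.exists_le_of_mul_sq h0 h1
  obtain ⟨C₂, hC₂, h3⟩ := Λ.exists_le_of_mul_sq one_pos le_rfl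
  refine ⟨C₁ * C₂, by positivity, fun t ht ht1 => ?_⟩
  have hsq : t ^ 2 ≤ 1 := pow_le_one₀ ht.le ht1
  have h4 : Λ (q * t ^ 3) ≤ Λ (q * (t ^ 2) ^ 2) := by
    refine Λ.antitoneOn ⟨by positivity, ?_⟩ ⟨by positivity, ?_⟩ ?_
    · exact mul_le_one₀ h1 (by positivity) (pow_le_one₀ (by positivity) hsq)
    · exact mul_le_one₀ h1 (by positivity) (pow_le_one₀ ht.le ht1)
    · rw [← pow_mul]
      exact mul_le_mul_of_nonneg_left (pow_le_pow_of_le_one ht.le ht1 (by norm_num)) h0.le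
  calc Λ (q * t ^ 3) ≤ C₁ * Λ (t ^ 2) := h4.trans (h2 _ (by positivity) hsq)
    _ ≤ C₁ * (C₂ * Λ t) := by
      have := h3 t ht ht1
      rw [one_mul] at this
      exact mul_le_mul_of_nonneg_left this hC₁.le
    _ = _ := by ring

/-- The denominator of the kernel is at least `2r(1 - cos s)`, and `1 - cos s ≥ 2 s² / π²` on `[-π,
π]`. This is a Chebyshev type control of the kernel away from `0`. -/
lemma pk_mul_sq_le {r s : ℝ} (h0 : 1 / 2 ≤ r) (h1 : r < 1) (hs : |s| ≤ Real.pi) :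
    pk r s * s ^ 2 ≤ Real.pi ^ 2 * (1 - r) := by
  have hπ := Real.pi_pos
  have hd := pk_denom_pos (by linarith : 0 ≤ r) h1 s
  have hc := Real.cos_le_one_sub_mul_cos_sq hs
  unfold pk
  rw [div_mul_eq_mul_div, div_le_iff₀ hd]
  have h2 : 2 * s ^ 2 ≤ Real.pi ^ 2 * (1 - Real.cos s) := by
    have : Real.pi ^ 2 * (2 / Real.pi ^ 2 * s ^ 2) = 2 * s ^ 2 := by field_simp
    nlinarith [sq_nonneg Real.pi]
  have h3 : 0 ≤ Real.pi ^ 2 * (1 - Real.cos s) :=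
    mul_nonneg (by positivity) (by linarith [Real.cos_le_one s])
  have h4 : 2 * s ^ 2 ≤ Real.pi ^ 2 * (1 - 2 * r * Real.cos s + r ^ 2) := by
    have : Real.pi ^ 2 * (1 - 2 * r * Real.cos s + r ^ 2) =
      Real.pi ^ 2 * (1 - r) ^ 2 + 2 * r * (Real.pi ^ 2 * (1 - Real.cos s)) := by ring
    rw [this]
    have : 0 ≤ Real.pi ^ 2 * (1 - r) ^ 2 := by positivity
    nlinarith
  have h5 : 0 ≤ (1 - r) := by linarith
  calc (1 - r ^ 2) * s ^ 2 = (1 - r) * ((1 + r) * s ^ 2) := by ring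
    _ ≤ (1 - r) * (Real.pi ^ 2 * (1 - 2 * r * Real.cos s + r ^ 2)) := by
      refine mul_le_mul_of_nonneg_left (le_trans ?_ h4) h5
      nlinarith [sq_nonneg s]
    _ = _ := by ring

lemma scale_identity {η t : ℝ} (hη : η ≠ 0) (ht : t ≠ 0) :
    Real.pi ^ 2 * (η ^ 2 / 2 * t ^ 3) / (η * (2 * Real.pi * t)) ^ 2 = t / 8 := by
  field_simp
  norm_num

section primitive

variable {v : ℝ → ℝ}

lemma primitive_periodic (hv : Continuous v) (hper : Function.Periodic v (2 * Real.pi))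
    (h0 : ∫ t in (0 : ℝ)..(2 * Real.pi), v t = 0) :
    Function.Periodic (fun x => ∫ t in (0 : ℝ)..x, v t) (2 * Real.pi) := fun x => by
  simp only
  rw [← intervalIntegral.integral_add_adjacent_intervals (hv.intervalIntegrable 0 x)
    (hv.intervalIntegrable x _)]
  have := hper.intervalIntegral_add_eq x 0
  rw [zero_add] at this
  rw [this, h0, add_zero]

lemma primitive_sub (hv : Continuous v) (a b : ℝ) :
    (∫ t in (0 : ℝ)..b, v t) - ∫ t in (0 : ℝ)..a, v t = ∫ t in a..b, v t :=
  intervalIntegral.integral_interval_sub_left (hv.intervalIntegrable _ _)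
    (hv.intervalIntegrable _ _)

/-- Fubini: integrating the Poisson means of `v` is the same as averaging the translated increments
of its primitive. -/
lemma average_primitive (hv : Continuous v) {ρ : ℝ} (h0 : 0 ≤ ρ) (h1 : ρ < 1) (a b : ℝ) :
    ∫ t in a..b, (∫ s in (-Real.pi)..Real.pi, pk ρ s * v (s + t)) =
      ∫ s in (-Real.pi)..Real.pi, pk ρ s *
        ((∫ t in (0 : ℝ)..(b + s), v t) - ∫ t in (0 : ℝ)..(a + s), v t) := by
  have hc := continuous_pk h0 h1
  rw [intervalIntegral_intervalIntegral_swap]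
  · congr 1; ext s
    rw [intervalIntegral.integral_const_mul, primitive_sub hv]
    congr 1
    have := intervalIntegral.integral_comp_add_left (a := a) (b := b) v s
    rw [this, add_comm s a, add_comm s b]
  · have : Continuous (fun p : ℝ × ℝ => pk ρ p.2 * v (p.2 + p.1)) := by fun_prop
    refine (this.continuousOn.integrableOn_compact
      (isCompact_uIcc.prod isCompact_uIcc)).mono_set (prod_mono uIoc_subset_uIcc uIoc_subset_uIcc)

set_option maxHeartbeats 1000000 in
/-- Uniform one-sided modulus for the primitives of continuous functions whose Poisson means grow
at most like `Λ`. -/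
lemma exists_upperMod_primitive (Λ : Majorant) : ∃ C : ℝ, 0 < C ∧ ∀ (v : ℝ → ℝ) (M : ℝ), 0 ≤ M →
    Continuous v → Function.Periodic v (2 * Real.pi) →
    ∫ t in (0 : ℝ)..(2 * Real.pi), v t = 0 →
    (∀ ρ t, 0 ≤ ρ → ρ < 1 →
      ∫ s in (-Real.pi)..Real.pi, pk ρ s * v (s + t) ≤ M * Λ (1 - ρ)) →
    UpperMod Λ (C * M) fun x => ∫ t in (0 : ℝ)..x, v t := by
  have hπ := Real.pi_pos
  obtain ⟨β, hβ, hscale⟩ := Λ.exists_kap_mul_le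
  -- `η` is the fraction by which both ends of an interval are moved inwards. It is small enough
  -- that an increment over `2η` times the length costs at most an eighth of the original `kap`, and
  -- it depends only on `Λ`.
  obtain ⟨η, hη, hη4, hηβ⟩ : ∃ η : ℝ, 0 < η ∧ η ≤ 1 / 4 ∧ (2 * η) ^ β ≤ 1 / 8 := by
    have h1 : Tendsto (fun η : ℝ => (2 * η) ^ β) (𝓝 0) (𝓝 ((2 * 0) ^ β)) :=
      ((continuous_const.mul continuous_id).tendsto (0 : ℝ)).rpow_const (Or.inr hβ.le)
    rw [mul_zero, Real.zero_rpow hβ.ne'] at h1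
    have h2 := (h1.mono_left (nhdsWithin_le_nhds (s := Ioi 0))).eventually
      (Iic_mem_nhds (show (0 : ℝ) < 1 / 8 by norm_num))
    obtain ⟨η, h3, h4⟩ := (h2.and (Ioc_mem_nhdsGT (show (0 : ℝ) < 1 / 4 by norm_num))).exists
    exact ⟨η, h4.1, h4.2, h3⟩
  obtain ⟨C, hC, hcube⟩ := Λ.exists_le_of_mul_cube (q := η ^ 2 / 2) (by positivity) (by nlinarith)
  refine ⟨4 * C, by positivity, fun v M hM hv hper h0 hP => ?_⟩
  set F : ℝ → ℝ := fun x => ∫ t in (0 : ℝ)..x, v t with hF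
  have hFper : Function.Periodic F (2 * Real.pi) := primitive_periodic hv hper h0
  have hFc : Continuous F := intervalIntegral.continuous_primitive
    (fun a b => hv.intervalIntegrable a b) 0
  set K := Λ.kap (2 * Real.pi) with hK
  have hKpos : 0 < K := Λ.kap_pos Real.two_pi_pos le_rfl
  obtain ⟨B, hB⟩ : ∃ B, ∀ t, |v t| ≤ B := by
    obtain ⟨B, hB⟩ := isCompact_Icc.exists_bound_of_continuousOn
      (s := Icc 0 (2 * Real.pi)) hv.continuousOn
    refine ⟨B, fun t => ?_⟩
    obtain ⟨y, hy, hyt⟩ := hper.exists_mem_Ico₀ Real.two_pi_pos t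
    rw [hyt]
    exact hB y ⟨hy.1, hy.2.le⟩
  have hB0 : 0 ≤ B := (abs_nonneg _).trans (hB 0)
  -- The best modulus constant `m` of `F` is the supremum of `R`. It is finite because `v` is
  -- bounded; the bound `m ≤ 4 C M`, independent of `B`, comes from averaging an almost extremal
  -- increment.
  let R : Set ℝ := {x | ∃ a b, a < b ∧ b ≤ a + 2 * Real.pi ∧ x = (F b - F a) / Λ.kap (b - a)}
  have hRb : BddAbove R := by
    refine ⟨B * (2 * Real.pi) / K, ?_⟩
    rintro _ ⟨a, b, hab, hb, rfl⟩
    have hk : 0 < Λ.kap (b - a) := Λ.kap_pos (by linarith) (by linarith)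
    rw [div_le_div_iff₀ hk hKpos]
    have h2 : F b - F a ≤ B * (b - a) := by
      rw [hF, primitive_sub hv]
      have := intervalIntegral.norm_integral_le_of_norm_le_const (a := a) (b := b) (C := B)
        (f := v) fun t _ => hB t
      rw [abs_of_pos (by linarith : 0 < b - a)] at this
      exact (le_abs_self _).trans this
    have h3 := Λ.mul_kap_le (s := b - a) (t := 2 * Real.pi) (by linarith) (by linarith) le_rfl
    calc (F b - F a) * K ≤ B * (b - a) * K := mul_le_mul_of_nonneg_right h2 hKpos.le
      _ = B * ((b - a) * K) := by ring
      _ ≤ B * (2 * Real.pi * Λ.kap (b - a)) := mul_le_mul_of_nonneg_left h3 hB0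
      _ = _ := by ring
  have hRne : R.Nonempty := ⟨_, 0, 2 * Real.pi, Real.two_pi_pos, by linarith, rfl⟩
  set m := sSup R with hm
  have hmF : UpperMod Λ m F := by
    intro a b hab hb
    rcases hab.eq_or_lt with rfl | hab
    · simp
    · have hk : 0 < Λ.kap (b - a) := Λ.kap_pos (by linarith) (by linarith)
      rw [← div_le_iff₀ hk]
      exact le_csSup hRb ⟨a, b, hab, hb, rfl⟩
  suffices hmle : m ≤ 4 * C * M by
    intro a b hab hb
    exact (hmF a b hab hb).trans
      (mul_le_mul_of_nonneg_right hmle (Λ.kap_nonneg (by linarith) (by linarith)))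
  rcases le_or_gt m 0 with hm0 | hm0
  · exact hm0.trans (by positivity)
  obtain ⟨_, ⟨a, b, hab, hb, rfl⟩, hratio⟩ := exists_lt_of_lt_csSup hRne
    (show 3 / 4 * m < sSup R by rw [← hm]; linarith)
  set δ := b - a with hδ
  have hδ0 : 0 < δ := by linarith
  have hδ2 : δ ≤ 2 * Real.pi := by linarith
  have hk : 0 < Λ.kap δ := Λ.kap_pos hδ0 hδ2
  rw [lt_div_iff₀ hk] at hratio
  set w := η * δ with hw
  have hw0 : 0 < w := by positivity
  have hwδ : w ≤ δ / 4 := by rw [hw]; nlinarith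
  have hkw : ∀ t, 0 ≤ t → t ≤ 2 * w → m * Λ.kap t ≤ m * Λ.kap δ / 8 := by
    intro t ht ht2
    have h1 := Λ.kap_mono ht ht2 (by linarith)
    have h2 := hscale (2 * η) δ (by positivity) (by linarith) hδ0.le hδ2
    rw [show 2 * w = 2 * η * δ by rw [hw]; ring] at h1
    have h3 : Λ.kap t ≤ 1 / 8 * Λ.kap δ :=
      h1.trans (h2.trans (mul_le_mul_of_nonneg_right hηβ hk.le))
    calc m * Λ.kap t ≤ m * (1 / 8 * Λ.kap δ) := mul_le_mul_of_nonneg_left h3 hm0.le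
      _ = _ := by ring
  set t₀ := δ / (2 * Real.pi) with ht₀
  have ht₀0 : 0 < t₀ := by positivity
  have ht₀1 : t₀ ≤ 1 := (div_le_one Real.two_pi_pos).2 hδ2
  -- The smoothing scale is cubic in the length: small enough that the tail `h / w ^ 2` of the
  -- kernel is of the order of `t₀`, which `t₀ * K ≤ kap δ` absorbs, yet such that `Λ h` is still
  -- comparable with `Λ t₀`.
  set h := η ^ 2 / 2 * t₀ ^ 3 with hh
  have hh0 : 0 < h := by positivity
  have hh1 : h ≤ 1 / 2 := by
    have h1 : t₀ ^ 3 ≤ 1 := pow_le_one₀ ht₀0.le ht₀1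
    have h2 : η ^ 2 / 2 ≤ 1 / 2 := by nlinarith
    calc h ≤ 1 / 2 * 1 := by rw [hh]; gcongr
      _ = 1 / 2 := by ring
  -- For `|s| ≤ w` the shifted ends stay inside `[a, b]`, and the two lost pieces cost at most `m
  -- kap δ / 8` each, out of more than `3/4 m kap δ`. For larger `s` periodicity bounds the
  -- complementary increment and gives the lower bound `-m K`, which is absorbed by the quadratic
  -- term.
  have hD : ∀ s, |s| ≤ Real.pi → m * Λ.kap δ / 2 - s ^ 2 / w ^ 2 * (2 * m * K) ≤
      F (b - w + s) - F (a + w + s) := by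
    intro s hs
    have hkK : Λ.kap δ ≤ K := Λ.kap_mono hδ0.le hδ2 le_rfl
    have hmk : m * Λ.kap δ ≤ m * K := mul_le_mul_of_nonneg_left hkK hm0.le
    have hmk0 : 0 < m * Λ.kap δ := by positivity
    rcases le_or_gt |s| w with hsw | hsw
    · rw [abs_le] at hsw
      have h1 := hmF (b - w + s) b (by linarith) (by linarith)
      have h2 := hmF a (a + w + s) (by linarith) (by linarith)
      have h3 := hkw (b - (b - w + s)) (by linarith) (by linarith)
      have h4 := hkw (a + w + s - a) (by linarith) (by linarith)
      have h5 : 0 ≤ s ^ 2 / w ^ 2 * (2 * m * K) := by positivity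
      linarith
    · have h1 : 1 ≤ s ^ 2 / w ^ 2 := by
        rw [one_le_div (by positivity), ← sq_abs s]
        exact pow_le_pow_left₀ hw0.le hsw.le 2
      have h2 : 2 * m * K ≤ s ^ 2 / w ^ 2 * (2 * m * K) :=
        le_mul_of_one_le_left (by positivity) h1
      have h3 := hmF (b - w + s) (a + w + s + 2 * Real.pi) (by linarith) (by linarith)
      rw [hFper] at h3
      have h4 : m * Λ.kap (a + w + s + 2 * Real.pi - (b - w + s)) ≤ m * K :=
        mul_le_mul_of_nonneg_left (Λ.kap_mono (by linarith) (by linarith) le_rfl) hm0.le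
      nlinarith
  have hρ0 : (1 : ℝ) / 2 ≤ 1 - h := by linarith
  have hρ1 : 1 - h < 1 := by linarith
  have hpc := continuous_pk (by linarith : (0 : ℝ) ≤ 1 - h) hρ1
  have hlow : 2 * Real.pi * (m * Λ.kap δ / 2) -
      2 * Real.pi * (Real.pi ^ 2 * h / w ^ 2 * (2 * m * K)) ≤
      ∫ s in (-Real.pi)..Real.pi, pk (1 - h) s * (F (b - w + s) - F (a + w + s)) := by
    have h1 : ∫ s in (-Real.pi)..Real.pi, (pk (1 - h) s * (m * Λ.kap δ / 2) -
        Real.pi ^ 2 * h / w ^ 2 * (2 * m * K)) ≤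
        ∫ s in (-Real.pi)..Real.pi, pk (1 - h) s * (F (b - w + s) - F (a + w + s)) := by
      refine intervalIntegral.integral_mono_on (by linarith)
        (Continuous.intervalIntegrable (by fun_prop) _ _)
        (Continuous.intervalIntegrable (by fun_prop) _ _) fun s hs => ?_
      have hs' : |s| ≤ Real.pi := abs_le.2 hs
      have h2 := mul_le_mul_of_nonneg_left (hD s hs') (pk_nonneg (by linarith) hρ1 s)
      refine le_trans ?_ h2
      rw [mul_sub]
      refine sub_le_sub_left ?_ _
      have h3 := pk_mul_sq_le hρ0 hρ1 hs'
      rw [sub_sub_cancel] at h3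
      calc pk (1 - h) s * (s ^ 2 / w ^ 2 * (2 * m * K)) =
          pk (1 - h) s * s ^ 2 / w ^ 2 * (2 * m * K) := by ring
        _ ≤ Real.pi ^ 2 * h / w ^ 2 * (2 * m * K) := by gcongr
    refine le_trans (le_of_eq ?_) h1
    rw [intervalIntegral.integral_sub (Continuous.intervalIntegrable (by fun_prop) _ _)
      (Continuous.intervalIntegrable (by fun_prop) _ _), intervalIntegral.integral_mul_const,
      intervalIntegral.integral_const, smul_eq_mul]
    have h7 := integral_pk (by linarith : (0 : ℝ) ≤ 1 - h) hρ1 (-Real.pi)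
    rw [show -Real.pi + 2 * Real.pi = Real.pi by ring] at h7
    rw [h7]
    ring
  -- By Fubini the average is the integral of the Poisson means of `v` at radius `1 - h`, to which
  -- the growth hypothesis applies; then `Λ h ≤ C Λ t₀`.
  have hup : ∫ s in (-Real.pi)..Real.pi, pk (1 - h) s * (F (b - w + s) - F (a + w + s)) ≤
      2 * Real.pi * (C * M * Λ.kap δ) := by
    rw [← average_primitive hv (by linarith) hρ1 (a + w) (b - w)]
    have hΛh : Λ h ≤ C * Λ t₀ := hcube t₀ ht₀0 ht₀1
    have hΛ0 : 0 ≤ C * Λ t₀ := mul_nonneg hC.le (Λ.pos t₀ ⟨ht₀0, ht₀1⟩).le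
    have h1 : ∫ t in (a + w)..(b - w), (∫ s in (-Real.pi)..Real.pi, pk (1 - h) s * v (s + t)) ≤
        ∫ t in (a + w)..(b - w), M * (C * Λ t₀) := by
      refine intervalIntegral.integral_mono_on (by linarith)
        (Continuous.intervalIntegrable ?_ _ _) (Continuous.intervalIntegrable (by fun_prop) _ _)
        fun t _ => ?_
      · exact intervalIntegral.continuous_parametric_intervalIntegral_of_continuous'
          (by fun_prop) _ _
      · refine (hP (1 - h) t (by linarith) hρ1).trans ?_
        rw [sub_sub_cancel]
        exact mul_le_mul_of_nonneg_left hΛh hM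
    refine h1.trans ?_
    rw [intervalIntegral.integral_const, smul_eq_mul]
    have h2 : Λ.kap δ = t₀ * Λ t₀ := rfl
    have h3 : δ = 2 * Real.pi * t₀ := by rw [ht₀]; field_simp
    calc (b - w - (a + w)) * (M * (C * Λ t₀)) ≤ δ * (M * (C * Λ t₀)) :=
          mul_le_mul_of_nonneg_right (by linarith) (mul_nonneg hM hΛ0)
      _ = _ := by rw [h2]; nth_rewrite 1 [h3]; ring
  -- The tail removes at most half of the main term `m kap δ / 2`, leaving `m kap δ / 4 ≤ C M kap
  -- δ`; this is the source of the factor `4`.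
  have herr : Real.pi ^ 2 * h / w ^ 2 * (2 * m * K) ≤ m * Λ.kap δ / 4 := by
    have h1 := Λ.mul_kap_le hδ0.le hδ2 le_rfl
    have h2 : Real.pi ^ 2 * h / w ^ 2 = t₀ / 8 := by
      have h3 : δ = 2 * Real.pi * t₀ := by rw [ht₀]; field_simp
      rw [hh, hw, h3, scale_identity hη.ne' ht₀0.ne']
    rw [h2]
    have h4 : t₀ * K ≤ Λ.kap δ := by
      rw [ht₀, div_mul_eq_mul_div, div_le_iff₀ Real.two_pi_pos]; linarith
    calc t₀ / 8 * (2 * m * K) = m * (t₀ * K) / 4 := by ring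
      _ ≤ m * Λ.kap δ / 4 := by gcongr
  have hfin : m * Λ.kap δ / 4 ≤ C * M * Λ.kap δ := by
    have := hlow.trans hup
    have h6 := mul_le_mul_of_nonneg_left herr Real.two_pi_pos.le
    have h5 : 2 * Real.pi * (m * Λ.kap δ / 4) ≤ 2 * Real.pi * (C * M * Λ.kap δ) := by
      linarith
    exact le_of_mul_le_mul_left h5 Real.two_pi_pos
  have : m / 4 ≤ C * M := by
    refine le_of_mul_le_mul_right ?_ hk
    linarith
  linarith

end primitive

end KorenblumType

/-! ### The logarithm and its dilations -/

namespace KorenblumType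

variable {Λ : Majorant} {G : ℂ → ℂ}

/-- Take a primitive `G` of `F' / F` with `G 0 = 0`; the derivative of `F * exp (-G)` vanishes. -/
lemma exists_log {F : ℂ → ℂ} (hF : DifferentiableOn ℂ F (Metric.ball 0 1))
    (hne : ∀ z ∈ Metric.ball (0 : ℂ) 1, F z ≠ 0) (h0 : F 0 = 1) :
    ∃ G : ℂ → ℂ, DifferentiableOn ℂ G (Metric.ball 0 1) ∧ G 0 = 0 ∧
      ∀ z ∈ Metric.ball (0 : ℂ) 1, Complex.exp (G z) = F z := by
  have hd : DifferentiableOn ℂ (fun z => deriv F z / F z) (Metric.ball 0 1) :=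
    (hF.deriv Metric.isOpen_ball).div hF hne
  obtain ⟨G, hG0, hG⟩ := (hd.isExactOn_ball).with_val_at 0 0
  refine ⟨G, fun z hz => (hG z hz).differentiableAt.differentiableWithinAt, hG0, ?_⟩
  have hq : ∀ z ∈ Metric.ball (0 : ℂ) 1, HasDerivAt (fun z => F z * Complex.exp (-G z)) 0 z := by
    intro z hz
    have h1 := (hF.differentiableAt (Metric.isOpen_ball.mem_nhds hz)).hasDerivAt
    refine (h1.mul (hG z hz).neg.cexp).congr_deriv ?_
    have := hne z hz
    simp only [Pi.neg_apply]
    field_simp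
    ring
  have hconst : ∀ z ∈ Metric.ball (0 : ℂ) 1, F z * Complex.exp (-G z) = 1 := by
    intro z hz
    have := (convex_ball (0 : ℂ) 1).is_const_of_fderivWithin_eq_zero (𝕜 := ℂ)
      (f := fun z => F z * Complex.exp (-G z))
      (fun w hw => (hq w hw).differentiableAt.differentiableWithinAt)
      (fun w hw => by
        rw [fderivWithin_of_isOpen Metric.isOpen_ball hw, (hq w hw).hasFDerivAt.fderiv]
        ext; simp) hz (Metric.mem_ball_self one_pos)
    simpa [h0, hG0] using this
  intro z hz
  have h1 := hconst z hz
  rw [Complex.exp_neg] at h1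
  field_simp at h1
  exact h1.symm

/-- The density `Re G(r e^{iθ}) / 2π`. -/
def density (G : ℂ → ℂ) (r θ : ℝ) : ℝ :=
  (G (r * Complex.exp (θ * Complex.I))).re / (2 * Real.pi)

lemma mul_exp_mem_ball {r : ℝ} (hr0 : 0 ≤ r) (hr1 : r < 1) (θ : ℝ) :
    (r : ℂ) * Complex.exp (θ * Complex.I) ∈ Metric.ball (0 : ℂ) 1 := by
  rwa [mem_ball_zero_iff, norm_mul, Complex.norm_exp_ofReal_mul_I, mul_one, Complex.norm_real,
    Real.norm_of_nonneg hr0]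

lemma continuous_density (hG : DifferentiableOn ℂ G (Metric.ball 0 1)) {r : ℝ} (hr0 : 0 ≤ r)
    (hr1 : r < 1) : Continuous (density G r) := by
  have : Continuous fun θ : ℝ => G (r * Complex.exp (θ * Complex.I)) :=
    hG.continuousOn.comp_continuous (by fun_prop) (mul_exp_mem_ball hr0 hr1)
  exact (Complex.continuous_re.comp this).div_const _

lemma density_periodic (G : ℂ → ℂ) (r : ℝ) : Function.Periodic (density G r) (2 * Real.pi) :=
  fun θ => by
    unfold density
    push_cast
    rw [add_mul, Complex.exp_periodic]

/-- The Poisson formula. -/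
lemma integral_pk_mul_density (hG : DifferentiableOn ℂ G (Metric.ball 0 1)) {r : ℝ} (hr0 : 0 ≤ r)
    (hr1 : r < 1) {ρ : ℝ} (h0 : 0 ≤ ρ) (h1 : ρ < 1) (t : ℝ) :
    ∫ s in (-Real.pi)..Real.pi, pk ρ s * density G r (s + t) =
      (G (r * (ρ * Complex.exp (t * Complex.I)))).re := by
  have hw : ‖(ρ : ℂ)‖ < 1 := by rwa [Complex.norm_real, Real.norm_of_nonneg h0]
  have hmaps : ∀ z ∈ Metric.closedBall (0 : ℂ) 1,
      (r : ℂ) * (z * Complex.exp (t * Complex.I)) ∈ Metric.ball (0 : ℂ) 1 := fun z hz => by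
    rw [mem_ball_zero_iff, norm_mul, norm_mul, Complex.norm_exp_ofReal_mul_I, mul_one,
      Complex.norm_real, Real.norm_of_nonneg hr0]
    rw [mem_closedBall_zero_iff] at hz
    nlinarith [norm_nonneg z]
  have hd : DifferentiableOn ℂ (fun z => G (r * (z * Complex.exp (t * Complex.I))))
      (Metric.closedBall 0 1) :=
    hG.comp (f := fun z => (r : ℂ) * (z * Complex.exp (t * Complex.I))) (by fun_prop) hmaps
  have h := DiffContOnCl.circleAverage_re_herglotzRieszKernel_smul (R := 1) (c := 0) (w := (ρ : ℂ))
    (hd.mono Metric.closure_ball_subset_closedBall).diffContOnCl (by rwa [mem_ball_zero_iff])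
  have e : ∀ θ : ℝ, (((Complex.re ∘ herglotzRieszKernel 0 (ρ : ℂ)) •
      fun z => G (r * (z * Complex.exp (t * Complex.I)))) (circleMap 0 1 θ)) =
      (pk ρ θ : ℂ) * G (r * Complex.exp ((θ + t : ℝ) * Complex.I)) := fun θ => by
    have := re_ker hw θ
    rw [Complex.norm_real, Real.norm_of_nonneg h0, Complex.arg_ofReal_of_nonneg h0, sub_zero] at this
    rw [← this]
    simp [herglotzRieszKernel_def, circleMap, Complex.exp_add, add_mul]
  rw [Real.circleAverage_def] at h
  simp_rw [e] at h
  have hc : Continuous fun θ : ℝ =>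
      (pk ρ θ : ℂ) * G (r * Complex.exp ((θ + t : ℝ) * Complex.I)) :=
    (Complex.continuous_ofReal.comp (continuous_pk h0 h1)).mul
      (hG.continuousOn.comp_continuous (by fun_prop) fun θ => mul_exp_mem_ball hr0 hr1 _)
  have hre := Complex.reCLM.intervalIntegral_comp_comm
    (hc.intervalIntegrable (μ := volume) 0 (2 * Real.pi))
  simp only [Complex.reCLM_apply] at hre
  have h2 := congrArg Complex.re h
  rw [Complex.smul_re, ← hre] at h2
  rw [← h2]
  have hper : Function.Periodic (fun s => pk ρ s * density G r (s + t)) (2 * Real.pi) := fun s => by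
    simp only
    rw [pk_periodic ρ s, add_right_comm, density_periodic G r]
  have h3 := hper.intervalIntegral_add_eq (-Real.pi) 0
  rw [show -Real.pi + 2 * Real.pi = Real.pi by ring, zero_add] at h3
  rw [h3, smul_eq_mul, ← intervalIntegral.integral_const_mul]
  congr 1; ext s
  rw [Complex.re_ofReal_mul]
  unfold density
  field_simp

/-- Integration by parts returns the Poisson integral of the density; the boundary terms vanish
because `v` has mean zero. -/
lemma re_herg_primitive {v : ℝ → ℝ} (hv : Continuous v) (hper : Function.Periodic v (2 * Real.pi))
    (h0 : ∫ t in (0 : ℝ)..(2 * Real.pi), v t = 0) {z : ℂ} (hz : ‖z‖ < 1) :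
    (herg (fun x => ∫ t in (0 : ℝ)..x, v t) z).re =
      ∫ s in (-Real.pi)..Real.pi, pk ‖z‖ s * v (s + z.arg) := by
  have hFc : Continuous fun x => ∫ t in (0 : ℝ)..x, v t :=
    intervalIntegral.continuous_primitive (fun a b => hv.intervalIntegrable a b) 0
  rw [re_herg_eq hz (hFc.intervalIntegrable _ _)]
  have hp := intervalIntegral.integral_mul_deriv_eq_deriv_mul (a := 0) (b := 2 * Real.pi)
    (u := fun θ => pk ‖z‖ (θ - z.arg)) (v := fun x => ∫ t in (0 : ℝ)..x, v t)
    (fun t _ => (hasDerivAt_pk (norm_nonneg z) hz (t - z.arg)).comp_sub_const t z.arg)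
    (fun t _ => intervalIntegral.integral_hasDerivAt_right (hv.intervalIntegrable 0 t)
      (hv.stronglyMeasurableAtFilter _ _) hv.continuousAt)
    (((continuous_dpk (norm_nonneg z) hz).comp (by fun_prop)).intervalIntegrable _ _)
    (hv.intervalIntegrable _ _)
  simp only [h0, intervalIntegral.integral_same, mul_zero, sub_zero, zero_sub] at hp
  rw [← hp]
  have hp : Function.Periodic (fun t => pk ‖z‖ t * v (t + z.arg)) (2 * Real.pi) := fun t => by
    simp only
    rw [pk_periodic ‖z‖ t, add_right_comm, hper]
  have := intervalIntegral.integral_comp_sub_right (a := 0) (b := 2 * Real.pi)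
    (fun t => pk ‖z‖ t * v (t + z.arg)) z.arg
  simp only [sub_add_cancel] at this
  rw [this]
  have h2 := hp.intervalIntegral_add_eq (0 - z.arg) (-Real.pi)
  rwa [show 0 - z.arg + 2 * Real.pi = 2 * Real.pi - z.arg by ring,
    show -Real.pi + 2 * Real.pi = Real.pi by ring] at h2

/-- The point is that `C` does not depend on `r`: the Poisson means of the density are values of `Re
G` at radius `r ρ ≤ ρ`, so they obey the same growth bound for all `r`. The mean of the density
vanishes because `G 0 = 0`. -/
lemma exists_dist_dilation (hG : DifferentiableOn ℂ G (Metric.ball 0 1)) (hG0 : G 0 = 0) {M : ℝ}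
    (hM : 0 ≤ M) (hb : ∀ z ∈ Metric.ball (0 : ℂ) 1, (G z).re ≤ M * Λ (1 - ‖z‖)) :
    ∃ C : ℝ, 0 < C ∧ ∀ r : ℝ, 0 ≤ r → r < 1 → ∃ F : ℝ → ℝ, UpperMod Λ (C * M) F ∧
      Function.Periodic F (2 * Real.pi) ∧ F 0 = 0 ∧ Continuous F ∧
      ∀ z ∈ Metric.ball (0 : ℂ) 1, (herg F z).re = (G (r * z)).re := by
  obtain ⟨C, hC, h⟩ := exists_upperMod_primitive Λ
  refine ⟨C, hC, fun r hr0 hr1 => ?_⟩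
  have hv := continuous_density hG hr0 hr1
  have hper := density_periodic G r
  have h0 : ∫ t in (0 : ℝ)..(2 * Real.pi), density G r t = 0 := by
    have h1 := integral_pk_mul_density hG hr0 hr1 le_rfl one_pos 0
    have h2 := hper.intervalIntegral_add_eq (-Real.pi) 0
    rw [show -Real.pi + 2 * Real.pi = Real.pi by ring, zero_add] at h2
    rw [← h2]
    simpa [pk, hG0] using h1
  refine ⟨_, h _ M hM hv hper h0 fun ρ t hρ0 hρ1 => ?_, primitive_periodic hv hper h0, by simp,
    intervalIntegral.continuous_primitive (fun a b => hv.intervalIntegrable a b) 0, fun z hz => ?_⟩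
  · rw [integral_pk_mul_density hG hr0 hr1 hρ0 hρ1]
    have hn : ‖(r : ℂ) * (ρ * Complex.exp (t * Complex.I))‖ = r * ρ := by
      rw [norm_mul, norm_mul, Complex.norm_exp_ofReal_mul_I, mul_one, Complex.norm_real,
        Complex.norm_real, Real.norm_of_nonneg hr0, Real.norm_of_nonneg hρ0]
    have hle : r * ρ ≤ ρ := mul_le_of_le_one_left hρ0 hr1.le
    have h1 := hb ((r : ℂ) * (ρ * Complex.exp (t * Complex.I)))
      (by rw [mem_ball_zero_iff, hn]; linarith)
    rw [hn] at h1
    exact h1.trans (mul_le_mul_of_nonneg_left (Λ.antitoneOn ⟨by linarith, by linarith⟩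
      ⟨by linarith, by linarith [mul_nonneg hr0 hρ0]⟩ (by linarith)) hM)
  · have hz' : ‖z‖ < 1 := mem_ball_zero_iff.1 hz
    rw [re_herg_primitive hv hper h0 hz', integral_pk_mul_density hG hr0 hr1 (norm_nonneg z) hz',
      Complex.norm_mul_exp_arg_mul_I]

end KorenblumType

/-! ### Compactness of functions with a common one-sided modulus -/

namespace KorenblumType

variable {Λ : Majorant} {M : ℝ} {F : ℝ → ℝ}

lemma UpperMod.abs_le (h : UpperMod Λ M F) (hM : 0 ≤ M) (hper : Function.Periodic F (2 * Real.pi))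
    (h0 : F 0 = 0) (x : ℝ) : |F x| ≤ M * Λ.kap (2 * Real.pi) := by
  obtain ⟨y, hy, hxy⟩ := hper.exists_mem_Ico₀ Real.two_pi_pos x
  rw [hxy]
  have h1 : F (2 * Real.pi) = 0 := by rw [← h0, ← hper 0, zero_add]
  exact h.upperModOn.abs_le hM h0 h1 hy.1 hy.2.le

lemma UpperMod.intervalIntegrable (h : UpperMod Λ M F) (hM : 0 ≤ M)
    (hper : Function.Periodic F (2 * Real.pi)) (h0 : F 0 = 0) (a b : ℝ) :
    IntervalIntegrable F volume a b := by
  rw [intervalIntegrable_iff]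
  exact Measure.integrableOn_of_bounded (M := M * Λ.kap (2 * Real.pi)) measure_Ioc_lt_top.ne
    (h.measurable hM).aestronglyMeasurable (Eventually.of_forall fun x => h.abs_le hM hper h0 x)

/-- Riemann sums converge uniformly over all functions with a given one-sided modulus. -/
lemma UpperMod.abs_integral_sub_sum_le (h : UpperMod Λ M F) (hM : 0 ≤ M)
    (hper : Function.Periodic F (2 * Real.pi)) (h0 : F 0 = 0) {φ : ℝ → ℝ} (hφ : Continuous φ)
    {B : ℝ} (hB : ∀ x, |φ x| ≤ B) {N : ℕ} (hN : 0 < N) :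
    |(∫ θ in (0 : ℝ)..(2 * Real.pi), φ θ * F θ) -
      ∑ i ∈ Finset.range N, F (2 * Real.pi / N * i) *
        ∫ θ in (2 * Real.pi / N * i)..(2 * Real.pi / N * (i + 1 : ℕ)), φ θ| ≤
      B * (4 * Real.pi * M * Λ.kap (2 * Real.pi / N)) := by
  have hπ := Real.two_pi_pos
  have hN' : (0 : ℝ) < N := Nat.cast_pos.2 hN
  set δ := 2 * Real.pi / N with hδ
  have hδ0 : 0 < δ := by positivity
  have hδ1 : δ ≤ 2 * Real.pi := div_le_self hπ.le (by exact_mod_cast hN)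
  have hNδ : δ * N = 2 * Real.pi := by rw [hδ]; field_simp
  have hB0 : 0 ≤ B := (abs_nonneg _).trans (hB 0)
  have hF := h.intervalIntegrable hM hper h0
  have hI : ∀ a b, IntervalIntegrable (fun θ => φ θ * F θ) volume a b := fun a b =>
    (hF a b).continuousOn_mul hφ.continuousOn
  have h1 := intervalIntegral.sum_integral_adjacent_intervals (μ := volume)
    (f := fun θ => φ θ * F θ) (a := fun i : ℕ => δ * i) (n := N) fun i _ => hI _ _
  simp only [Nat.cast_zero, mul_zero, hNδ] at h1
  rw [← h1, ← Finset.sum_sub_distrib]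
  have hterm : ∀ i ∈ Finset.range N, |(∫ θ in (δ * i)..(δ * (i + 1 : ℕ)), φ θ * F θ) -
      F (δ * i) * ∫ θ in (δ * i)..(δ * (i + 1 : ℕ)), φ θ| ≤
      B * δ * (2 * M * Λ.kap δ + (F (δ * i) - F (δ * (i + 1 : ℕ)))) := by
    intro i _
    have hstep : δ * (i + 1 : ℕ) = δ * i + δ := by push_cast; ring
    rw [← intervalIntegral.integral_const_mul, ← intervalIntegral.integral_sub (hI _ _)
      (Continuous.intervalIntegrable (by fun_prop) _ _), hstep]
    refine (intervalIntegral.norm_integral_le_of_norm_le_const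
      (f := fun θ => φ θ * F θ - F (δ * i) * φ θ)
      (C := B * (2 * M * Λ.kap δ + (F (δ * i) - F (δ * i + δ)))) fun θ hθ => ?_).trans
        (le_of_eq ?_)
    · rw [uIoc_of_le (by linarith)] at hθ
      have e1 := h (δ * i) θ hθ.1.le (by linarith [hθ.2])
      have e2 := h θ (δ * i + δ) hθ.2 (by linarith [hθ.1])
      have e3 := mul_le_mul_of_nonneg_left (Λ.kap_mono (s := θ - δ * i) (t := δ)
        (by linarith [hθ.1]) (by linarith [hθ.2]) hδ1) hM
      have e4 := mul_le_mul_of_nonneg_left (Λ.kap_mono (s := δ * i + δ - θ) (t := δ)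
        (by linarith [hθ.2]) (by linarith [hθ.1]) hδ1) hM
      have e7 := h (δ * i) (δ * i + δ) (by linarith) (by linarith)
      rw [add_sub_cancel_left] at e7
      -- A one-sided modulus bounds the rise of `F` in a cell, but not its fall. The fall is charged
      -- to the total drop over the cell, and these drops telescope to zero over a period.
      have e5 : |F θ - F (δ * i)| ≤ 2 * M * Λ.kap δ + (F (δ * i) - F (δ * i + δ)) := by
        have e6 := mul_nonneg hM (Λ.kap_nonneg hδ0.le hδ1)
        rw [_root_.abs_le]; constructor <;> linarith
      rw [show φ θ * F θ - F (δ * i) * φ θ = φ θ * (F θ - F (δ * i)) by ring, norm_mul]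
      exact mul_le_mul (hB θ) e5 (abs_nonneg _) hB0
    · rw [add_sub_cancel_left, abs_of_pos hδ0]; ring
  refine (Finset.abs_sum_le_sum_abs _ _).trans ((Finset.sum_le_sum hterm).trans (le_of_eq ?_))
  rw [← Finset.mul_sum, Finset.sum_add_distrib, Finset.sum_range_sub', Finset.sum_const,
    Finset.card_range, nsmul_eq_mul, hNδ, ← zero_add (2 * Real.pi), hper]
  simp only [Nat.cast_zero, mul_zero, sub_self, add_zero]
  linear_combination (2 * B * M * Λ.kap δ) * hNδ

/-- The filter will be an ultrafilter, along which dominated convergence is not valid in general.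
Instead, integrals are approximated by Riemann sums with an error uniform over the class, and a
finite sum passes to the pointwise limit. -/
lemma tendsto_integral_of_upperMod {ι : Type*} {l : Filter ι} {H : ι → ℝ → ℝ} (hM : 0 ≤ M)
    (hH : ∀ i, UpperMod Λ M (H i)) (hHp : ∀ i, Function.Periodic (H i) (2 * Real.pi))
    (hH0 : ∀ i, H i 0 = 0) (hF : UpperMod Λ M F) (hFp : Function.Periodic F (2 * Real.pi))
    (hF0 : F 0 = 0) (hlim : ∀ x, Tendsto (fun i => H i x) l (𝓝 (F x))) {φ : ℝ → ℝ}
    (hφ : Continuous φ) {B : ℝ} (hB : ∀ x, |φ x| ≤ B) :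
    Tendsto (fun i => ∫ θ in (0 : ℝ)..(2 * Real.pi), φ θ * H i θ) l
      (𝓝 (∫ θ in (0 : ℝ)..(2 * Real.pi), φ θ * F θ)) := by
  have hB0 : 0 ≤ B := (abs_nonneg _).trans (hB 0)
  rw [Metric.tendsto_nhds]
  intro ε hε
  set K := B * (4 * Real.pi * M) with hK
  have hK0 : 0 ≤ K := by positivity
  obtain ⟨η, hη, hη2, hk⟩ := Λ.exists_kap_le (ε := ε / (3 * (K + 1))) (by positivity)
  obtain ⟨N, hN⟩ := exists_nat_gt (2 * Real.pi / η)
  have hN0 : (0 : ℝ) < N := lt_trans (by positivity) hN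
  have hδ : 2 * Real.pi / N ≤ η := by
    rw [div_lt_iff₀ hη] at hN
    rw [div_le_iff₀ hN0]; linarith
  have hsmall : B * (4 * Real.pi * M * Λ.kap (2 * Real.pi / N)) < ε / 3 := by
    calc B * (4 * Real.pi * M * Λ.kap (2 * Real.pi / N)) = K * Λ.kap (2 * Real.pi / N) := by
          rw [hK]; ring
      _ ≤ K * (ε / (3 * (K + 1))) :=
        mul_le_mul_of_nonneg_left (hk _ (by positivity) hδ) hK0
      _ < (K + 1) * (ε / (3 * (K + 1))) :=
        mul_lt_mul_of_pos_right (by linarith) (by positivity)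
      _ = ε / 3 := by field_simp
  have hsum : Tendsto (fun i => ∑ j ∈ Finset.range N, H i (2 * Real.pi / N * j) *
        ∫ θ in (2 * Real.pi / N * j)..(2 * Real.pi / N * (j + 1 : ℕ)), φ θ) l
      (𝓝 (∑ j ∈ Finset.range N, F (2 * Real.pi / N * j) *
        ∫ θ in (2 * Real.pi / N * j)..(2 * Real.pi / N * (j + 1 : ℕ)), φ θ)) :=
    tendsto_finsetSum _ fun j _ => (hlim _).mul_const _
  filter_upwards [(Metric.tendsto_nhds.1 hsum) (ε / 3) (by positivity)] with i hi
  rw [Real.dist_eq] at hi ⊢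
  have h1 := (hH i).abs_integral_sub_sum_le hM (hHp i) (hH0 i) hφ hB (Nat.cast_pos.1 hN0)
  have h2 := hF.abs_integral_sub_sum_le hM hFp hF0 hφ hB (Nat.cast_pos.1 hN0)
  rw [abs_lt] at hi ⊢
  rw [_root_.abs_le] at h1 h2
  constructor <;> linarith [h1.1, h1.2, h2.1, h2.2, hi.1, hi.2]

/-- Selection principle for functions with a common one-sided modulus. -/
lemma exists_limit_upperMod {H : ℕ → ℝ → ℝ} (hM : 0 ≤ M) (hH : ∀ i, UpperMod Λ M (H i))
    (hHp : ∀ i, Function.Periodic (H i) (2 * Real.pi)) (hH0 : ∀ i, H i 0 = 0) :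
    ∃ F : ℝ → ℝ, UpperMod Λ M F ∧ Function.Periodic F (2 * Real.pi) ∧ F 0 = 0 ∧
      ∀ x, Tendsto (fun n => H n x) (hyperfilter ℕ) (𝓝 (F x)) := by
  have hex : ∀ x, ∃ y, Tendsto (fun n => H n x) (hyperfilter ℕ) (𝓝 y) := fun x => by
    obtain ⟨y, -, hy⟩ := (isCompact_Icc (a := -(M * Λ.kap (2 * Real.pi)))
      (b := M * Λ.kap (2 * Real.pi))).ultrafilter_le_nhds ((hyperfilter ℕ).map fun n => H n x)
      (by
        rw [le_principal_iff, Ultrafilter.mem_coe, Ultrafilter.mem_map]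
        exact univ_mem' fun n => _root_.abs_le.1 ((hH n).abs_le hM (hHp n) (hH0 n) x))
    exact ⟨y, hy⟩
  choose F hF using hex
  refine ⟨F, fun a b hab hb => ?_, fun x => ?_, ?_, hF⟩
  · exact le_of_tendsto ((hF b).sub (hF a)) (Eventually.of_forall fun n => hH n a b hab hb)
  · refine tendsto_nhds_unique (hF _) ?_
    simp_rw [fun n => hHp n x]
    exact hF x
  · refine tendsto_nhds_unique (hF _) ?_
    simp_rw [hH0]
    exact tendsto_const_nhds

lemma herg_zero (F : ℝ → ℝ) : herg F 0 = 0 := by simp [herg, dker]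

/-- The modulus of `exp H` is constantly `1`, so by the maximum principle `exp H` is constant. -/
lemma exp_eq_one_of_re_eq_zero {H : ℂ → ℂ} (hH : DifferentiableOn ℂ H (Metric.ball 0 1))
    (h0 : H 0 = 0) (hre : ∀ z ∈ Metric.ball (0 : ℂ) 1, (H z).re = 0) {z : ℂ}
    (hz : z ∈ Metric.ball (0 : ℂ) 1) : Complex.exp (H z) = 1 := by
  have hd : DifferentiableOn ℂ (fun z => Complex.exp (H z)) (Metric.ball 0 1) := hH.cexp
  have := Complex.eqOn_of_isPreconnected_of_isMaxOn_norm (convex_ball (0 : ℂ) 1).isPreconnected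
    Metric.isOpen_ball hd (Metric.mem_ball_self one_pos) (fun w hw => by
      simp [Complex.norm_exp, hre w hw, h0])
  simpa [h0] using this hz

/-- The logarithm of a zero-free function of `A_Λ^{-∞}` is the Herglotz transform of a distribution
function with a one-sided modulus. -/
theorem exists_eq_exp_herg (f : KorenblumSpace Λ) (hf : ∀ z : 𝔻, f z ≠ 0) (hf0 : f 0 = 1) :
    ∃ (F : ℝ → ℝ) (M : ℝ), 0 ≤ M ∧ UpperMod Λ M F ∧ Function.Periodic F (2 * Real.pi) ∧ F 0 = 0 ∧
      ∀ z : 𝔻, f z = Complex.exp (herg F z) := by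
  obtain ⟨c, hc, ⟨F₀, hF₀, hfF⟩, C, hC⟩ := f.2
  replace hfF : ∀ z : 𝔻, f z = F₀ z := hfF
  replace hC : ∀ z : 𝔻, ‖f z‖ ≤ C * Real.exp (c * Λ (1 - ‖(z : ℂ)‖)) := hC
  have hmem : ∀ z ∈ Metric.ball (0 : ℂ) 1, ∃ w : 𝔻, (w : ℂ) = z := fun z hz =>
    ⟨Complex.UnitDisc.mk z (mem_ball_zero_iff.1 hz), rfl⟩
  obtain ⟨G, hG, hG0, hexp⟩ := exists_log hF₀
    (fun z hz => by obtain ⟨w, rfl⟩ := hmem z hz; rw [← hfF]; exact hf w)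
    (by have := hfF 0; rw [hf0] at this; simpa using this.symm)
  have hCpos : 0 < C := by
    have := hC 0
    rw [hf0, norm_one] at this
    exact pos_of_mul_pos_left (one_pos.trans_le this) (Real.exp_pos _).le
  have hΛ1 := Λ.pos 1 ⟨one_pos, le_rfl⟩
  -- The multiplicative constant of the growth bound is absorbed into the exponent, using `Λ ≥ Λ 1 >
  -- 0`.
  set M₀ := |Real.log C| / Λ 1 + c with hM₀
  have hM₀0 : 0 ≤ M₀ := by positivity
  have hb : ∀ z ∈ Metric.ball (0 : ℂ) 1, (G z).re ≤ M₀ * Λ (1 - ‖z‖) := by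
    intro z hz
    obtain ⟨w, rfl⟩ := hmem z hz
    have h1 := hC w
    rw [hfF, ← hexp _ hz, Complex.norm_exp, ← Real.exp_log hCpos, ← Real.exp_add,
      Real.exp_le_exp] at h1
    have hm := one_sub_norm_mem w
    have h2 : Λ 1 ≤ Λ (1 - ‖(w : ℂ)‖) := Λ.antitoneOn hm ⟨one_pos, le_rfl⟩ hm.2
    have h3 : Real.log C ≤ |Real.log C| / Λ 1 * Λ (1 - ‖(w : ℂ)‖) := by
      calc Real.log C ≤ |Real.log C| := le_abs_self _
        _ = |Real.log C| / Λ 1 * Λ 1 := by field_simp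
        _ ≤ _ := mul_le_mul_of_nonneg_left h2 (by positivity)
    rw [hM₀, add_mul]
    linarith
  obtain ⟨C', hC', hdil⟩ := exists_dist_dilation (Λ := Λ) hG hG0 hM₀0 hb
  set r : ℕ → ℝ := fun n => 1 - 1 / ((n : ℝ) + 1) with hr
  have hr0 : ∀ n, 0 ≤ r n := fun n => by
    have : 1 / ((n : ℝ) + 1) ≤ 1 := by rw [div_le_one (by positivity)]; linarith [n.cast_nonneg (α := ℝ)]
    simp only [hr]; linarith
  have hr1 : ∀ n, r n < 1 := fun n => by
    have : 0 < 1 / ((n : ℝ) + 1) := by positivity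
    simp only [hr]; linarith
  have hrlim : Tendsto r (hyperfilter ℕ) (𝓝 1) := by
    have := (tendsto_one_div_add_atTop_nhds_zero_nat (𝕜 := ℝ)).const_sub 1
    rw [sub_zero] at this
    exact this.mono_left Nat.hyperfilter_le_atTop
  choose H hH hHp hH0 hHc hHre using fun n => hdil (r n) (hr0 n) (hr1 n)
  have hM : 0 ≤ C' * M₀ := by positivity
  obtain ⟨F, hF, hFp, hF0, hlim⟩ := exists_limit_upperMod hM hH hHp hH0
  have hFi := hF.intervalIntegrable hM hFp hF0
  have hre : ∀ z ∈ Metric.ball (0 : ℂ) 1, (herg F z).re = (G z).re := by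
    intro z hz
    have hz' : ‖z‖ < 1 := mem_ball_zero_iff.1 hz
    have hcd := continuous_dpk (norm_nonneg z) hz'
    have hB : ∀ θ, |dpk ‖z‖ (θ - z.arg)| ≤ 2 / (1 - ‖z‖) ^ 2 := fun θ => by
      rw [← re_dker hz']
      exact (Complex.abs_re_le_norm _).trans (norm_dker_le le_rfl hz' θ)
    have h1 := (tendsto_integral_of_upperMod hM hH hHp hH0 hF hFp hF0 hlim
      (φ := fun θ => dpk ‖z‖ (θ - z.arg)) (by fun_prop) hB).neg
    rw [← re_herg_eq hz' (hFi _ _)] at h1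
    have h2 : ∀ n, -∫ θ in (0 : ℝ)..(2 * Real.pi), dpk ‖z‖ (θ - z.arg) * H n θ =
        (G (r n * z)).re := fun n => by
      rw [← re_herg_eq hz' ((hHc n).intervalIntegrable _ _), hHre n z hz]
    simp_rw [h2] at h1
    refine tendsto_nhds_unique h1 ?_
    have hcont : ContinuousAt G z := (hG.differentiableAt (Metric.isOpen_ball.mem_nhds hz)).continuousAt
    have h3 : Tendsto (fun n => (r n : ℂ) * z) (hyperfilter ℕ) (𝓝 z) := by
      have := ((Complex.continuous_ofReal.tendsto 1).comp hrlim).mul_const z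
      simpa using this
    exact (Complex.continuous_re.tendsto _).comp (hcont.tendsto.comp h3)
  refine ⟨F, C' * M₀, hM, hF, hFp, hF0, fun z => ?_⟩
  have hz : (z : ℂ) ∈ Metric.ball (0 : ℂ) 1 := mem_ball_zero_iff.2 z.norm_lt_one
  -- Only real parts have been compared so far; both functions vanish at the origin, which fixes the
  -- imaginary constant.
  have h1 := exp_eq_one_of_re_eq_zero (H := fun z => G z - herg F z)
    (hG.sub (herg_differentiableOn (hFi _ _))) (by simp [hG0, herg_zero])
    (fun w hw => by rw [Complex.sub_re, hre w hw, sub_self]) hz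
  rw [Complex.exp_sub, div_eq_one_iff_eq (Complex.exp_ne_zero _), hexp _ hz] at h1
  rw [hfF, h1]

end KorenblumType

namespace KorenblumType

variable {Λ : Majorant} {M : ℝ} {F : ℝ → ℝ}

/-! ### One-sided limits -/

lemma UpperMod.tendsto_leftLim (h : UpperMod Λ M F) (hM : 0 ≤ M) (x : ℝ) :
    Tendsto F (𝓝[<] x) (𝓝 (Function.leftLim F x)) := by
  have hπ := Real.two_pi_pos
  suffices ∃ L, Tendsto F (𝓝[<] x) (𝓝 L) from tendsto_leftLim_of_tendsto this
  -- The left limit is the infimum of the corrected values `F y + M kap(x - y)`. A `y` nearly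
  -- attaining it bounds `F t` above for all `t` between `y` and `x`, while the infimum itself
  -- bounds `F t` below up to `M kap(x - t)`.
  set A : Set ℝ := (fun y => F y + M * Λ.kap (x - y)) '' Ico (x - 2 * Real.pi) x with hA
  have hne : A.Nonempty := ⟨_, _, ⟨le_rfl, by linarith⟩, rfl⟩
  have hbd : BddBelow A := by
    refine ⟨F x, ?_⟩
    rintro _ ⟨y, hy, rfl⟩
    have := h y x hy.2.le (by linarith [hy.1])
    simp only; linarith
  refine ⟨sInf A, ?_⟩
  rw [Metric.tendsto_nhds]
  intro ε hε
  obtain ⟨_, ⟨y, hy, rfl⟩, hlt⟩ := exists_lt_of_csInf_lt hne (show sInf A < sInf A + ε by linarith)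
  obtain ⟨η, hη, hη2, hk⟩ := Λ.exists_kap_le (ε := ε / (M + 1)) (by positivity)
  filter_upwards [Ioo_mem_nhdsLT hy.2, Ioo_mem_nhdsLT (show x - η < x by linarith)] with t ht ht2
  have h1 : sInf A ≤ F t + M * Λ.kap (x - t) := csInf_le hbd ⟨t, ⟨by linarith [ht.1, hy.1], ht.2⟩, rfl⟩
  have h2 := h y t ht.1.le (by linarith [ht.2, hy.1])
  have h3 := mul_le_mul_of_nonneg_left (Λ.kap_mono (s := t - y) (t := x - y) (by linarith [ht.1])
    (by linarith [ht.2]) (by linarith [hy.1])) hM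
  have h4 : M * Λ.kap (x - t) < ε := by
    calc M * Λ.kap (x - t) ≤ M * (ε / (M + 1)) :=
          mul_le_mul_of_nonneg_left (hk _ (by linarith [ht.2]) (by linarith [ht2.1])) hM
      _ < (M + 1) * (ε / (M + 1)) := mul_lt_mul_of_pos_right (by linarith) (by positivity)
      _ = ε := by field_simp
  rw [Real.dist_eq, abs_lt]
  simp only at hlt
  constructor <;> linarith

/-- The point reflection of the graph preserves increments and exchanges left and right limits. -/
lemma UpperMod.neg_comp_neg (h : UpperMod Λ M F) : UpperMod Λ M fun x => -F (-x) := by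
  intro a b hab hb
  have := h (-b) (-a) (by linarith) (by linarith)
  rw [show -a - -b = b - a by ring] at this
  simp only; linarith

lemma UpperMod.tendsto_rightLim (h : UpperMod Λ M F) (hM : 0 ≤ M) (x : ℝ) :
    Tendsto F (𝓝[>] x) (𝓝 (Function.rightLim F x)) := by
  suffices ∃ L, Tendsto F (𝓝[>] x) (𝓝 L) from tendsto_rightLim_of_tendsto this
  have h1 := (h.neg_comp_neg.tendsto_leftLim hM (-x)).neg
  have h2 : Tendsto (fun y : ℝ => -y) (𝓝[>] x) (𝓝[<] (-x)) := tendsto_neg_nhdsGT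
  have h3 := h1.comp h2
  simp only [neg_neg, Function.comp_def] at h3
  exact ⟨_, h3⟩

lemma UpperMod.tendsto_rightLim_add (h : UpperMod Λ M F) (hM : 0 ≤ M) (x : ℝ) :
    Tendsto (fun t : ℝ => F (x + t)) (𝓝[>] 0) (𝓝 (Function.rightLim F x)) := by
  refine (h.tendsto_rightLim hM x).comp (tendsto_nhdsWithin_iff.2 ⟨?_,
    eventually_mem_nhdsWithin.mono fun t ht => by simpa using ht⟩)
  have := (continuous_const_add x).tendsto 0
  rw [add_zero] at this
  exact this.mono_left nhdsWithin_le_nhds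

lemma UpperMod.tendsto_leftLim_sub (h : UpperMod Λ M F) (hM : 0 ≤ M) (x : ℝ) :
    Tendsto (fun t : ℝ => F (x - t)) (𝓝[>] 0) (𝓝 (Function.leftLim F x)) := by
  refine (h.tendsto_leftLim hM x).comp (tendsto_nhdsWithin_iff.2 ⟨?_,
    eventually_mem_nhdsWithin.mono fun t ht => by simpa using ht⟩)
  have := (continuous_sub_left x).tendsto 0
  rw [sub_zero] at this
  exact this.mono_left nhdsWithin_le_nhds

lemma UpperMod.leftLim (h : UpperMod Λ M F) (hM : 0 ≤ M) :
    UpperMod Λ M (Function.leftLim F) := fun a b hab hb => by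
  refine le_of_tendsto ((h.tendsto_leftLim_sub hM b).sub (h.tendsto_leftLim_sub hM a))
    (Eventually.of_forall fun t => ?_)
  have := h (a - t) (b - t) (by linarith) (by linarith)
  rwa [sub_sub_sub_cancel_right] at this

lemma UpperMod.leftLim_periodic (h : UpperMod Λ M F) (hM : 0 ≤ M)
    (hper : Function.Periodic F (2 * Real.pi)) :
    Function.Periodic (Function.leftLim F) (2 * Real.pi) := fun x => by
  have h1 : Tendsto (fun y : ℝ => y + 2 * Real.pi) (𝓝[<] x) (𝓝[<] (x + 2 * Real.pi)) :=
    tendsto_nhdsWithin_iff.2 ⟨((continuous_add_const _).tendsto x).mono_left nhdsWithin_le_nhds,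
      eventually_mem_nhdsWithin.mono fun y hy => by
        simpa using hy⟩
  have h2 := (h.tendsto_leftLim hM (x + 2 * Real.pi)).comp h1
  simp only [Function.comp_def, hper _] at h2
  exact tendsto_nhds_unique h2 (h.tendsto_leftLim hM x)

lemma UpperMod.rightLim_periodic (h : UpperMod Λ M F) (hM : 0 ≤ M)
    (hper : Function.Periodic F (2 * Real.pi)) :
    Function.Periodic (Function.rightLim F) (2 * Real.pi) := fun x => by
  have h1 : Tendsto (fun y : ℝ => y + 2 * Real.pi) (𝓝[>] x) (𝓝[>] (x + 2 * Real.pi)) :=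
    tendsto_nhdsWithin_iff.2 ⟨((continuous_add_const _).tendsto x).mono_left nhdsWithin_le_nhds,
      eventually_mem_nhdsWithin.mono fun y hy => by
        simpa using hy⟩
  have h2 := (h.tendsto_rightLim hM (x + 2 * Real.pi)).comp h1
  simp only [Function.comp_def, hper _] at h2
  exact tendsto_nhds_unique h2 (h.tendsto_rightLim hM x)

/-! ### Replacing a distribution function by its left limits -/

lemma dker_periodic (z : ℂ) : Function.Periodic (dker z) (2 * Real.pi) := fun θ => by
  unfold dker
  push_cast
  rw [add_mul, Complex.exp_periodic]

lemma dker_add (z : ℂ) (θ h : ℝ) :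
    dker z (θ + h) = dker (z * Complex.exp (-h * Complex.I)) θ := by
  unfold dker
  have e : Complex.exp ((θ + h : ℝ) * Complex.I) =
      Complex.exp (h * Complex.I) * Complex.exp (θ * Complex.I) := by
    rw [← Complex.exp_add]; congr 1; push_cast; ring
  have e2 : z = Complex.exp (h * Complex.I) * (z * Complex.exp (-h * Complex.I)) := by
    rw [mul_left_comm, ← Complex.exp_add]; simp
  rw [e]
  nth_rewrite 1 2 [e2]
  have hne := Complex.exp_ne_zero (h * Complex.I)
  rw [← mul_sub, mul_pow]
  rw [show -2 * Complex.I * (Complex.exp (h * Complex.I) * (z * Complex.exp (-h * Complex.I))) *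
      (Complex.exp (h * Complex.I) * Complex.exp (θ * Complex.I)) =
      Complex.exp (h * Complex.I) ^ 2 * (-2 * Complex.I * (z * Complex.exp (-h * Complex.I)) *
        Complex.exp (θ * Complex.I)) by ring,
    mul_div_mul_left _ _ (pow_ne_zero 2 hne)]

lemma integral_dker {z : ℂ} (hz : ‖z‖ < 1) : ∫ θ in (0 : ℝ)..(2 * Real.pi), dker z θ = 0 := by
  rw [intervalIntegral.integral_eq_sub_of_hasDerivAt (fun θ _ => hasDerivAt_ker hz θ)
    ((continuous_dker hz).intervalIntegrable _ _)]
  push_cast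
  rw [Complex.exp_two_pi_mul_I]
  simp

/-- The Herglotz transform does not see the values at jumps. -/
lemma UpperMod.herg_leftLim (h : UpperMod Λ M F) (hM : 0 ≤ M)
    (hper : Function.Periodic F (2 * Real.pi)) (h0 : F 0 = 0) {z : ℂ} (hz : ‖z‖ < 1) :
    herg (Function.leftLim F) z = herg F z := by
  have hi := h.intervalIntegrable hM hper h0
  -- Translating `F` amounts to rotating `z`. As `t → 0+` the translates tend pointwise to the left
  -- limits of `F`, while the rotated points tend to `z`, where the transform is continuous.
  have hrot : ∀ t : ℝ, herg (fun θ => F (θ - t)) z = herg F (z * Complex.exp (-t * Complex.I)) := by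
    intro t
    have hp : Function.Periodic (fun θ => dker z (θ + t) * (F θ : ℂ)) (2 * Real.pi) := fun θ => by
      simp only
      rw [add_right_comm, dker_periodic z, hper]
    have h1 := intervalIntegral.integral_comp_sub_right (a := 0) (b := 2 * Real.pi)
      (fun θ => dker z (θ + t) * (F θ : ℂ)) t
    simp only [sub_add_cancel] at h1
    have h2 := hp.intervalIntegral_add_eq (0 - t) 0
    rw [show 0 - t + 2 * Real.pi = 2 * Real.pi - t by ring, zero_add] at h2
    unfold herg
    rw [h1, h2]
    simp_rw [dker_add]
  have hlim : Tendsto (fun t : ℝ => herg (fun θ => F (θ - t)) z) (𝓝[>] 0) (𝓝 (herg F z)) := by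
    simp_rw [hrot]
    have hcont : ContinuousAt (herg F) z := ((herg_differentiableOn (hi _ _)).differentiableAt
      (Metric.isOpen_ball.mem_nhds (mem_ball_zero_iff.2 hz))).continuousAt
    have h3 : Tendsto (fun t : ℝ => z * Complex.exp (-t * Complex.I)) (𝓝[>] 0) (𝓝 z) := by
      have : Continuous fun t : ℝ => z * Complex.exp (-t * Complex.I) := by fun_prop
      have := this.tendsto 0
      simp only [Complex.ofReal_zero, neg_zero, zero_mul, Complex.exp_zero, mul_one] at this
      exact this.mono_left nhdsWithin_le_nhds
    exact hcont.tendsto.comp h3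
  refine tendsto_nhds_unique ?_ hlim
  refine Tendsto.neg ?_
  have hmeas := h.measurable hM
  refine intervalIntegral.tendsto_integral_filter_of_dominated_convergence
    (fun _ => 2 / (1 - ‖z‖) ^ 2 * (M * Λ.kap (2 * Real.pi))) (Eventually.of_forall fun t => ?_)
    (Eventually.of_forall fun t => Eventually.of_forall fun θ _ => ?_)
    (by simp) (Eventually.of_forall fun θ _ => ?_)
  · exact ((continuous_dker hz).measurable.mul (Complex.measurable_ofReal.comp
      (hmeas.comp (measurable_id.sub_const t)))).aestronglyMeasurable
  · rw [norm_mul, Complex.norm_real]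
    exact mul_le_mul (norm_dker_le le_rfl hz θ) (h.abs_le hM hper h0 _) (norm_nonneg _)
      (by positivity)
  · refine Tendsto.const_mul _ ((Complex.continuous_ofReal.tendsto _).comp ?_)
    exact h.tendsto_leftLim_sub hM θ

end KorenblumType

namespace KorenblumType

/-! ### Sums over the ends of an arc -/

/-- `I` contains the points following after `p` in the clockwise direction. -/
def LeftGerm (I : Set Circle) (p : Circle) : Prop :=
  ∀ᶠ h in 𝓝[>] (0 : ℝ), Circle.exp (-h) * p ∈ I

open Classical in
/-- The jump of the indicator function of `I` at `p`, from the left limit to the value,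
multiplied by `f p`. -/
def jump (f : Circle → ℝ) (I : Set Circle) (p : Circle) : ℝ :=
  ((if p ∈ I then 1 else 0) - if LeftGerm I p then 1 else 0) * f p

/-- The sum of the jumps of the indicator function of `I`, with weight `f`. -/
def jumpSum (f : Circle → ℝ) (I : Set Circle) : ℝ := ∑ᶠ p, jump f I p

/-- The sets whose indicator functions have left limits, and only finitely many jumps. -/
structure IsTame (I : Set Circle) : Prop where
  germ : ∀ p, LeftGerm I p ∨ LeftGerm Iᶜ p
  finite : ∀ f, (Function.support (jump f I)).Finite

lemma not_leftGerm_of_disjoint {I J : Set Circle} (h : Disjoint I J) {p : Circle}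
    (hI : LeftGerm I p) : ¬ LeftGerm J p := fun hJ => by
  obtain ⟨t, h1, h2⟩ := (hI.and hJ).exists
  exact Set.disjoint_left.1 h h1 h2

/-- The converse direction needs the dichotomy of tameness: if `I` does not fill a one-sided
neighbourhood, then it misses one, and there the union is contained in `J`. -/
lemma leftGerm_union {I J : Set Circle} (hI : IsTame I) {p : Circle} :
    LeftGerm (I ∪ J) p ↔ LeftGerm I p ∨ LeftGerm J p := by
  refine ⟨fun h => ?_, fun h => h.elim (fun h => h.mono fun _ => Or.inl) fun h => h.mono fun _ => Or.inr⟩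
  refine (hI.germ p).imp_right fun h' => ?_
  filter_upwards [h, h'] with t h1 h2
  exact h1.resolve_left h2

/-- The indicator functions and their left limits add up for disjoint sets, so the jumps do as well,
point by point. Additivity of the mass thus requires no case distinction on how two arcs fit
together. -/
lemma jumpSum_union {I J : Set Circle} (hI : IsTame I) (hJ : IsTame J) (h : Disjoint I J)
    (f : Circle → ℝ) : jumpSum f (I ∪ J) = jumpSum f I + jumpSum f J := by
  unfold jumpSum
  rw [← finsum_add_distrib (hI.finite f) (hJ.finite f)]
  refine finsum_congr fun p => ?_
  have h1 : p ∈ I → p ∉ J := fun h1 h2 => Set.disjoint_left.1 h h1 h2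
  have h2 : LeftGerm I p → ¬ LeftGerm J p := not_leftGerm_of_disjoint h
  have h3 := leftGerm_union (J := J) hI (p := p)
  simp only [jump]
  by_cases a : p ∈ I <;> by_cases b : p ∈ J <;> by_cases c : LeftGerm I p <;>
    by_cases d : LeftGerm J p <;> simp_all

lemma jump_univ (f : Circle → ℝ) (p : Circle) : jump f univ p = 0 := by
  have : LeftGerm univ p := Eventually.of_forall fun _ => mem_univ _
  simp [jump, this]

lemma leftGerm_compl_empty (p : Circle) : LeftGerm (∅ᶜ : Set Circle) p :=
  Eventually.of_forall fun _ => by simp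

lemma jump_empty (f : Circle → ℝ) (p : Circle) : jump f ∅ p = 0 := by
  have : ¬ LeftGerm ∅ p := fun h => by
    obtain ⟨t, ht⟩ := h.exists
    exact ht
  simp [jump, this]

lemma isTame_univ : IsTame univ :=
  ⟨fun _ => Or.inl (Eventually.of_forall fun _ => mem_univ _), fun f => by
    rw [Function.support_eq_empty_iff.2 (funext fun p => jump_univ f p)]; exact finite_empty⟩

lemma isTame_empty : IsTame ∅ :=
  ⟨fun p => Or.inr (leftGerm_compl_empty p), fun f => by
    rw [Function.support_eq_empty_iff.2 (funext fun p => jump_empty f p)]; exact finite_empty⟩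

lemma injOn_exp_Ioc (c : ℝ) : InjOn Circle.exp (Ioc c (c + 2 * Real.pi)) := by
  intro x hx y hy h
  obtain ⟨m, hm⟩ := Circle.exp_eq_exp.1 h
  have hπ := Real.two_pi_pos
  have h1 : (m : ℝ) < 1 := by
    by_contra! h1
    have := mul_le_mul_of_nonneg_right h1 hπ.le
    linarith [hx.2, hy.1]
  have h2 : (-1 : ℝ) < m := by
    by_contra! h2
    have := mul_le_mul_of_nonneg_right h2 hπ.le
    linarith [hx.1, hy.2]
  have h3 : m = 0 := by
    have : m < 1 := by exact_mod_cast h1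
    have : -1 < m := by exact_mod_cast h2
    omega
  rw [hm, h3]; simp

lemma image_exp_Ioc (c : ℝ) : Circle.exp '' Ioc c (c + 2 * Real.pi) = univ := by
  rw [eq_univ_iff_forall]
  intro p
  obtain ⟨θ, rfl⟩ := Circle.exp_surjective p
  refine ⟨toIocMod Real.two_pi_pos c θ, toIocMod_mem_Ioc _ _ _, ?_⟩
  rw [← self_sub_toIocDiv_zsmul]
  exact Circle.periodic_exp.sub_zsmul_eq _

section lift

variable {s : Set ℝ} {a b c : ℝ}

lemma exp_mem_image_lift (hsub : s ⊆ Ioo c (c + 2 * Real.pi)) {x : ℝ}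
    (hx : x ∈ Ioc c (c + 2 * Real.pi)) : Circle.exp x ∈ Circle.exp '' s ↔ x ∈ s :=
  (injOn_exp_Ioc c).mem_image_iff (hsub.trans Ioo_subset_Ioc_self) hx

lemma eventually_lift (hsub : s ⊆ Ioo c (c + 2 * Real.pi)) {x : ℝ}
    (hx : x ∈ Ioc c (c + 2 * Real.pi)) :
    ∀ᶠ h in 𝓝[>] (0 : ℝ), (Circle.exp (-h) * Circle.exp x ∈ Circle.exp '' s ↔ x - h ∈ s) := by
  filter_upwards [Ioo_mem_nhdsGT (show 0 < x - c by linarith [hx.1])] with h hh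
  rw [← Circle.exp_add, neg_add_eq_sub]
  exact exp_mem_image_lift hsub ⟨by linarith [hh.2], by linarith [hh.1, hx.2]⟩

lemma Ioo_subset_of_isGLB_isLUB (hs : s.OrdConnected) (ha : IsGLB s a) (hb : IsLUB s b) :
    Ioo a b ⊆ s := fun x hx => by
  obtain ⟨y, hy, -, hyx⟩ := ha.exists_between hx.1
  obtain ⟨z, hz, hxz, -⟩ := hb.exists_between hx.2
  exact hs.out hy hz ⟨hyx.le, hxz.le⟩

lemma leftGerm_image (hs : s.OrdConnected) (hsub : s ⊆ Ioo c (c + 2 * Real.pi))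
    (ha : IsGLB s a) (hb : IsLUB s b) {x : ℝ} (hx : x ∈ Ioc c (c + 2 * Real.pi)) (hax : a < x)
    (hxb : x ≤ b) : LeftGerm (Circle.exp '' s) (Circle.exp x) := by
  filter_upwards [eventually_lift hsub hx, Ioo_mem_nhdsGT (show 0 < x - a by linarith)] with h h1 h2
  exact h1.2 (Ioo_subset_of_isGLB_isLUB hs ha hb ⟨by linarith [h2.2], by linarith [h2.1]⟩)

lemma leftGerm_compl_image (hsub : s ⊆ Ioo c (c + 2 * Real.pi))
    (ha : IsGLB s a) (hb : IsLUB s b) {x : ℝ} (hx : x ∈ Ioc c (c + 2 * Real.pi))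
    (hax : x ≤ a ∨ b < x) : LeftGerm (Circle.exp '' s)ᶜ (Circle.exp x) := by
  rcases hax with hax | hax
  · filter_upwards [eventually_lift hsub hx, self_mem_nhdsWithin] with h h1 h2 h3
    have := ha.1 (h1.1 h3)
    have h2 : 0 < h := h2
    linarith
  · filter_upwards [eventually_lift hsub hx, Ioo_mem_nhdsGT (show 0 < x - b by linarith)]
      with h h1 h2 h3
    have := hb.1 (h1.1 h3)
    linarith [h2.2]

-- An interval is entered between left limit and value exactly at a left end point that it contains,
-- and left in that way exactly at a right end point that it does not contain. The other two cases
-- are seen by the reflected arc.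
open Classical in
lemma jump_image (hs : s.OrdConnected) (hne : s.Nonempty) (hsub : s ⊆ Ioo c (c + 2 * Real.pi))
    (ha : IsGLB s a) (hb : IsLUB s b) (f : Circle → ℝ) {x : ℝ}
    (hx : x ∈ Ioc c (c + 2 * Real.pi)) :
    jump f (Circle.exp '' s) (Circle.exp x) =
      (if x = a ∧ a ∈ s then f (Circle.exp a) else 0) -
        if x = b ∧ b ∉ s then f (Circle.exp b) else 0 := by
  unfold jump
  rw [exp_mem_image_lift hsub hx]
  have hab : a ≤ b := by
    obtain ⟨y, hy⟩ := hne
    exact (ha.1 hy).trans (hb.1 hy)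
  rcases lt_or_ge a x with h1 | h1
  · have hxa : x ≠ a := h1.ne'
    rcases le_or_gt x b with h2 | h2
    · have hg := leftGerm_image hs hsub ha hb hx h1 h2
      rcases eq_or_ne x b with rfl | hxb
      · by_cases hm : x ∈ s <;> simp [hm, hg, hxa]
      · have hm := Ioo_subset_of_isGLB_isLUB hs ha hb ⟨h1, lt_of_le_of_ne h2 hxb⟩
        simp [hm, hg, hxa, hxb]
    · have hg := not_leftGerm_of_disjoint disjoint_compl_left
        (leftGerm_compl_image hsub ha hb hx (Or.inr h2))
      have hm : x ∉ s := fun h => absurd (hb.1 h) (not_le.2 h2)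
      have hxb : x ≠ b := h2.ne'
      simp [hm, hg, hxa, hxb]
  · have hg := not_leftGerm_of_disjoint disjoint_compl_left
      (leftGerm_compl_image hsub ha hb hx (Or.inl h1))
    rcases h1.eq_or_lt with rfl | h1
    · have hxb : x ∉ s → x ≠ b := by
        rintro hm rfl
        obtain ⟨y, hy⟩ := hne
        exact hm (le_antisymm (ha.1 hy) (hb.1 hy) ▸ hy)
      by_cases hm : x ∈ s
      · have : ¬ (x = b ∧ b ∉ s) := fun h => h.2 (h.1 ▸ hm)
        simp [hm, hg, this]
      · simp [hm, hg, hxb hm]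
    · have hm : x ∉ s := fun h => absurd (ha.1 h) (not_le.2 h1)
      have hxa : x ≠ a := h1.ne
      have hxb : x ≠ b := (h1.trans_le hab).ne
      simp [hm, hg, hxa, hxb]

lemma isTame_image (hs : s.OrdConnected) (hsub : s ⊆ Ioo c (c + 2 * Real.pi)) :
    IsTame (Circle.exp '' s) := by
  rcases s.eq_empty_or_nonempty with rfl | hne
  · rw [image_empty]; exact isTame_empty
  have hbd : BddBelow s := bddBelow_Ioo.mono hsub
  have hba : BddAbove s := bddAbove_Ioo.mono hsub
  have ha := isGLB_csInf hne hbd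
  have hb := isLUB_csSup hne hba
  have hlift : ∀ p : Circle, ∃ x ∈ Ioc c (c + 2 * Real.pi), Circle.exp x = p := fun p =>
    (image_exp_Ioc c).ge (mem_univ p)
  refine ⟨fun p => ?_, fun f => ?_⟩
  · obtain ⟨x, hx, rfl⟩ := hlift p
    by_cases h : sInf s < x ∧ x ≤ sSup s
    · exact Or.inl (leftGerm_image hs hsub ha hb hx h.1 h.2)
    · refine Or.inr (leftGerm_compl_image hsub ha hb hx ?_)
      rw [not_and_or, not_lt, not_le] at h
      exact h
  · refine (Set.toFinite {Circle.exp (sInf s), Circle.exp (sSup s)}).subset fun p hp => ?_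
    obtain ⟨x, hx, rfl⟩ := hlift p
    by_contra! hne'
    rw [mem_insert_iff, mem_singleton_iff, not_or] at hne'
    refine hp ?_
    rw [jump_image hs hne hsub ha hb f hx, if_neg (fun h => hne'.1 (by rw [h.1])),
      if_neg (fun h => hne'.2 (by rw [h.1])), sub_zero]

open Classical in
lemma jumpSum_image (hs : s.OrdConnected) (hne : s.Nonempty)
    (hsub : s ⊆ Ioo c (c + 2 * Real.pi)) (ha : IsGLB s a) (hb : IsLUB s b) (f : Circle → ℝ) :
    jumpSum f (Circle.exp '' s) =
      (if a ∈ s then f (Circle.exp a) else 0) - if b ∈ s then 0 else f (Circle.exp b) := by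
  unfold jumpSum
  rw [← finsum_mem_univ, ← image_exp_Ioc c, finsum_mem_image (injOn_exp_Ioc c), finsum_mem_def]
  have key : ∀ x, (Ioc c (c + 2 * Real.pi)).indicator
      (fun x => jump f (Circle.exp '' s) (Circle.exp x)) x =
      (if x = a then if a ∈ s then f (Circle.exp a) else 0 else 0) +
        if x = b then -(if b ∈ s then 0 else f (Circle.exp b)) else 0 := by
    intro x
    by_cases hx : x ∈ Ioc c (c + 2 * Real.pi)
    · rw [indicator_of_mem hx, jump_image hs hne hsub ha hb f hx]
      by_cases h1 : x = a <;> by_cases h2 : x = b <;> by_cases h3 : a ∈ s <;>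
        by_cases h4 : b ∈ s <;> by_cases h5 : a = b <;> simp [h1, h2, h3, h4, h5, sub_eq_add_neg]
    · rw [indicator_of_notMem hx]
      -- Of the two end points only `a` can fall outside the half-open period, when `a = c`; in that
      -- case it is not in `s` and carries no jump.
      have h1 : ¬ (x = a ∧ a ∈ s) := fun h => hx (h.1 ▸ Ioo_subset_Ioc_self (hsub h.2))
      have h2 : x ≠ b := by
        rintro rfl
        obtain ⟨y, hy⟩ := hne
        exact hx ⟨(hsub hy).1.trans_le (hb.1 hy), hb.2 fun z hz => (hsub hz).2.le⟩
      rw [if_neg h2]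
      by_cases h3 : x = a
      · rw [if_pos h3, if_neg (fun h => h1 ⟨h3, h⟩), add_zero]
      · rw [if_neg h3, add_zero]
  rw [finsum_congr key, finsum_add_distrib, finsum_eq_single _ a (fun x hx => if_neg hx),
    finsum_eq_single _ b (fun x hx => if_neg hx), if_pos rfl, if_pos rfl, ← sub_eq_add_neg]
  · exact (Set.finite_singleton a).subset fun x hx => by
      by_contra h
      exact hx (if_neg h)
  · exact (Set.finite_singleton b).subset fun x hx => by
      by_contra h
      exact hx (if_neg h)

end lift

/-- Arcs avoiding a point lift to intervals avoiding its preimages. -/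
lemma exists_lift {I : Set Circle} (hI : IsArc I) {c : ℝ} (hc : Circle.exp c ∉ I) :
    ∃ s : Set ℝ, s.OrdConnected ∧ s ⊆ Ioo c (c + 2 * Real.pi) ∧ I = Circle.exp '' s := by
  obtain ⟨t, ht, rfl⟩ := hI
  rcases t.eq_empty_or_nonempty with rfl | ⟨x, hx⟩
  · exact ⟨∅, ordConnected_empty, empty_subset _, rfl⟩
  -- The translate that brings one point of `t` into the period brings all of `t` there, since `t`
  -- is an interval and omits the preimages of the excluded point at both ends of that period.
  set k := toIcoDiv Real.two_pi_pos c x with hk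
  set d := k • (2 * Real.pi) with hd
  have hexp : ∀ y, Circle.exp (y + d) = Circle.exp y := fun y => Circle.periodic_exp.zsmul k y
  have hxm := toIcoMod_mem_Ico Real.two_pi_pos c x
  rw [← self_sub_toIcoDiv_zsmul] at hxm
  have h1 : c + d ∉ t := fun h => hc ⟨_, h, hexp c⟩
  have h2 : c + 2 * Real.pi + d ∉ t := fun h => hc ⟨_, h, by rw [hexp, Circle.periodic_exp]⟩
  refine ⟨(fun y => y + d) ⁻¹' t, ⟨fun y hy z hz w hw => ht.out hy hz
    ⟨by simpa using hw.1, by simpa using hw.2⟩⟩, fun y hy => ⟨?_, ?_⟩, ?_⟩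
  · by_contra! h
    exact h1 (ht.out hy hx ⟨by linarith, by linarith [hxm.1]⟩)
  · by_contra! h
    exact h2 (ht.out hx hy ⟨by linarith [hxm.2], by linarith⟩)
  · ext p
    constructor
    · rintro ⟨y, hy, rfl⟩
      exact ⟨y - d, by simpa using hy, by rw [← hexp (y - d), sub_add_cancel]⟩
    · rintro ⟨y, hy, rfl⟩
      exact ⟨y + d, hy, hexp y⟩

lemma IsArc.isTame {I : Set Circle} (hI : IsArc I) : IsTame I := by
  by_cases hu : I = univ
  · rw [hu]; exact isTame_univ
  obtain ⟨p, hp⟩ := (ne_univ_iff_exists_notMem I).1 hu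
  obtain ⟨c, rfl⟩ := Circle.exp_surjective p
  obtain ⟨s, hs, hsub, rfl⟩ := exists_lift hI hp
  exact isTame_image hs hsub

lemma inv_preimage_image (s : Set ℝ) :
    (fun p : Circle => p⁻¹) ⁻¹' (Circle.exp '' s) = Circle.exp '' (-s) := by
  ext p
  constructor
  · rintro ⟨y, hy, h⟩
    exact ⟨-y, by simpa using hy, by rw [Circle.exp_neg, h]; simp⟩
  · rintro ⟨y, hy, rfl⟩
    exact ⟨-y, hy, by simp [Circle.exp_neg]⟩

lemma IsArc.inv {I : Set Circle} (hI : IsArc I) : IsArc ((fun p : Circle => p⁻¹) ⁻¹' I) := by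
  obtain ⟨s, hs, rfl⟩ := hI
  refine ⟨-s, ⟨fun x hx y hy z hz => ?_⟩, inv_preimage_image s⟩
  exact hs.out hy hx ⟨by linarith [hz.2], by linarith [hz.1]⟩

end KorenblumType

namespace KorenblumType

variable {Λ : Majorant} {M : ℝ} {F : ℝ → ℝ} {s : Set ℝ} {a b c : ℝ}

/-! ### The premeasure of a distribution function -/

/-- The mass given to `I` by the distribution function `F`. -/
def massOf (F : ℝ → ℝ) (I : Set Circle) : ℝ :=
  jumpSum (fun p => Function.rightLim F (-Complex.arg (p : ℂ))) ((fun p : Circle => p⁻¹) ⁻¹' I) -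
    jumpSum (fun p => Function.leftLim F (Complex.arg (p : ℂ))) I

lemma massOf_univ (F : ℝ → ℝ) : massOf F univ = 0 := by
  simp [massOf, jumpSum, jump_univ]

lemma massOf_empty (F : ℝ → ℝ) : massOf F ∅ = 0 := by
  simp [massOf, jumpSum, jump_empty]

/-- Jump sums are intrinsic to the subset of the circle, so no compatible lifts of `I`, `J` and
their union have to be chosen. -/
lemma massOf_union (F : ℝ → ℝ) {I J : Set Circle} (hI : IsArc I) (hJ : IsArc J)
    (h : Disjoint I J) : massOf F (I ∪ J) = massOf F I + massOf F J := by
  unfold massOf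
  rw [preimage_union, jumpSum_union hI.isTame hJ.isTame h,
    jumpSum_union hI.inv.isTame hJ.inv.isTame (h.preimage _)]
  ring

lemma periodic_arg_exp {G : ℝ → ℝ} (hG : Function.Periodic G (2 * Real.pi)) (x : ℝ) :
    G (Complex.arg (Circle.exp x : ℂ)) = G x := by
  obtain ⟨m, hm⟩ := Circle.exp_eq_exp.1 (Circle.exp_arg (Circle.exp x))
  rw [hm]
  exact hG.int_mul m x

-- The jump sum of the arc itself accounts for the left limits of `F`, and that of the inverted arc
-- for the right limits: reflection turns a right end point belonging to the arc into a left end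
-- point belonging to the inverted arc.
open Classical in
lemma massOf_image (h : UpperMod Λ M F) (hM : 0 ≤ M) (hper : Function.Periodic F (2 * Real.pi))
    (hs : s.OrdConnected) (hne : s.Nonempty) (hsub : s ⊆ Ioo c (c + 2 * Real.pi))
    (ha : IsGLB s a) (hb : IsLUB s b) :
    massOf F (Circle.exp '' s) =
      (if b ∈ s then Function.rightLim F b else Function.leftLim F b) -
        if a ∈ s then Function.leftLim F a else Function.rightLim F a := by
  have hl := periodic_arg_exp (h.leftLim_periodic hM hper)
  have hr : ∀ x : ℝ, Function.rightLim F (-Complex.arg (Circle.exp x : ℂ)) =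
      Function.rightLim F (-x) :=
    periodic_arg_exp (G := fun x => Function.rightLim F (-x)) fun x => by
      have := h.rightLim_periodic hM hper (-(x + 2 * Real.pi))
      simp only at this ⊢
      rw [← this]; congr 1; ring
  have hs' : (-s).OrdConnected := ⟨fun x hx y hy z hz =>
    hs.out hy hx ⟨by linarith [hz.2], by linarith [hz.1]⟩⟩
  have hsub' : -s ⊆ Ioo (-(c + 2 * Real.pi)) (-(c + 2 * Real.pi) + 2 * Real.pi) := fun x hx => by
    have := hsub hx
    exact ⟨by linarith [this.2], by linarith [this.1]⟩
  unfold massOf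
  rw [inv_preimage_image, jumpSum_image hs hne hsub ha hb,
    jumpSum_image hs' (by simpa using hne) hsub' hb.neg ha.neg]
  simp only [hl, hr, Set.mem_neg, neg_neg]
  split_ifs <;> ring

open Classical in
/-- The masses are limits of increments of the distribution function. -/
lemma tendsto_massOf_image (h : UpperMod Λ M F) (hM : 0 ≤ M)
    (hper : Function.Periodic F (2 * Real.pi)) (hs : s.OrdConnected) (hne : s.Nonempty)
    (hsub : s ⊆ Ioo c (c + 2 * Real.pi)) (ha : IsGLB s a) (hb : IsLUB s b) :
    Tendsto (fun t : ℝ => F (if b ∈ s then b + t else b - t) - F (if a ∈ s then a - t else a + t))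
      (𝓝[>] 0) (𝓝 (massOf F (Circle.exp '' s))) := by
  rw [massOf_image h hM hper hs hne hsub ha hb]
  refine Tendsto.sub ?_ ?_
  · split_ifs
    · exact h.tendsto_rightLim_add hM b
    · exact h.tendsto_leftLim_sub hM b
  · split_ifs
    · exact h.tendsto_leftLim_sub hM a
    · exact h.tendsto_rightLim_add hM a

lemma lt_of_not_mem_ends (hne : s.Nonempty) (ha : IsGLB s a) (hb : IsLUB s b)
    (h : a ∉ s ∨ b ∉ s) : a < b := by
  obtain ⟨y, hy⟩ := hne
  have h1 := ha.1 hy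
  have h2 := hb.1 hy
  refine lt_of_le_of_ne (h1.trans h2) fun hab => ?_
  have e1 : y = a := le_antisymm (hab ▸ h2) h1
  have e2 : y = b := e1.trans hab
  exact h.elim (fun h => h (e1 ▸ hy)) fun h => h (e2 ▸ hy)

-- An end point in `s` is moved slightly outwards and stays in `U` because `U` is open; one not in
-- `s` is moved inwards and lands in `s`.
open Classical in
lemma eventually_ends_mem (hs : s.OrdConnected) (hne : s.Nonempty) (ha : IsGLB s a)
    (hb : IsLUB s b) {U : Set ℝ} (hU : IsOpen U) (hsU : s ⊆ U) :
    ∀ᶠ t in 𝓝[>] (0 : ℝ), (if b ∈ s then b + t else b - t) ∈ U ∧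
      (if a ∈ s then a - t else a + t) ∈ U := by
  have hio := Ioo_subset_of_isGLB_isLUB hs ha hb
  refine Eventually.and ?_ ?_
  · split_ifs with h
    · have := (continuous_const_add b).tendsto 0
      rw [add_zero] at this
      exact (this.mono_left nhdsWithin_le_nhds).eventually (hU.mem_nhds (hsU h))
    · have hab := lt_of_not_mem_ends hne ha hb (Or.inr h)
      filter_upwards [Ioo_mem_nhdsGT (sub_pos.2 hab)] with t ht
      exact hsU (hio ⟨by linarith [ht.2], by linarith [ht.1]⟩)
  · split_ifs with h
    · have := (continuous_sub_left a).tendsto 0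
      rw [sub_zero] at this
      exact (this.mono_left nhdsWithin_le_nhds).eventually (hU.mem_nhds (hsU h))
    · have hab := lt_of_not_mem_ends hne ha hb (Or.inl h)
      filter_upwards [Ioo_mem_nhdsGT (sub_pos.2 hab)] with t ht
      exact hsU (hio ⟨by linarith [ht.1], by linarith [ht.2]⟩)

lemma abs_massOf_image_le (h : UpperMod Λ M F) (hM : 0 ≤ M)
    (hper : Function.Periodic F (2 * Real.pi)) (hs : s.OrdConnected) (hne : s.Nonempty)
    (hsub : s ⊆ Ioo c (c + 2 * Real.pi)) {U : Set ℝ} (hU : IsOpen U) (hsU : s ⊆ U) {ε : ℝ}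
    (hε : ∀ u ∈ U, ∀ v ∈ U, |F u - F v| ≤ ε) : |massOf F (Circle.exp '' s)| ≤ ε := by
  classical
  have ha := isGLB_csInf hne (bddBelow_Ioo.mono hsub)
  have hb := isLUB_csSup hne (bddAbove_Ioo.mono hsub)
  refine le_of_tendsto (tendsto_massOf_image h hM hper hs hne hsub ha hb).abs ?_
  filter_upwards [eventually_ends_mem hs hne ha hb hU hsU] with t ht
  exact hε _ ht.1 _ ht.2

lemma massOf_image_le (h : UpperMod Λ M F) (hM : 0 ≤ M)
    (hper : Function.Periodic F (2 * Real.pi)) (hs : s.OrdConnected) (hne : s.Nonempty)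
    (hsub : s ⊆ Ioo c (c + 2 * Real.pi)) (ha : IsGLB s a) (hb : IsLUB s b) :
    massOf F (Circle.exp '' s) ≤ M * Λ.kap (b - a) := by
  classical
  have hπ := Real.two_pi_pos
  have hca : c ≤ a := ha.2 fun y hy => (hsub hy).1.le
  have hbc : b ≤ c + 2 * Real.pi := hb.2 fun y hy => (hsub hy).2.le
  have hab : a ≤ b := by
    obtain ⟨y, hy⟩ := hne
    exact (ha.1 hy).trans (hb.1 hy)
  set u : ℝ → ℝ := fun t => if b ∈ s then b + t else b - t with hu
  set v : ℝ → ℝ := fun t => if a ∈ s then a - t else a + t with hv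
  have huc : Continuous u := by rw [hu]; split_ifs <;> fun_prop
  have hvc : Continuous v := by rw [hv]; split_ifs <;> fun_prop
  have hw : Tendsto (fun t => u t - v t) (𝓝[>] 0) (𝓝 (b - a)) := by
    have := (huc.tendsto 0).sub (hvc.tendsto 0)
    have e : u 0 - v 0 = b - a := by simp [hu, hv]
    rw [e] at this
    exact this.mono_left nhdsWithin_le_nhds
  -- Only the degenerate lengths `0` and `2π` require care, as there the perturbed interval might
  -- leave the range where the modulus applies. Length `0` means a single point, whose ends move
  -- outwards; length `2π` means that neither end belongs to `s`, so both move inwards.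
  have hge : ∀ᶠ t in 𝓝[>] (0 : ℝ), 0 ≤ u t - v t := by
    rcases hab.eq_or_lt with hab' | hab'
    · have h1 : a ∈ s ∧ b ∈ s := by
        by_contra hcon
        exact (lt_of_not_mem_ends hne ha hb (not_and_or.1 hcon)).ne hab'
      filter_upwards [self_mem_nhdsWithin] with t ht
      have ht : 0 < t := ht
      simp only [hu, hv, if_pos h1.1, if_pos h1.2]
      linarith
    · exact (hw.eventually (lt_mem_nhds (sub_pos.2 hab'))).mono fun t ht => le_of_lt ht
  have hle : ∀ᶠ t in 𝓝[>] (0 : ℝ), u t - v t ≤ 2 * Real.pi := by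
    rcases (show b - a ≤ 2 * Real.pi by linarith).eq_or_lt with hab' | hab'
    · have h1 : a ∉ s := fun h => by linarith [(hsub h).1]
      have h2 : b ∉ s := fun h => by linarith [(hsub h).2]
      filter_upwards [self_mem_nhdsWithin] with t ht
      have ht : 0 < t := ht
      simp only [hu, hv, if_neg h1, if_neg h2]
      linarith
    · exact (hw.eventually (gt_mem_nhds hab')).mono fun t ht => le_of_lt ht
  have hk : Tendsto (fun t => M * Λ.kap (u t - v t)) (𝓝[>] 0) (𝓝 (M * Λ.kap (b - a))) := by
    refine Tendsto.const_mul _ ?_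
    have hcw := Λ.kap_continuousOn (b - a) ⟨by linarith, by linarith⟩
    exact hcw.tendsto.comp (tendsto_nhdsWithin_iff.2 ⟨hw, hge.and hle⟩)
  refine le_of_tendsto_of_tendsto (tendsto_massOf_image h hM hper hs hne hsub ha hb) hk ?_
  filter_upwards [hge, hle] with t h1 h2
  exact h _ _ (by linarith) (by linarith)

/-- The normalized measure is computed over `[0, 2π)`, whereas the lift lies in another period;
periodicity of the indicator of the full preimage allows the period to be moved. -/
lemma circleMeasure_lift (hs : s.OrdConnected) (hne : s.Nonempty)
    (hsub : s ⊆ Ioo c (c + 2 * Real.pi)) (ha : IsGLB s a) (hb : IsLUB s b) :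
    circleMeasure (Circle.exp '' s) = (b - a) / (2 * Real.pi) := by
  have hπ := Real.two_pi_pos
  set S : Set ℝ := {θ | Circle.exp θ ∈ Circle.exp '' s} with hS
  have hab : a ≤ b := by
    obtain ⟨y, hy⟩ := hne
    exact (ha.1 hy).trans (hb.1 hy)
  have hmeas : MeasurableSet S := by
    have : S = ⋃ k : ℤ, (fun θ : ℝ => θ + k * (2 * Real.pi)) ⁻¹' s := by
      ext θ
      simp only [hS, mem_ofPred_eq, mem_image, mem_iUnion, mem_preimage]
      constructor
      · rintro ⟨y, hy, h⟩
        obtain ⟨m, hm⟩ := Circle.exp_eq_exp.1 h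
        exact ⟨m, hm ▸ hy⟩
      · rintro ⟨k, hk⟩
        exact ⟨_, hk, Circle.exp_eq_exp.2 ⟨k, rfl⟩⟩
    rw [this]
    exact MeasurableSet.iUnion fun k => (measurable_id.add_const _) hs.measurableSet
  have hper : Function.Periodic (S.indicator (1 : ℝ → ℝ)) (2 * Real.pi) := fun θ => by
    have : θ + 2 * Real.pi ∈ S ↔ θ ∈ S := by simp only [hS, mem_ofPred_eq, Circle.periodic_exp θ]
    by_cases h : θ ∈ S <;> simp [h, this]
  have h1 : circleMeasure (Circle.exp '' s) =
      (∫ θ in (0 : ℝ)..(0 + 2 * Real.pi), S.indicator (1 : ℝ → ℝ) θ) / (2 * Real.pi) := by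
    unfold circleMeasure
    rw [zero_add, intervalIntegral.integral_of_le hπ.le, ← integral_Ico_eq_integral_Ioc,
      integral_indicator_one hmeas, measureReal_restrict_apply hmeas]
    congr 2
    ext θ; simp [hS, and_comm]
  rw [h1, hper.intervalIntegral_add_eq 0 c, intervalIntegral.integral_of_le (by linarith),
    integral_indicator_one hmeas, measureReal_restrict_apply hmeas]
  have h2 : S ∩ Ioc c (c + 2 * Real.pi) = s := by
    ext θ
    constructor
    · rintro ⟨h3, h4⟩
      exact (exp_mem_image_lift hsub h4).1 h3
    · intro h3
      exact ⟨⟨θ, h3, rfl⟩, Ioo_subset_Ioc_self (hsub h3)⟩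
  rw [h2]
  congr 1
  refine le_antisymm ?_ ?_
  · have h3 : s ⊆ Icc a b := fun y hy => ⟨ha.1 hy, hb.1 hy⟩
    refine (measureReal_mono h3 measure_Icc_lt_top.ne).trans ?_
    rw [Real.volume_real_Icc_of_le hab]
  · have h3 := measureReal_mono (μ := volume) (Ioo_subset_of_isGLB_isLUB hs ha hb)
      ((measure_mono hsub).trans_lt measure_Ioo_lt_top).ne
    rwa [Real.volume_real_Ioo_of_le hab] at h3

/-- Nested intervals with empty intersection end up close to a point, on one side of it. -/
lemma exists_one_sided {S : ℕ → Set ℝ} (hs : ∀ n, (S n).OrdConnected) (hne : ∀ n, (S n).Nonempty)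
    {A B : ℝ} (hsub : ∀ n, S n ⊆ Icc A B) (hanti : Antitone S) (hempty : ⋂ n, S n = ∅) :
    ∃ q, ∀ δ > 0, ∃ N, S N ⊆ Ioo (q - δ) q ∨ S N ⊆ Ioo q (q + δ) := by
  have hcl : (⋂ n, closure (S n)).Nonempty :=
    IsCompact.nonempty_iInter_of_sequence_nonempty_isCompact_isClosed _
      (fun n => closure_mono (hanti n.le_succ)) (fun n => (hne n).closure)
      (isCompact_Icc.of_isClosed_subset isClosed_closure
        (closure_minimal (hsub 0) isClosed_Icc)) fun n => isClosed_closure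
  obtain ⟨q, hq⟩ := hcl
  have hout : ∀ x, ∃ N, ∀ n ≥ N, x ∉ S n := fun x => by
    have : x ∉ ⋂ n, S n := by rw [hempty]; exact notMem_empty x
    rw [mem_iInter, not_forall] at this
    obtain ⟨N, hN⟩ := this
    exact ⟨N, fun n hn h => hN (hanti hn h)⟩
  refine ⟨q, fun δ hδ => ?_⟩
  -- The three points `q - δ`, `q`, `q + δ` eventually leave the nested intervals. Each later
  -- interval still has points within `δ` of `q`, so it is trapped between two neighbouring points
  -- of the three.
  obtain ⟨N₁, h1⟩ := hout (q - δ)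
  obtain ⟨N₂, h2⟩ := hout q
  obtain ⟨N₃, h3⟩ := hout (q + δ)
  set N := max N₁ (max N₂ N₃)
  have h1 := h1 N (le_max_left _ _)
  have h2 := h2 N ((le_max_left _ _).trans (le_max_right _ _))
  have h3 := h3 N ((le_max_right _ _).trans (le_max_right _ _))
  obtain ⟨y, hy1, hy2⟩ := mem_closure_iff_nhds.1 (mem_iInter.1 hq N) _
    (Ioo_mem_nhds (show q - δ < q by linarith) (show q < q + δ by linarith))
  have hyq : y ≠ q := fun h => h2 (h ▸ hy2)
  refine ⟨N, hyq.lt_or_gt.imp (fun hlt x hx => ⟨?_, ?_⟩) fun hlt x hx => ⟨?_, ?_⟩⟩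
  · by_contra! h
    exact h1 ((hs N).out hx hy2 ⟨h, hy1.1.le⟩)
  · by_contra! h
    exact h2 ((hs N).out hy2 hx ⟨hlt.le, h⟩)
  · by_contra! h
    exact h2 ((hs N).out hx hy2 ⟨h, hlt.le⟩)
  · by_contra! h
    exact h3 ((hs N).out hy2 hx ⟨hy1.2.le, h⟩)

/-- Nested arcs with empty intersection eventually avoid the point `1`, hence lift to a common
period, and their lifts concentrate on one side of a point `q`. The one-sided limit of `F` at `q`
makes the oscillation of `F`, and with it the mass, small. -/
lemma tendsto_massOf (h : UpperMod Λ M F) (hM : 0 ≤ M) (hper : Function.Periodic F (2 * Real.pi))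
    {I : ℕ → Set Circle} (hI : ∀ n, IsArc (I n)) (hanti : ∀ n, I (n + 1) ⊆ I n)
    (hempty : ⋂ n, I n = ∅) : Tendsto (fun n => massOf F (I n)) atTop (𝓝 0) := by
  have hanti' : Antitone I := antitone_nat_of_succ_le hanti
  by_cases hnon : ∃ n, I n = ∅
  · obtain ⟨n, hn⟩ := hnon
    refine tendsto_const_nhds.congr' ?_
    filter_upwards [eventually_ge_atTop n] with m hm
    rw [subset_empty_iff.1 ((hanti' hm).trans hn.subset), massOf_empty]
  push Not at hnon
  obtain ⟨n₀, hn₀⟩ : ∃ n₀, Circle.exp 0 ∉ I n₀ := by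
    have : Circle.exp 0 ∉ ⋂ n, I n := by rw [hempty]; exact notMem_empty _
    rwa [mem_iInter, not_forall] at this
  choose S hS hSsub hSI using fun n => exists_lift (hI (n + n₀))
    (c := 0) fun hc => hn₀ (hanti' (Nat.le_add_left n₀ n) hc)
  have hSne : ∀ n, (S n).Nonempty := fun n => by
    have := hnon (n + n₀)
    rw [hSI] at this
    exact this.of_image
  have hSanti : Antitone S := antitone_nat_of_succ_le fun n y hy => by
    have h1 : Circle.exp y ∈ I (n + n₀) := by
      have : Circle.exp y ∈ I (n + 1 + n₀) := by rw [hSI]; exact mem_image_of_mem _ hy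
      exact hanti' (by omega) this
    rw [hSI] at h1
    exact (exp_mem_image_lift (hSsub n) (Ioo_subset_Ioc_self (hSsub _ hy))).1 h1
  have hSempty : ⋂ n, S n = ∅ := by
    refine eq_empty_of_forall_notMem fun y hy => ?_
    have : Circle.exp y ∈ ⋂ n, I n := mem_iInter.2 fun n => by
      have h1 : Circle.exp y ∈ I (n + n₀) := by
        rw [hSI]; exact mem_image_of_mem _ (mem_iInter.1 hy n)
      exact hanti' (Nat.le_add_right n n₀) h1
    rw [hempty] at this
    exact this
  obtain ⟨q, hq⟩ := exists_one_sided hS hSne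
    (fun n => (hSsub n).trans Ioo_subset_Icc_self) hSanti hSempty
  rw [Metric.tendsto_atTop]
  intro ε hε
  have hosc : ∀ {l : Filter ℝ} {L : ℝ}, Tendsto F l (𝓝 L) →
      ∀ᶠ x in l, |F x - L| < ε / 4 := fun hF => by
    have := (Metric.tendsto_nhds.1 hF) (ε / 4) (by positivity)
    simpa only [Real.dist_eq] using this
  obtain ⟨l, hl, hl2⟩ := (mem_nhdsLT_iff_exists_Ioo_subset.1 (hosc (h.tendsto_leftLim hM q)))
  obtain ⟨r, hr, hr2⟩ := (mem_nhdsGT_iff_exists_Ioo_subset.1 (hosc (h.tendsto_rightLim hM q)))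
  have hl' : l < q := hl
  have hr' : q < r := hr
  obtain ⟨N, hN⟩ := hq (min (q - l) (r - q)) (lt_min (by linarith) (by linarith))
  obtain ⟨U, hU, hNU, hUε⟩ : ∃ U : Set ℝ, IsOpen U ∧ S N ⊆ U ∧
      ∀ u ∈ U, ∀ v ∈ U, |F u - F v| ≤ ε / 2 := by
    rcases hN with hN | hN
    · refine ⟨Ioo l q, isOpen_Ioo, hN.trans (Ioo_subset_Ioo_left ?_), fun u hu v hv => ?_⟩
      · linarith [min_le_left (q - l) (r - q)]
      · have h1 : |F u - Function.leftLim F q| < ε / 4 := hl2 hu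
        have h2 : |F v - Function.leftLim F q| < ε / 4 := hl2 hv
        rw [abs_lt] at h1 h2
        rw [_root_.abs_le]; constructor <;> linarith
    · refine ⟨Ioo q r, isOpen_Ioo, hN.trans (Ioo_subset_Ioo_right ?_), fun u hu v hv => ?_⟩
      · linarith [min_le_right (q - l) (r - q)]
      · have h1 : |F u - Function.rightLim F q| < ε / 4 := hr2 hu
        have h2 : |F v - Function.rightLim F q| < ε / 4 := hr2 hv
        rw [abs_lt] at h1 h2
        rw [_root_.abs_le]; constructor <;> linarith
  refine ⟨N + n₀, fun n hn => ?_⟩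
  obtain ⟨k, rfl⟩ := Nat.exists_eq_add_of_le' (le_trans (Nat.le_add_left n₀ N) hn)
  have h1 := abs_massOf_image_le h hM hper (hS k) (hSne k) (hSsub k) hU
    ((hSanti (show N ≤ k by omega)).trans hNU) hUε
  rw [← hSI] at h1
  rw [Real.dist_eq, sub_zero]
  linarith

/-- The premeasure with a given distribution function. -/
def UpperMod.premeasure (h : UpperMod Λ M F) (hM : 0 ≤ M)
    (hper : Function.Periodic F (2 * Real.pi)) : Premeasure where
  toFun I := massOf F I
  map_whole := massOf_univ F
  map_union I J K hd hK := by rw [hK, massOf_union F I.2 J.2 hd]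
  tendsto_zero I hanti hempty := tendsto_massOf h hM hper (fun n => (I n).2) hanti hempty

lemma UpperMod.premeasure_isBounded (h : UpperMod Λ M F) (hM : 0 ≤ M)
    (hper : Function.Periodic F (2 * Real.pi)) : (h.premeasure hM hper).IsBounded Λ := by
  have hπ := Real.two_pi_pos
  -- The constant must be strictly positive, while `M` may be zero.
  refine ⟨M + 1, by positivity, fun I => ?_⟩
  change massOf F I ≤ _
  obtain ⟨I, hI⟩ := I
  change massOf F I ≤ (M + 1) * (circleMeasure I * Λ (circleMeasure I))
  by_cases hu : I = univ
  · have h1 : circleMeasure I = 1 := by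
      rw [hu]
      have : {θ : ℝ | θ ∈ Ico 0 (2 * Real.pi) ∧ Circle.exp θ ∈ (univ : Set Circle)} =
        Ico 0 (2 * Real.pi) := by ext; simp
      rw [circleMeasure, this, Real.volume_real_Ico_of_le hπ.le, sub_zero, div_self hπ.ne']
    rw [h1, hu, massOf_univ]
    have := Λ.pos 1 ⟨one_pos, le_rfl⟩
    positivity
  obtain ⟨p, hp⟩ := (ne_univ_iff_exists_notMem I).1 hu
  obtain ⟨c, rfl⟩ := Circle.exp_surjective p
  obtain ⟨s, hs, hsub, rfl⟩ := exists_lift hI hp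
  rcases s.eq_empty_or_nonempty with rfl | hne
  · rw [image_empty, massOf_empty]
    simp [circleMeasure]
  have ha := isGLB_csInf hne (bddBelow_Ioo.mono hsub)
  have hb := isLUB_csSup hne (bddAbove_Ioo.mono hsub)
  have hab : sInf s ≤ sSup s := by
    obtain ⟨y, hy⟩ := hne
    exact (ha.1 hy).trans (hb.1 hy)
  have hca : c ≤ sInf s := ha.2 fun y hy => (hsub hy).1.le
  have hbc : sSup s ≤ c + 2 * Real.pi := hb.2 fun y hy => (hsub hy).2.le
  rw [circleMeasure_lift hs hne hsub ha hb]
  refine (massOf_image_le h hM hper hs hne hsub ha hb).trans ?_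
  exact mul_le_mul_of_nonneg_right (by linarith) (Λ.kap_nonneg (by linarith) (by linarith))

lemma UpperMod.dist_premeasure (h : UpperMod Λ M F) (hM : 0 ≤ M)
    (hper : Function.Periodic F (2 * Real.pi)) {θ : ℝ} (h0 : 0 < θ) (h1 : θ < 2 * Real.pi) :
    (h.premeasure hM hper).dist θ = Function.leftLim F θ - Function.leftLim F 0 := by
  classical
  -- This `c` centres a period around `[0, θ)`: `c < 0` and `θ < c + 2π` both amount to `θ < 2π`.
  have h2 := massOf_image h hM hper (s := Ico 0 θ) (c := (θ - 2 * Real.pi) / 2) ordConnected_Ico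
    ⟨0, le_rfl, h0⟩ (fun x hx => ⟨by linarith [hx.1], by linarith [hx.2]⟩)
    (isGLB_Ico h0) (isLUB_Ico h0)
  rw [if_neg (by simp), if_pos ⟨le_rfl, h0⟩] at h2
  exact h2

/-- The distribution function of the premeasure differs from `F` by passing to left limits and by an
additive constant. The first does not change the transform by `herg_leftLim`, the second because the
kernel has integral zero over a period. -/
lemma UpperMod.expHerglotz_premeasure (h : UpperMod Λ M F) (hM : 0 ≤ M)
    (hper : Function.Periodic F (2 * Real.pi)) (h0 : F 0 = 0) (z : 𝔻) :
    (h.premeasure hM hper).expHerglotz z = Complex.exp (herg F z) := by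
  have hz := z.norm_lt_one
  rw [Premeasure.expHerglotz_eq, herg_congr (G := fun θ => Function.leftLim F θ - Function.leftLim F 0)
    fun θ h1 h2 => h.dist_premeasure hM hper h1 h2]
  congr 1
  rw [← h.herg_leftLim hM hper h0 hz]
  have hi : IntervalIntegrable (Function.leftLim F) volume 0 (2 * Real.pi) := by
    have h1 : UpperMod Λ M fun x => Function.leftLim F x - Function.leftLim F 0 :=
      fun a b hab hb => by simpa using h.leftLim hM a b hab hb
    have h2 := (h1.intervalIntegrable hM
      (fun x => congrArg (· - Function.leftLim F 0) (h.leftLim_periodic hM hper x)) (sub_self _)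
      0 (2 * Real.pi)).add (intervalIntegrable_const (c := Function.leftLim F 0))
    refine h2.congr fun x _ => ?_
    simp
  rw [herg_sub hi (by simp) hz]
  simp [herg, integral_dker hz]

end KorenblumType

end

theorem theorem4p1 (Λ : KorenblumType.Majorant) (f : KorenblumType.KorenblumSpace Λ)
    (hf : ∀ z : Complex.UnitDisc, f z ≠ 0) (hf0 : f 0 = 1) :
    (∃ μ : KorenblumType.Premeasure, μ.IsBounded Λ ∧ ∀ z, f z = μ.expHerglotz z) ∧
    ∀ μ : KorenblumType.Premeasure, μ.IsBounded Λ → (∀ z, f z = μ.expHerglotz z) →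
      (∀ F : Set Circle, KorenblumType.IsCarlesonSet Λ F → μ.singularPart F = 0) →
      f.IsCyclicVector := by
  refine ⟨?_, fun μ hb h hs => KorenblumType.isCyclicVector_of_singularPart_eq_zero hb h hs⟩
  obtain ⟨F, M, hM, hF, hper, h0, hfF⟩ := KorenblumType.exists_eq_exp_herg f hf hf0
  exact ⟨hF.premeasure hM hper, hF.premeasure_isBounded hM hper, fun z => by
    rw [hfF, hF.expHerglotz_premeasure hM hper h0]⟩
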